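/- **Model.** Let $(X_i,\varepsilon_i)_{i\ge 1}$ be i.i.d. pairs of real random variables with $\varepsilon_i$ independent of $X_i$, $\mathbb E[\varepsilon_i]=0$, $\mathrm{Var}(\varepsilon_i)=\sigma^2>0$ (fixed), and let $Y_i=f(X_i)+\varepsilon_i$. Write $(X,Y)$ for a generic pair $(X_1,Y_1)$. Assume that $X\in[a,b]$ almost surely; that $f$ is continuous on $[a,b]$ and there are $a=t_0<t_1<\dots<t_J=b$ $(J\ge 1)$ and constants $0<c_f\le C_f$ such that on each $(t_{j-1},t_j)$ the function $f$ is $C^1$ and strictly monotone with $c_f\le|f'|\le C_f$; and that $\varepsilon$ is sub-Gaussian with a continuous density. **Cross-fitting.** Fix $K\ge 2$ and, for each $n$, a deterministic partition of $\{1,\dots,n\}$ into $K$ folds; $k(i)$ is the fold of $i$. For each $n$ and each fold $k$ let $\widehat f_n^{(-k)},\widehat g_n^{(-k)}:\mathbb R\to\mathbb R$ be (measurable) regressors computed from the observations $(X_j,Y_j)$, $j\le n$, outside fold $k$, such that $\mathbb E\|\widehat f_n^{(-k)}-f\|_{L^2(P_X)}^2\to 0$ for each $k$. **Scores.** For $0<\alpha<\beta$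 and a cloud $\mathcal R\subset\mathbb R^2$ of $N\ge 2$ points put $$\overline{\mathrm{TP}}^{[\alpha,\beta]}(\mathcal R)=\frac1{(N-1)(\beta-\alpha)}\sum_{e\in \mathrm{MST}(\mathcal R)}\bigl(\min\{w(e),\beta\}-\alpha\bigr)_+ ,$$ where $\mathrm{MST}(\mathcal R)$ is a Euclidean minimum spanning tree of $\mathcal R$ and $w(e)$ is the Euclidean length of the edge $e$ (the score is $0$ if $N\le 1$). For a sample of $n$ numbers let $T_n=\mathrm{rank}/(n+1)$, with ties broken by the index. The forward cloud $\widetilde{\mathcal R}^{(n)}_{Y\mid X}$ consists of the points $\bigl(T_n(X_i),\,T_n(Y_i-\widehat f_n^{(-k(i))}(X_i))\bigr)$, $i\le n$. **Binned reverse cloud.** Let $B_n$ be positive integers with $B_n\to\infty$, $B_n=o(n)$ and $B_n^{7/3}\log B_n/n\to 0$. Let $U_i=T_n(Y_i)$, $J_b=\{i\le n:U_i\in((b-1)/B_n,b/B_n]\}$, $N_b=|J_b|$ $(1\le b\le B_n)$, and let $m_n$ be the number of $b$ with $N_b\ge 1$. The binned reverse cloud is $$\widehat{\mathcal R}^{(n)}_{X\mid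 Y}=\Bigl\{\Bigl(\tfrac1{N_b}\sum_{i\in J_b}U_i,\ \tfrac1{N_b}\sum_{i\in J_b}\bigl(X_i-\widehat g_n^{(-k(i))}(Y_i)\bigr)\Bigr):N_b\ge 1\Bigr\}.$$ Fix $\kappa>0$ and $c_\beta>1$ and put $\alpha_n=\kappa n^{-2/3}$, $\beta_n=c_\beta\alpha_n$, $\widetilde\alpha_n=\kappa m_n^{-2/3}$, $\widetilde\beta_n=c_\beta\widetilde\alpha_n$. With $m(y)=\mathbb E[X\mid Y=y]$ and $\xi=X-m(Y)$, assume that there is a constant $K_0$ such that the conditional law of $\xi$ given $Y=y$ has $\psi_2$-norm at most $K_0\sigma$ for almost every $y$ with respect to the law of $Y$, where $\|Z\|_{\psi_2}=\inf\{t>0:\mathbb E\,e^{Z^2/t^2}\le 2\}$, and that $$\max_{b:N_b\ge 1}\Bigl|\frac1{N_b}\sum_{i\in J_b}\bigl(\widehat g_n^{(-k(i))}(Y_i)-m(Y_i)\bigr)\Bigr|=o_{\mathbb P}(\widetilde\alpha_n).$$ **Conclusion.** Then $$\overline{\mathrm{TP}}^{[\alpha_n,\beta_n]}\bigl(\widetilde{\mathcal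 R}^{(n)}_{Y\mid X}\bigr)\xrightarrow{\mathbb P}1,\qquad \overline{\mathrm{TP}}^{[\widetilde\alpha_n,\widetilde\beta_n]}\bigl(\widehat{\mathcal R}^{(n)}_{X\mid Y}\bigr)\xrightarrow{\mathbb P}0 .$$ Hence the TRA-s score difference $$\widetilde\Delta_{0,n}=\overline{\mathrm{TP}}^{[\alpha_n,\beta_n]}\bigl(\widetilde{\mathcal R}^{(n)}_{Y\mid X}\bigr)-\overline{\mathrm{TP}}^{[\widetilde\alpha_n,\widetilde\beta_n]}\bigl(\widehat{\mathcal R}^{(n)}_{X\mid Y}\bigr)\in[-1,1]$$ satisfies $\widetilde\Delta_{0,n}\xrightarrow{\mathbb P}1$ and $\mathbb E[\widetilde\Delta_{0,n}]\to 1$. -/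

import Mathlib

open MeasureTheory ProbabilityTheory Filter Topology Set
open scoped ENNReal

namespace TRA

noncomputable section

/-! ## Minimum spanning trees and the windowed score -/

/-- Euclidean length of an edge of the complete graph on the point family `Z`. -/
def edgeLength {ι : Type*} (Z : ι → EuclideanSpace ℝ (Fin 2)) : Sym2 ι → ℝ :=
  Sym2.lift ⟨fun i j => dist (Z i) (Z j), fun i j => dist_comm (Z i) (Z j)⟩

open Classical in
/-- Total Euclidean weight of a graph on the index set of `Z`. -/
def totalWeight {ι : Type*} [Fintype ι] (Z : ι → EuclideanSpace ℝ (Fin 2))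
    (T : SimpleGraph ι) : ℝ :=
  ∑ e ∈ T.edgeFinset, edgeLength Z e

/-- `T` is a Euclidean minimum spanning tree of the point family `Z`. -/
def IsMST {ι : Type*} [Fintype ι] (Z : ι → EuclideanSpace ℝ (Fin 2))
    (T : SimpleGraph ι) : Prop :=
  T.IsTree ∧ ∀ T' : SimpleGraph ι, T'.IsTree → totalWeight Z T ≤ totalWeight Z T'

/-- Every nonempty finite cloud has a minimum spanning tree. -/
theorem exists_isMST {ι : Type*} [Fintype ι] [Nonempty ι]
    (Z : ι → EuclideanSpace ℝ (Fin 2)) : ∃ T : SimpleGraph ι, IsMST Z T := by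
  classical
  obtain ⟨T₀, -, hT₀⟩ := (SimpleGraph.connected_top (V := ι)).exists_isTree_le
  obtain ⟨T, hT, hmin⟩ := Set.exists_min_image {T : SimpleGraph ι | T.IsTree}
    (totalWeight Z) (Set.toFinite _) ⟨T₀, hT₀⟩
  exact ⟨T, hT, hmin⟩

open Classical in
/-- A Euclidean minimum spanning tree of `Z` (the edgeless graph on an empty cloud). -/
def mst {ι : Type*} [Fintype ι] (Z : ι → EuclideanSpace ℝ (Fin 2)) : SimpleGraph ι :=
  if h : ∃ T : SimpleGraph ι, IsMST Z T then h.choose else ⊥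

/-- The soft window `(min {t, β} - α)₊`. -/
def window (α β t : ℝ) : ℝ := max (min t β - α) 0

open Classical in
/-- The normalized windowed score of a cloud, the sum of the windowed edge lengths over a
minimum spanning tree, divided by `(m - 1) (β - α)` for a cloud of `m` points. -/
def score {ι : Type*} [Fintype ι] (α β : ℝ) (Z : ι → EuclideanSpace ℝ (Fin 2)) : ℝ :=
  (∑ e ∈ (mst Z).edgeFinset, window α β (edgeLength Z e)) /
    (((Fintype.card ι : ℝ) - 1) * (β - α))

/-- The window scale `κ N ^ (-2/3)` for a cloud of `N` points. -/
def scale (κ : ℝ) (N : ℕ) : ℝ := κ * (N : ℝ) ^ (-(2 : ℝ) / 3)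

/-! ## Ranks, cross-fitting and the two clouds -/

open Classical in
/-- The rank of `u i` in the sample `u`, in `{1, …, n}`, ties being broken by the index. -/
def rank {n : ℕ} (u : Fin n → ℝ) (i : Fin n) : ℕ :=
  (Finset.univ.filter fun j => u j < u i ∨ (u j = u i ∧ j ≤ i)).card

/-- The empirical copula coordinate `rank / (n + 1)`. -/
def copulaRank {n : ℕ} (u : Fin n → ℝ) (i : Fin n) : ℝ := (rank u i : ℝ) / ((n : ℝ) + 1)

/-- A family of cross-fitted regressors for the fold assignment `fold`: the regressor of fold `k`
is a function of the observations outside fold `k` only. -/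
abbrev CrossFit {n K : ℕ} (fold : Fin n → Fin K) : Type :=
  (k : Fin K) → ({j : Fin n // fold j ≠ k} → ℝ × ℝ) → ℝ → ℝ

/-- The observations outside fold `k`. -/
def training {n K : ℕ} (fold : Fin n → Fin K) (k : Fin K) (x y : Fin n → ℝ) :
    {j : Fin n // fold j ≠ k} → ℝ × ℝ := fun j => (x j, y j)

/-- Out-of-fold forward residuals. -/
def forwardResidual {n K : ℕ} {fold : Fin n → Fin K} (fhat : CrossFit fold)
    (x y : Fin n → ℝ) (i : Fin n) : ℝ :=
  y i - fhat (fold i) (training fold (fold i) x y) (x i)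

/-- Out-of-fold reverse residuals. -/
def reverseResidual {n K : ℕ} {fold : Fin n → Fin K} (ghat : CrossFit fold)
    (x y : Fin n → ℝ) (i : Fin n) : ℝ :=
  x i - ghat (fold i) (training fold (fold i) x y) (y i)

/-- The rank-standardized forward residual cloud. -/
def forwardCloud {n K : ℕ} {fold : Fin n → Fin K} (fhat : CrossFit fold)
    (x y : Fin n → ℝ) (i : Fin n) : EuclideanSpace ℝ (Fin 2) :=
  !₂[copulaRank x i, copulaRank (forwardResidual fhat x y) i]

open Classical in
/-- The indices whose `y`-copula coordinate lies in the `b`-th of the `B` bins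
`(b / B, (b + 1) / B]`, `b = 0, …, B - 1`. -/
def bin {n : ℕ} (B : ℕ) (y : Fin n → ℝ) (b : Fin B) : Finset (Fin n) :=
  Finset.univ.filter fun i =>
    copulaRank y i ∈ Set.Ioc ((b : ℝ) / (B : ℝ)) (((b : ℝ) + 1) / (B : ℝ))

/-- The (labels of the) nonempty bins. -/
abbrev NonemptyBin {n : ℕ} (B : ℕ) (y : Fin n → ℝ) : Type :=
  {b : Fin B // (bin B y b).Nonempty}

/-- The number of nonempty bins. -/
def numBins {n : ℕ} (B : ℕ) (y : Fin n → ℝ) : ℕ := Fintype.card (NonemptyBin B y)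

/-- The average of `v` over a bin. -/
def binMean {n : ℕ} (s : Finset (Fin n)) (v : Fin n → ℝ) : ℝ := (∑ i ∈ s, v i) / (s.card : ℝ)

/-- The binned reverse cloud: one point (mean copula coordinate, mean reverse residual) for each
nonempty bin. -/
def binnedCloud {n K : ℕ} {fold : Fin n → Fin K} (B : ℕ) (ghat : CrossFit fold)
    (x y : Fin n → ℝ) (b : NonemptyBin B y) : EuclideanSpace ℝ (Fin 2) :=
  !₂[binMean (bin B y b.1) (copulaRank y), binMean (bin B y b.1) (reverseResidual ghat x y)]

/-- The largest absolute bin average, over the nonempty bins, of the error of the cross-fitted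
reverse regressor with respect to the target `m`. -/
def maxBinError {n K : ℕ} {fold : Fin n → Fin K} (B : ℕ) (ghat : CrossFit fold) (m : ℝ → ℝ)
    (x y : Fin n → ℝ) : ℝ :=
  ⨆ b : NonemptyBin B y, |binMean (bin B y b.1)
    fun i => ghat (fold i) (training fold (fold i) x y) (y i) - m (y i)|

/-- The forward score, with window `[κ n^(-2/3), cβ κ n^(-2/3)]`. -/
def forwardScore {n K : ℕ} {fold : Fin n → Fin K} (κ cβ : ℝ) (fhat : CrossFit fold)
    (x y : Fin n → ℝ) : ℝ :=
  score (scale κ n) (cβ * scale κ n) (forwardCloud fhat x y)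

/-- The score of the binned reverse cloud, with the window scaled to the number of nonempty
bins. -/
def binnedScore {n K : ℕ} {fold : Fin n → Fin K} (κ cβ : ℝ) (B : ℕ) (ghat : CrossFit fold)
    (x y : Fin n → ℝ) : ℝ :=
  score (scale κ (numBins B y)) (cβ * scale κ (numBins B y)) (binnedCloud B ghat x y)

/-- The TRA-s score difference. -/
def trasScore {n K : ℕ} {fold : Fin n → Fin K} (κ cβ : ℝ) (B : ℕ) (fhat ghat : CrossFit fold)
    (x y : Fin n → ℝ) : ℝ :=
  forwardScore κ cβ fhat x y - binnedScore κ cβ B ghat x y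

/-! ## The model -/

/-- The sub-Gaussian (`ψ₂`) Orlicz norm of a law on the line,
`inf {t > 0 : E exp (Z² / t²) ≤ 2}`. -/
def psi2Norm (ν : Measure ℝ) : ℝ≥0∞ :=
  ⨅ (t : ℝ) (_ : 0 < t ∧ ∫⁻ z, ENNReal.ofReal (Real.exp ((z / t) ^ 2)) ∂ν ≤ 2), ENNReal.ofReal t

/-- The response `Y i = f (X i) + ε i`. -/
def response {Ω : Type*} (f : ℝ → ℝ) (X ε : ℕ → Ω → ℝ) (i : ℕ) (ω : Ω) : ℝ :=
  f (X i ω) + ε i ω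

/-- The first `n` terms of a sequence of random variables. -/
def firstN {Ω : Type*} (V : ℕ → Ω → ℝ) (n : ℕ) (ω : Ω) : Fin n → ℝ := fun i => V i ω

/-- The fixed-noise additive-noise model: `(X i, ε i)` are i.i.d., the noise is independent of the
cause, centered, with variance `σ ^ 2 > 0`. -/
structure FixedNoiseANM {Ω : Type*} [MeasurableSpace Ω] (P : Measure Ω)
    (X ε : ℕ → Ω → ℝ) (σ : ℝ) : Prop where
  measurable_X : ∀ i, Measurable (X i)
  measurable_noise : ∀ i, Measurable (ε i)
  indep : iIndepFun (fun i ω => (X i ω, ε i ω)) P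
  ident : ∀ i, IdentDistrib (fun ω => (X i ω, ε i ω)) (fun ω => (X 0 ω, ε 0 ω)) P P
  indep_noise : ∀ i, IndepFun (X i) (ε i) P
  mean_noise : ∫ ω, ε 0 ω ∂P = 0
  sigma_pos : 0 < σ
  var_noise : variance (ε 0) P = σ ^ 2

/-- Forward regularity: the cause lives on `[a, b]`; `f` is continuous there and, on each of
finitely many consecutive open intervals, `C¹`, strictly monotone, and with derivative bounded
away from `0` and `∞` in absolute value; the noise is sub-Gaussian with a continuous density. -/
structure ForwardRegular {Ω : Type*} [MeasurableSpace Ω] (P : Measure Ω)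
    (X ε : ℕ → Ω → ℝ) (f : ℝ → ℝ) (a b : ℝ) : Prop where
  mem_interval : ∀ᵐ ω ∂P, X 0 ω ∈ Set.Icc a b
  measurable_f : Measurable f
  continuousOn_f : ContinuousOn f (Set.Icc a b)
  pieces : ∃ (J : ℕ) (t : Fin (J + 1) → ℝ) (cf Cf : ℝ),
    1 ≤ J ∧ StrictMono t ∧ t 0 = a ∧ t (Fin.last J) = b ∧ 0 < cf ∧
    ∀ j : Fin J,
      ContDiffOn ℝ 1 f (Set.Ioo (t j.castSucc) (t j.succ)) ∧
      (StrictMonoOn f (Set.Ioo (t j.castSucc) (t j.succ)) ∨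
        StrictAntiOn f (Set.Ioo (t j.castSucc) (t j.succ))) ∧
      ∀ x ∈ Set.Ioo (t j.castSucc) (t j.succ), cf ≤ |deriv f x| ∧ |deriv f x| ≤ Cf
  density : ∃ p : ℝ → ℝ, Continuous p ∧ (∀ z, 0 ≤ p z) ∧
    P.map (ε 0) = volume.withDensity fun z => ENNReal.ofReal (p z)
  subGaussian : psi2Norm (P.map (ε 0)) < ∞

/-- The reverse regression function `m(y) = E[X | Y = y]`, the mean of the regular conditional
distribution of `X` given `Y = y`. -/
def reverseTarget {Ω : Type*} [MeasurableSpace Ω] (P : Measure Ω) [IsFiniteMeasure P]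
    (X Y : Ω → ℝ) (y : ℝ) : ℝ :=
  ∫ x, x ∂(condDistrib X Y P y)

end

end TRA

/-! Forward score. It is near one when all but a small proportion of the tree edges have length at
least `β`. `card_short_edges_le` bounds the number of shorter edges by twice the number of
exceptional points plus the number of ordered pairs of other points closer than `2 * β`. Such a pair
has both ranks within some `r` of order `n^(1/3)`. Apart from a few sparse points
(`card_sparse_le`), residual ranks within `r` force the residuals to be within some `w` of order
`n^(-2/3)`. Each point has at most `2 * r + 1` neighbours in design rank, so for independent
residuals of bounded density one would expect `O(n * r * w) = O(n^(2/3))` such collisions.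

The difficulty is that the residual `e i - h i` contains a regression error `h i` which depends on
the noise of other folds and is only known to be small, without a rate. Within one fold neither
error sees `e i` or `e j`, and conditioning suffices. For two folds a collision is rewritten as
closeness of `e i + h j` and `e j + h i`; with the noise of the remaining folds frozen, these are
independent. It remains to see that, on average over `i`, the variable `e i + h j` does not
concentrate on cells of width `w`. This is a Bessel inequality (`sum_covariance_sq_le`): one
variable `h j` cannot be strongly correlated with many independent `e i` at once. For errors bounded
by `δ` the additional number of collisions is `O(δ * n)` (`sum_collision_le`), and consistency of
the regressors allows `δ` to be any small constant.

Reverse score. It is at most the tree length divided by the number of points, less one, times the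
lower window end. The tree is no longer than the path through the bins from left to right, whose
horizontal extent is bounded and whose vertical extent is controlled by the bin means of the reverse
residuals. Given the responses, the fluctuations `X - m(Y)` are centred and uncorrelated and the
bins are fixed, so a second moment bound (`lintegral_binFluctuation_le`) makes the fluctuation part
of order `(B^(7/3) / n)^(1/2)`. The regression part is negligible by assumption. Both scores lie in
`[0, 1]`, which gives convergence in mean. -/

namespace TRA

/-! ### Short edges of spanning trees and bounds for the score -/

-- An induced subgraph of a forest is a forest, hence extends to a spanning tree of the complete
-- graph on `W`, which has `W.card - 1` edges.
open Classical in
theorem card_edges_inside_le {ι : Type*} [Fintype ι] {T : SimpleGraph ι} (hT : T.IsAcyclic)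
    (W : Finset ι) : (T.edgeFinset.filter fun e => ∀ v ∈ e, v ∈ W).card ≤ W.card := by
  rcases W.eq_empty_or_nonempty with rfl | hW
  · simp only [Finset.notMem_empty, Finset.card_empty, Nat.le_zero, Finset.card_eq_zero]
    ext e
    induction e with
    | _ u v =>
      simp only [Finset.mem_filter, Finset.notMem_empty, iff_false, not_and]
      exact fun _ h => h u (Sym2.mem_mk_left u v)
  have : Nonempty (W : Set ι) := hW.to_subtype
  obtain ⟨F, hF, -, hFt⟩ := (SimpleGraph.connected_top (V := (W : Set ι))).exists_isTree_le_of_le_of_isAcyclic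
    (H := T.induce (W : Set ι)) le_top (hT.induce _)
  have hc := hFt.card_edgeFinset
  have hsub : (T.edgeFinset.filter fun e => ∀ v ∈ e, v ∈ W) ⊆
      F.edgeFinset.image (Sym2.map Subtype.val) := by
    intro e
    induction e with
    | _ u v =>
      simp only [Finset.mem_filter, SimpleGraph.mem_edgeFinset, SimpleGraph.mem_edgeSet,
        Sym2.mem_iff, forall_eq_or_imp, forall_eq, Finset.mem_image, and_imp]
      intro h hu hv
      refine ⟨s(⟨u, hu⟩, ⟨v, hv⟩), ?_, rfl⟩
      simp only [SimpleGraph.mem_edgeSet]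
      exact hF h
  have h1 := (Finset.card_le_card hsub).trans Finset.card_image_le
  have h2 : Fintype.card (W : Set ι) = W.card := by simp
  omega

open Classical in
/-- Short edges of a forest, up to a set `V` of exceptional points, are controlled by the pairs of
close points. -/
theorem card_short_edges_le {ι : Type*} [Fintype ι] (Z : ι → EuclideanSpace ℝ (Fin 2))
    {T : SimpleGraph ι} (hT : T.IsAcyclic) (β : ℝ) (V : Finset ι) :
    (T.edgeFinset.filter fun e => edgeLength Z e < β).card ≤ 2 * V.card +
      (Finset.univ.filter fun p : ι × ι =>
        p.1 ∉ V ∧ p.2 ∉ V ∧ p.1 ≠ p.2 ∧ dist (Z p.1) (Z p.2) < 2 * β).card := by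
  set N := Finset.univ.filter fun p : ι × ι =>
        p.1 ∉ V ∧ p.2 ∉ V ∧ p.1 ≠ p.2 ∧ dist (Z p.1) (Z p.2) < 2 * β with hN
  -- `W` collects the exceptional points and those with a close partner. A vertex outside `W` is at
  -- distance at least `2 * β` from every other vertex outside `V`.
  set W : Finset ι := V ∪ N.image Prod.fst with hWdef
  have hW : W.card ≤ V.card + N.card :=
    (Finset.card_union_le _ _).trans (Nat.add_le_add_left Finset.card_image_le _)
  have hlonely : ∀ u ∉ W, u ∉ V ∧ ∀ u' ∉ V, u ≠ u' → 2 * β ≤ dist (Z u) (Z u') := by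
    intro u hu
    simp only [hWdef, Finset.mem_union, Finset.mem_image, not_or, not_exists, not_and] at hu
    refine ⟨hu.1, fun u' hu' hne => ?_⟩
    by_contra! hlt
    exact hu.2 (u, u') (by simp [hN, hu.1, hu', hne, hlt]) rfl
  set E := T.edgeFinset.filter fun e => edgeLength Z e < β
  have hsplit := Finset.card_filter_add_card_filter_not (s := E) (fun e => ∀ v ∈ e, v ∈ W)
  have h1 : (E.filter fun e => ∀ v ∈ e, v ∈ W).card ≤ W.card := by
    refine (Finset.card_le_card ?_).trans (card_edges_inside_le hT W)
    intro e he
    simp only [E, Finset.mem_filter] at he ⊢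
    exact ⟨he.1.1, he.2⟩
  -- A short edge not contained in `W` has an isolated end, so its other end must be exceptional.
  have key : ∀ e ∈ E.filter (fun e => ¬ ∀ v ∈ e, v ∈ W), ∃ v ∈ V, ∃ u ∉ W, e = s(u, v) ∧
      dist (Z u) (Z v) < β := by
    intro e he
    simp only [E, Finset.mem_filter] at he
    obtain ⟨⟨heT, hel⟩, hne⟩ := he
    push Not at hne
    obtain ⟨u, hue, huW⟩ := hne
    obtain ⟨v, rfl⟩ := hue
    have hd : dist (Z u) (Z v) < β := hel
    refine ⟨v, ?_, u, huW, rfl, hd⟩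
    by_contra hv
    rw [SimpleGraph.mem_edgeFinset, SimpleGraph.mem_edgeSet] at heT
    have := (hlonely u huW).2 v hv heT.ne
    have := dist_nonneg (x := Z u) (y := Z v)
    linarith
  have h2 : (E.filter fun e => ¬ ∀ v ∈ e, v ∈ W).card ≤ V.card := by
    rcases isEmpty_or_nonempty ι with hι | hι
    · have : E = ∅ := by
        ext e
        induction e with
        | _ u v => exact hι.elim u
      simp
    choose! φ hφ using key
    refine Finset.card_le_card_of_injOn φ (fun e he => (hφ e he).1) ?_
    intro e he e' he' h
    obtain ⟨-, u, hu, h1, h2⟩ := hφ e he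
    obtain ⟨-, u', hu', h1', h2'⟩ := hφ e' he'
    rw [h1, h1', ← h]
    rw [← h] at h2'
    -- Two isolated points within `β` of the same point of `V` would be less than `2 * β` apart. So
    -- each point of `V` accounts for at most one such edge.
    suffices u = u' by rw [this]
    by_contra hne
    have h3 := (hlonely u hu).2 u' (hlonely u' hu').1 hne
    have h4 := dist_triangle_right (Z u) (Z u') (Z (φ e))
    linarith
  omega

theorem edgeLength_nonneg {ι : Type*} (Z : ι → EuclideanSpace ℝ (Fin 2)) (e : Sym2 ι) :
    0 ≤ edgeLength Z e := by
  induction e with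
  | _ u v => exact dist_nonneg (x := Z u) (y := Z v)

theorem mst_isMST {ι : Type*} [Fintype ι] [Nonempty ι] (Z : ι → EuclideanSpace ℝ (Fin 2)) :
    IsMST Z (mst Z) := by
  have h := exists_isMST Z
  rw [mst, dif_pos h]
  exact h.choose_spec

open Classical in
theorem card_mst_edges {ι : Type*} [Fintype ι] [Nonempty ι] (Z : ι → EuclideanSpace ℝ (Fin 2)) :
    ((mst Z).edgeFinset.card : ℝ) = (Fintype.card ι : ℝ) - 1 := by
  have h := (mst_isMST Z).1.card_edgeFinset
  rw [← h]; push_cast; ring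

theorem window_nonneg (α β t : ℝ) : 0 ≤ window α β t := le_max_right _ _

theorem window_le {α β : ℝ} (h : α ≤ β) (t : ℝ) : window α β t ≤ β - α :=
  max_le (by linarith [min_le_right t β]) (by linarith)

theorem window_eq {α β t : ℝ} (h : α ≤ β) (ht : β ≤ t) : window α β t = β - α := by
  rw [window, min_eq_right ht, max_eq_left (by linarith)]

/-- The window vanishes below `α` and is at most `β - α` above, where `t / α` is at least one. This
linear majorant lets the total tree length control the score. -/
theorem window_le_mul {α β t : ℝ} (hα : 0 < α) (h : α ≤ β) (ht : 0 ≤ t) :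
    window α β t ≤ (β - α) * (t / α) := by
  rcases le_total t α with h1 | h1
  · rw [window, max_eq_right]
    · exact mul_nonneg (by linarith) (by positivity)
    · linarith [min_le_left t β]
  · refine (window_le h t).trans ?_
    exact le_mul_of_one_le_right (by linarith) ((one_le_div hα).2 h1)

theorem score_nonneg {ι : Type*} [Fintype ι] {α β : ℝ} (h : α ≤ β)
    (Z : ι → EuclideanSpace ℝ (Fin 2)) : 0 ≤ score α β Z := by
  classical
  -- On the empty cloud the factor `Fintype.card ι - 1` is negative, but the sum has no terms.
  rcases isEmpty_or_nonempty ι with hι | hι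
  · have h0 : (mst Z).edgeFinset = ∅ := by
      ext e
      induction e with
      | _ u v => exact hι.elim u
    rw [score]
    simp only [h0, Finset.sum_empty, zero_div, le_refl]
  · refine div_nonneg (Finset.sum_nonneg fun _ _ => window_nonneg _ _ _) (mul_nonneg ?_ (by linarith))
    have : 1 ≤ Fintype.card ι := Fintype.card_pos
    have : (1 : ℝ) ≤ Fintype.card ι := by exact_mod_cast this
    linarith

theorem score_le_one {ι : Type*} [Fintype ι] {α β : ℝ} (h : α ≤ β)
    (Z : ι → EuclideanSpace ℝ (Fin 2)) : score α β Z ≤ 1 := by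
  classical
  rcases isEmpty_or_nonempty ι with hι | hι
  · have h0 : (mst Z).edgeFinset = ∅ := by
      ext e
      induction e with
      | _ u v => exact hι.elim u
    rw [score]
    simp only [h0, Finset.sum_empty, zero_div, zero_le_one]
  · refine div_le_one_of_le₀ ?_ ?_
    · refine (Finset.sum_le_card_nsmul _ _ _ fun e _ => window_le h _).trans ?_
      rw [nsmul_eq_mul, ← card_mst_edges Z]
    · have : 1 ≤ Fintype.card ι := Fintype.card_pos
      have : (1 : ℝ) ≤ Fintype.card ι := by exact_mod_cast this
      exact mul_nonneg (by linarith) (by linarith)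

-- An edge of length at least `β` carries the full height `β - α`, so what the score lacks is at
-- most the fraction of short edges.
open Classical in
theorem one_sub_score_le {ι : Type*} [Fintype ι] {α β : ℝ} (h : α < β)
    (hι : 2 ≤ Fintype.card ι) (Z : ι → EuclideanSpace ℝ (Fin 2)) (V : Finset ι) :
    ((Fintype.card ι : ℝ) - 1) * (1 - score α β Z) ≤ 2 * V.card +
      (Finset.univ.filter fun p : ι × ι =>
        p.1 ∉ V ∧ p.2 ∉ V ∧ p.1 ≠ p.2 ∧ dist (Z p.1) (Z p.2) < 2 * β).card := by
  have : Nonempty ι := Fintype.card_pos_iff.1 (by omega)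
  have hs := card_short_edges_le Z (mst_isMST Z).1.isAcyclic β V
  have hc := card_mst_edges Z
  have hsplit := Finset.card_filter_add_card_filter_not (s := (mst Z).edgeFinset)
    (fun e => edgeLength Z e < β)
  set S := (mst Z).edgeFinset.filter fun e => edgeLength Z e < β with hS
  set L := (mst Z).edgeFinset.filter fun e => ¬ edgeLength Z e < β with hL
  have hlow : (L.card : ℝ) * (β - α) ≤
      ∑ e ∈ (mst Z).edgeFinset, window α β (edgeLength Z e) := by
    calc (L.card : ℝ) * (β - α) = ∑ e ∈ L, window α β (edgeLength Z e) := by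
          rw [Finset.sum_congr rfl (g := fun _ => β - α)]
          · rw [Finset.sum_const, nsmul_eq_mul]
          · intro e he
            rw [hL, Finset.mem_filter, not_lt] at he
            exact window_eq h.le he.2
      _ ≤ _ := Finset.sum_le_sum_of_subset_of_nonneg (Finset.filter_subset _ _)
          fun _ _ _ => window_nonneg _ _ _
  have hn : (1 : ℝ) < Fintype.card ι := by exact_mod_cast hι
  have h1 : (L.card : ℝ) ≤ ((Fintype.card ι : ℝ) - 1) * score α β Z := by
    rw [score, mul_div_assoc', mul_div_mul_left _ _ (by linarith), le_div_iff₀ (by linarith)]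
    exact hlow
  have h2 : (S.card : ℝ) + L.card = (Fintype.card ι : ℝ) - 1 := by
    rw [← hc]; exact_mod_cast hsplit
  have h3 : (S.card : ℝ) ≤ ((2 * V.card + (Finset.univ.filter fun p : ι × ι =>
        p.1 ∉ V ∧ p.2 ∉ V ∧ p.1 ≠ p.2 ∧ dist (Z p.1) (Z p.2) < 2 * β).card : ℕ) : ℝ) := by
    exact_mod_cast hs
  push_cast at h3
  nlinarith

theorem score_le_totalWeight {ι : Type*} [Fintype ι] {α β : ℝ} (hα : 0 < α) (h : α < β)
    (hι : 2 ≤ Fintype.card ι) (Z : ι → EuclideanSpace ℝ (Fin 2)) :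
    score α β Z ≤ totalWeight Z (mst Z) / (((Fintype.card ι : ℝ) - 1) * α) := by
  classical
  have hn : (1 : ℝ) < Fintype.card ι := by exact_mod_cast hι
  have hn' : (0 : ℝ) < (Fintype.card ι : ℝ) - 1 := by linarith
  have hβ : 0 < β - α := by linarith
  rw [score, div_le_iff₀ (by positivity)]
  calc _ ≤ ∑ e ∈ (mst Z).edgeFinset, (β - α) * (edgeLength Z e / α) :=
        Finset.sum_le_sum fun e _ => window_le_mul hα h.le (edgeLength_nonneg Z e)
    _ = _ := by
        rw [← Finset.mul_sum, ← Finset.sum_div, totalWeight]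
        field_simp

/-- The path visiting the points in the order `e` is connected, so it contains a spanning tree, with
which minimality compares `mst Z`. -/
theorem totalWeight_mst_le_path {ι : Type*} [Fintype ι] (Z : ι → EuclideanSpace ℝ (Fin 2))
    {m : ℕ} (e : Fin (m + 1) ≃ ι) :
    totalWeight Z (mst Z) ≤ ∑ k : Fin m, dist (Z (e k.castSucc)) (Z (e k.succ)) := by
  classical
  have : Nonempty ι := ⟨e 0⟩
  set G : SimpleGraph ι := (SimpleGraph.pathGraph (m + 1)).map e.toEmbedding with hG
  have hconn : G.Connected :=
    (SimpleGraph.Iso.map e (SimpleGraph.pathGraph (m + 1))).connected_iff.1 (SimpleGraph.pathGraph_connected m)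
  obtain ⟨T, hTG, hT⟩ := hconn.exists_isTree_le
  refine ((mst_isMST Z).2 T hT).trans ?_
  rw [totalWeight]
  have hsub : T.edgeFinset ⊆ Finset.univ.image
      fun k : Fin m => s(e k.castSucc, e k.succ) := by
    intro a
    induction a with
    | _ u v =>
      intro h
      rw [SimpleGraph.mem_edgeFinset, SimpleGraph.mem_edgeSet] at h
      have h' := hTG h
      rw [hG, SimpleGraph.map_adj] at h'
      obtain ⟨i, j, hij, rfl, rfl⟩ := h'
      rw [SimpleGraph.pathGraph_adj] at hij
      simp only [Finset.mem_image, Finset.mem_univ, true_and]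
      rcases hij with hij | hij
      · refine ⟨⟨i, by omega⟩, ?_⟩
        have h1 : (Fin.castSucc ⟨i, by omega⟩ : Fin (m + 1)) = i := rfl
        have h2 : (Fin.succ ⟨i, by omega⟩ : Fin (m + 1)) = j := Fin.ext hij
        rw [h1, h2]; rfl
      · refine ⟨⟨j, by omega⟩, ?_⟩
        have h1 : (Fin.castSucc ⟨j, by omega⟩ : Fin (m + 1)) = j := rfl
        have h2 : (Fin.succ ⟨j, by omega⟩ : Fin (m + 1)) = i := Fin.ext hij
        rw [h1, h2, Sym2.eq_swap]; rfl
  refine (Finset.sum_le_sum_of_subset_of_nonneg hsub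
    fun _ _ _ => edgeLength_nonneg Z _).trans ?_
  exact Finset.sum_image_le_of_nonneg fun _ _ => edgeLength_nonneg Z _

/-! ### Planar distances, ranks and bins -/

theorem dist_mk_le (a b c d : ℝ) :
    dist (!₂[a, b] : EuclideanSpace ℝ (Fin 2)) !₂[c, d] ≤ |a - c| + |b - d| := by
  rw [EuclideanSpace.dist_eq, Fin.sum_univ_two]
  refine Real.sqrt_le_iff.2 ⟨by positivity, ?_⟩
  simp only [Real.dist_eq, Matrix.cons_val_zero, Matrix.cons_val_one]
  nlinarith [abs_nonneg (a - c), abs_nonneg (b - d), sq_abs (a - c), sq_abs (b - d),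
    mul_nonneg (abs_nonneg (a - c)) (abs_nonneg (b - d))]

theorem abs_sub_le_dist_mk (a b c d : ℝ) :
    |a - c| ≤ dist (!₂[a, b] : EuclideanSpace ℝ (Fin 2)) !₂[c, d] ∧
    |b - d| ≤ dist (!₂[a, b] : EuclideanSpace ℝ (Fin 2)) !₂[c, d] := by
  rw [EuclideanSpace.dist_eq, Fin.sum_univ_two]
  simp only [Real.dist_eq, Matrix.cons_val_zero, Matrix.cons_val_one]
  exact ⟨Real.le_sqrt_of_sq_le (by nlinarith [sq_nonneg |b - d|]),
    Real.le_sqrt_of_sq_le (by nlinarith [sq_nonneg |a - c|])⟩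

theorem rank_lt_rank {n : ℕ} {u : Fin n → ℝ} {i j : Fin n}
    (h : u i < u j ∨ (u i = u j ∧ i < j)) : rank u i < rank u j := by
  classical
  refine Finset.card_lt_card ((Finset.ssubset_iff_of_subset ?_).2 ⟨j, ?_, ?_⟩)
  · intro k
    simp only [Finset.mem_filter, Finset.mem_univ, true_and]
    rcases h with h | ⟨h, hij⟩ <;> rintro (hk | ⟨hk, hki⟩)
    · exact Or.inl (hk.trans h)
    · exact Or.inl (hk ▸ h)
    · exact Or.inl (h ▸ hk)
    · exact Or.inr ⟨hk.trans h, hki.trans hij.le⟩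
  · simp
  · simp only [Finset.mem_filter, Finset.mem_univ, true_and, not_or, not_lt, not_and, not_le]
    rcases h with h | ⟨h, hij⟩
    · exact ⟨h.le, fun h' => absurd h' h.ne'⟩
    · exact ⟨h.le, fun _ => hij⟩

theorem rank_injective {n : ℕ} (u : Fin n → ℝ) : Function.Injective (rank u) := by
  intro i j h
  by_contra hne
  rcases lt_trichotomy (u i) (u j) with h1 | h1 | h1
  · exact (rank_lt_rank (Or.inl h1)).ne h
  · rcases lt_or_gt_of_ne hne with h2 | h2
    · exact (rank_lt_rank (Or.inr ⟨h1, h2⟩)).ne h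
    · exact (rank_lt_rank (Or.inr ⟨h1.symm, h2⟩)).ne' h
  · exact (rank_lt_rank (Or.inl h1)).ne' h

theorem rank_mem_Icc {n : ℕ} (u : Fin n → ℝ) (i : Fin n) : rank u i ∈ Finset.Icc 1 n := by
  classical
  rw [Finset.mem_Icc]
  refine ⟨Finset.card_pos.2 ⟨i, by simp⟩, ?_⟩
  exact (Finset.card_le_univ _).trans (by simp)

open Classical in
theorem image_rank {n : ℕ} (u : Fin n → ℝ) :
    Finset.univ.image (rank u) = Finset.Icc 1 n := by
  refine Finset.eq_of_subset_of_card_le ?_ ?_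
  · intro k hk
    obtain ⟨i, -, rfl⟩ := Finset.mem_image.1 hk
    exact rank_mem_Icc u i
  · rw [Finset.card_image_of_injective _ (rank_injective u)]
    simp

theorem card_rank_close_le {n : ℕ} (u : Fin n → ℝ) (i : Fin n) (r : ℕ) :
    (Finset.univ.filter fun j => rank u i ≤ rank u j + r ∧ rank u j ≤ rank u i + r).card
      ≤ 2 * r + 1 := by
  classical
  refine (Finset.card_le_card_of_injOn (t := Finset.Icc (rank u i - r) (rank u i + r)) (rank u)
    ?_ (rank_injective u).injOn).trans ?_
  · intro j hj
    simp only [Finset.coe_filter, Finset.mem_univ, true_and, Set.mem_ofPred_eq, Finset.coe_Icc,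
      Set.mem_Icc] at hj ⊢
    omega
  · rw [Nat.card_Icc]; omega

open Classical in
/-- Few points of a sample can have a point of nearby rank at a large distance. -/
theorem card_sparse_le {n : ℕ} (u : Fin n → ℝ) (r : ℕ) {M w : ℝ} (hM : 0 ≤ M) (hw : 0 < w) :
    ((Finset.univ.filter fun i => |u i| ≤ M ∧
      ∃ j, rank u j ≤ rank u i + r ∧ u i + w < u j).card : ℝ) ≤ r * (2 * M / w + 2) := by
  set s := Finset.univ.filter fun i => |u i| ≤ M ∧
      ∃ j, rank u j ≤ rank u i + r ∧ u i + w < u j with hs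
  -- In a cell of length `w`, take the sparse point `i` of least rank and its witness `j`. As `u j`
  -- exceeds `u i + w`, it lies above the whole cell, so the sparse points of the cell have ranks in
  -- a window of length `r`.
  have hcell : ∀ m ∈ Finset.Icc ⌊-M / w⌋ ⌊M / w⌋,
      (s.filter fun i => ⌊u i / w⌋ = m).card ≤ r := by
    intro m _
    rcases (s.filter fun i => ⌊u i / w⌋ = m).eq_empty_or_nonempty with h | h
    · simp [h]
    obtain ⟨i, hi, hmin⟩ := Finset.exists_min_image _ (rank u) h
    rw [Finset.mem_filter, hs, Finset.mem_filter] at hi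
    obtain ⟨⟨-, -, j, hj, hij⟩, him⟩ := hi
    have : (s.filter fun i => ⌊u i / w⌋ = m).card ≤ (Finset.Ico (rank u i) (rank u i + r)).card := by
      refine Finset.card_le_card_of_injOn (rank u) ?_ (rank_injective u).injOn
      intro k hk
      have hk1 := hmin k hk
      simp only [Finset.coe_filter, Set.mem_ofPred_eq] at hk
      have hku : u k < u j := by
        have h1 := Int.abs_sub_lt_one_of_floor_eq_floor (hk.2.trans him.symm)
        rw [← sub_div, abs_div, abs_of_pos hw, div_lt_one hw, abs_lt] at h1
        linarith [h1.2]
      have := rank_lt_rank (Or.inl hku)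
      simp only [Finset.coe_Ico, Set.mem_Ico]
      omega
    simpa using this
  have hmaps : ∀ i ∈ s, ⌊u i / w⌋ ∈ Finset.Icc ⌊-M / w⌋ ⌊M / w⌋ := by
    intro i hi
    rw [hs, Finset.mem_filter] at hi
    have h1 := abs_le.1 hi.2.1
    rw [Finset.mem_Icc]
    exact ⟨Int.floor_mono (by gcongr; exact h1.1), Int.floor_mono (by gcongr; exact h1.2)⟩
  have h1 := Finset.card_le_mul_card_image_of_maps_to hmaps r hcell
  have h2 : ((Finset.Icc ⌊-M / w⌋ ⌊M / w⌋).card : ℝ) ≤ 2 * M / w + 2 := by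
    rw [Int.card_Icc]
    have h3 : ⌊-M / w⌋ ≤ ⌊M / w⌋ := Int.floor_mono (by gcongr; linarith)
    have h4 : (((⌊M / w⌋ + 1 - ⌊-M / w⌋).toNat : ℤ) : ℝ) = ⌊M / w⌋ + 1 - ⌊-M / w⌋ := by
      rw [Int.toNat_of_nonneg (by omega)]; push_cast; ring
    rw [Int.cast_natCast] at h4
    rw [h4]
    have h5 := Int.floor_le (M / w)
    have h6 := Int.lt_floor_add_one (-M / w)
    have h7 : 2 * M / w = M / w - (-M / w) := by ring
    rw [h7]; linarith
  calc (s.card : ℝ) ≤ ((r * (Finset.Icc ⌊-M / w⌋ ⌊M / w⌋).card : ℕ) : ℝ) := by exact_mod_cast h1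
    _ ≤ _ := by push_cast; gcongr

/-- Ranks are a permutation of `1, …, n`, so a bin counts the integers in `(p, q]`. At most one unit
is lost in rounding, and one more in the last bin, whose upper end `n + 1` is not a rank. -/
theorem le_card_bin {n : ℕ} (B : ℕ) (y : Fin n → ℝ) (b : Fin B) :
    ((n : ℝ) + 1) / B - 2 ≤ (bin B y b).card := by
  classical
  have hB : (0 : ℝ) < B := by exact_mod_cast b.pos
  have hn : (0 : ℝ) < (n : ℝ) + 1 := by positivity
  set p : ℝ := (b : ℝ) * ((n + 1) / B) with hp
  set q : ℝ := ((b : ℝ) + 1) * ((n + 1) / B) with hq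
  have hp0 : 0 ≤ p := by positivity
  have hpq : q = p + ((n : ℝ) + 1) / B := by rw [hp, hq]; ring
  have hq0 : 0 ≤ q := by positivity
  have hqn : q ≤ n + 1 := by
    have : (b : ℝ) + 1 ≤ B := by exact_mod_cast b.2
    calc q ≤ B * ((n + 1) / B) := by rw [hq]; gcongr
      _ = n + 1 := by field_simp
  have hsub : (Finset.Ioc ⌊p⌋₊ ⌊q⌋₊).erase (n + 1) ⊆ (bin B y b).image (rank y) := by
    intro k hk
    rw [Finset.mem_erase, Finset.mem_Ioc] at hk
    obtain ⟨hkn, hk1, hk2⟩ := hk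
    have hk1' : p < k := (Nat.floor_lt hp0).1 hk1
    have hk2' : (k : ℝ) ≤ q := (Nat.le_floor_iff hq0).1 hk2
    have hk3 : k ≤ n + 1 := by exact_mod_cast hk2'.trans hqn
    have hmem : k ∈ Finset.univ.image (rank y) := by
      rw [image_rank, Finset.mem_Icc]; omega
    obtain ⟨i, -, rfl⟩ := Finset.mem_image.1 hmem
    refine Finset.mem_image.2 ⟨i, ?_, rfl⟩
    simp only [bin, Finset.mem_filter, Finset.mem_univ, true_and, Set.mem_Ioc, copulaRank]
    constructor
    · rw [lt_div_iff₀ hn]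
      calc (b : ℝ) / B * (n + 1) = p := by rw [hp]; ring
        _ < _ := hk1'
    · rw [div_le_iff₀ hn]
      calc _ ≤ q := hk2'
        _ = _ := by rw [hq]; ring
  have h1 := (Finset.card_le_card hsub).trans Finset.card_image_le
  have h2 : (Finset.Ioc ⌊p⌋₊ ⌊q⌋₊).card - 1 ≤ ((Finset.Ioc ⌊p⌋₊ ⌊q⌋₊).erase (n + 1)).card :=
    Finset.pred_card_le_card_erase
  rw [Nat.card_Ioc] at h2
  have h3 : ⌊q⌋₊ ≤ (bin B y b).card + 1 + ⌊p⌋₊ := by omega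
  have h4 : (⌊q⌋₊ : ℝ) ≤ (bin B y b).card + 1 + ⌊p⌋₊ := by exact_mod_cast h3
  have h5 := Nat.lt_floor_add_one q
  have h6 := Nat.floor_le hp0
  linarith

theorem bin_disjoint {n : ℕ} {B : ℕ} {y : Fin n → ℝ} {i : Fin n} {b b' : Fin B}
    (h : i ∈ bin B y b) (h' : i ∈ bin B y b') : b = b' := by
  simp only [bin, Finset.mem_filter, Finset.mem_univ, true_and, Set.mem_Ioc] at h h'
  have hB : (0 : ℝ) < B := by exact_mod_cast b.pos
  have h1 := h.1.trans_le h'.2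
  have h2 := h'.1.trans_le h.2
  rw [div_lt_div_iff_of_pos_right hB] at h1 h2
  have h3 : (b : ℕ) < b' + 1 := by exact_mod_cast h1
  have h4 : (b' : ℕ) < b + 1 := by exact_mod_cast h2
  exact Fin.ext (by omega)

theorem binMean_mem_Icc {n : ℕ} {B : ℕ} {y : Fin n → ℝ} {b : Fin B}
    (h : (bin B y b).Nonempty) :
    binMean (bin B y b) (copulaRank y) ∈ Set.Icc ((b : ℝ) / B) (((b : ℝ) + 1) / B) := by
  have hc : (0 : ℝ) < (bin B y b).card := by exact_mod_cast h.card_pos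
  have hm : ∀ i ∈ bin B y b, copulaRank y i ∈ Set.Ioc ((b : ℝ) / B) (((b : ℝ) + 1) / B) := by
    intro i hi
    simpa [bin] using hi
  rw [binMean, Set.mem_Icc, le_div_iff₀ hc, div_le_iff₀ hc]
  constructor
  · have := Finset.card_nsmul_le_sum _ _ _ fun i hi => (hm i hi).1.le
    rwa [nsmul_eq_mul, mul_comm] at this
  · have := Finset.sum_le_card_nsmul _ _ _ fun i hi => (hm i hi).2
    rwa [nsmul_eq_mul, mul_comm] at this

/-! ### Measurability of the scores -/

/-- Splits off a discrete choice: the selected spanning tree, or the pattern of the bins. -/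
theorem measurable_of_countable_cases {α γ δ : Type*} [MeasurableSpace α] [MeasurableSpace δ]
    [Countable γ] {c : α → γ} (hc : ∀ g, MeasurableSet {a | c a = g}) {F : γ → α → δ}
    (hF : ∀ g, Measurable (F g)) : Measurable fun a => F (c a) a := by
  intro s hs
  have : (fun a => F (c a) a) ⁻¹' s = ⋃ g, {a | c a = g} ∩ F g ⁻¹' s := by
    ext a
    simp
  rw [this]
  exact MeasurableSet.iUnion fun g => (hc g).inter (hF g hs)

theorem measurable_edgeLength {ι : Type*} [Finite ι] (e : Sym2 ι) :
    Measurable fun Z : ι → EuclideanSpace ℝ (Fin 2) => edgeLength Z e := by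
  induction e with
  | _ u v =>
    exact (measurable_pi_apply u).dist (measurable_pi_apply v)

theorem measurableSet_isMST {ι : Type*} [Fintype ι] (T : SimpleGraph ι) :
    MeasurableSet {Z : ι → EuclideanSpace ℝ (Fin 2) | IsMST Z T} := by
  classical
  have hw : ∀ T : SimpleGraph ι,
      Measurable fun Z : ι → EuclideanSpace ℝ (Fin 2) => totalWeight Z T := fun T =>
    Finset.measurable_sum _ fun e _ => measurable_edgeLength e
  have : {Z : ι → EuclideanSpace ℝ (Fin 2) | IsMST Z T} = {_Z | T.IsTree} ∩
      ⋂ T' : SimpleGraph ι, {Z | T'.IsTree → totalWeight Z T ≤ totalWeight Z T'} := by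
    ext Z
    simp [IsMST]
  rw [this]
  refine (MeasurableSet.const _).inter (MeasurableSet.iInter fun T' => ?_)
  by_cases hT' : T'.IsTree
  · simpa [hT'] using measurableSet_le (hw T) (hw T')
  · simp [hT']

/-- The selected tree depends on the cloud only through the set of all its minimum spanning trees,
which takes finitely many values. -/
theorem measurableSet_mst_eq {ι : Type*} [Fintype ι] (T : SimpleGraph ι) :
    MeasurableSet {Z : ι → EuclideanSpace ℝ (Fin 2) | mst Z = T} := by
  classical
  let pick : (SimpleGraph ι → Prop) → SimpleGraph ι := fun q =>
    if h : ∃ T, q T then h.choose else ⊥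
  have h1 : ∀ Z : ι → EuclideanSpace ℝ (Fin 2), mst Z = pick (IsMST Z) := fun Z => rfl
  have h2 : Measurable fun Z : ι → EuclideanSpace ℝ (Fin 2) => IsMST Z :=
    measurable_pi_iff.2 fun T => measurableSet_setOfPred.1 (measurableSet_isMST T)
  simp_rw [h1]
  exact h2 (Set.toFinite {q | pick q = T}).measurableSet

theorem measurable_score {ι : Type*} [Fintype ι] (α β : ℝ) :
    Measurable fun Z : ι → EuclideanSpace ℝ (Fin 2) => score α β Z := by
  classical
  have h := measurable_of_countable_cases (δ := ℝ) (measurableSet_mst_eq (ι := ι))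
    (F := fun T Z => (∑ e ∈ T.edgeFinset, window α β (edgeLength Z e)) /
    (((Fintype.card ι : ℝ) - 1) * (β - α))) fun T => by
      refine Measurable.div_const (Finset.measurable_sum _ fun e _ => ?_) _
      exact (((measurable_edgeLength e).min measurable_const).sub_const _).max measurable_const
  exact h

theorem measurable_rank {n : ℕ} (i : Fin n) : Measurable fun u : Fin n → ℝ => rank u i := by
  classical
  simp_rw [rank, Finset.card_filter]
  refine Finset.measurable_sum _ fun j _ => Measurable.ite ?_ measurable_const measurable_const
  refine (measurableSet_lt (measurable_pi_apply j) (measurable_pi_apply i)).union ?_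
  exact (measurableSet_eq_fun (measurable_pi_apply j) (measurable_pi_apply i)).inter
    (MeasurableSet.const _)

theorem measurable_copulaRank {n : ℕ} (i : Fin n) :
    Measurable fun u : Fin n → ℝ => copulaRank u i :=
  (measurable_from_top.comp (measurable_rank i)).div_const _

theorem measurableSet_mem_bin {n : ℕ} (B : ℕ) (b : Fin B) (i : Fin n) :
    MeasurableSet {y : Fin n → ℝ | i ∈ bin B y b} := by
  classical
  simp only [bin, Finset.mem_filter, Finset.mem_univ, true_and]
  exact measurable_copulaRank i measurableSet_Ioc

theorem measurableSet_bin_eq {n : ℕ} (B : ℕ) (c : Fin B → Finset (Fin n)) :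
    MeasurableSet {y : Fin n → ℝ | bin B y = c} := by
  have : {y : Fin n → ℝ | bin B y = c} = ⋂ b, ⋂ i, {y | i ∈ bin B y b ↔ i ∈ c b} := by
    ext y
    simp [funext_iff, Finset.ext_iff]
  rw [this]
  refine MeasurableSet.iInter fun b => MeasurableSet.iInter fun i => ?_
  by_cases h : i ∈ c b
  · simpa [h] using measurableSet_mem_bin B b i
  · simp only [h, iff_false]
    exact (measurableSet_mem_bin B b i).compl

theorem measurable_training {n K : ℕ} (fold : Fin n → Fin K) (k : Fin K) :
    Measurable fun p : (Fin n → ℝ) × (Fin n → ℝ) => training fold k p.1 p.2 :=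
  measurable_pi_iff.2 fun _ => ((measurable_pi_apply _).comp measurable_fst).prodMk
    ((measurable_pi_apply _).comp measurable_snd)

theorem measurable_forwardResidual {n K : ℕ} {fold : Fin n → Fin K} {fhat : CrossFit fold}
    (hf : ∀ k, Measurable (Function.uncurry (fhat k))) (i : Fin n) :
    Measurable fun p : (Fin n → ℝ) × (Fin n → ℝ) => forwardResidual fhat p.1 p.2 i := by
  refine ((measurable_pi_apply i).comp measurable_snd).sub ?_
  exact (hf (fold i)).comp ((measurable_training fold (fold i)).prodMk
    ((measurable_pi_apply i).comp measurable_fst))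

theorem measurable_reverseResidual {n K : ℕ} {fold : Fin n → Fin K} {ghat : CrossFit fold}
    (hg : ∀ k, Measurable (Function.uncurry (ghat k))) (i : Fin n) :
    Measurable fun p : (Fin n → ℝ) × (Fin n → ℝ) => reverseResidual ghat p.1 p.2 i := by
  refine ((measurable_pi_apply i).comp measurable_fst).sub ?_
  exact (hg (fold i)).comp ((measurable_training fold (fold i)).prodMk
    ((measurable_pi_apply i).comp measurable_snd))

theorem measurable_mk_euclidean {α : Type*} [MeasurableSpace α] {u v : α → ℝ} (hu : Measurable u)
    (hv : Measurable v) : Measurable fun a => (!₂[u a, v a] : EuclideanSpace ℝ (Fin 2)) := by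
  refine (WithLp.measurable_toLp 2 (Fin 2 → ℝ)).comp (measurable_pi_iff.2 fun i => ?_)
  fin_cases i
  · simpa using hu
  · simpa using hv

theorem measurable_forwardScore {n K : ℕ} {fold : Fin n → Fin K} {fhat : CrossFit fold}
    (hf : ∀ k, Measurable (Function.uncurry (fhat k))) (κ cβ : ℝ) :
    Measurable fun p : (Fin n → ℝ) × (Fin n → ℝ) => forwardScore κ cβ fhat p.1 p.2 := by
  refine (measurable_score _ _).comp (measurable_pi_iff.2 fun i => ?_)
  refine measurable_mk_euclidean ((measurable_copulaRank i).comp measurable_fst)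
    ((measurable_copulaRank i).comp ?_)
  exact measurable_pi_iff.2 fun j => measurable_forwardResidual hf j

theorem measurable_binnedScore {n K : ℕ} {fold : Fin n → Fin K} {ghat : CrossFit fold}
    (hg : ∀ k, Measurable (Function.uncurry (ghat k))) (κ cβ : ℝ) (B : ℕ) :
    Measurable fun p : (Fin n → ℝ) × (Fin n → ℝ) => binnedScore κ cβ B ghat p.1 p.2 := by
  classical
  -- The index type of the binned cloud varies with the sample; it is constant once the bin pattern
  -- `c` is fixed.
  have h := measurable_of_countable_cases (δ := ℝ)
    (c := fun p : (Fin n → ℝ) × (Fin n → ℝ) => bin B p.2)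
    (fun c => measurable_snd (measurableSet_bin_eq B c))
    (F := fun c p => score (scale κ (Fintype.card {b // (c b).Nonempty}))
      (cβ * scale κ (Fintype.card {b // (c b).Nonempty}))
      (fun b : {b // (c b).Nonempty} => (!₂[binMean (c b.1) (copulaRank p.2),
        binMean (c b.1) (reverseResidual ghat p.1 p.2)] : EuclideanSpace ℝ (Fin 2))))
    fun c => by
      refine (measurable_score _ _).comp (measurable_pi_iff.2 fun b => ?_)
      refine measurable_mk_euclidean ?_ ?_
      · exact (Finset.measurable_sum _ fun i _ =>
          (measurable_copulaRank i).comp measurable_snd).div_const _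
      · exact (Finset.measurable_sum _ fun i _ => measurable_reverseResidual hg i).div_const _
  convert h using 2
  unfold binnedScore numBins binnedCloud
  congr!

/-! ### Bessel inequality and decoupled collisions -/

theorem memLp_two_indicator {Ω : Type*} [MeasurableSpace Ω] {P : Measure Ω}
    [IsFiniteMeasure P] {s : Set Ω} (hs : MeasurableSet s) :
    MemLp (s.indicator fun _ => (1 : ℝ)) 2 P :=
  memLp_indicator_const 2 hs 1 (Or.inr (measure_ne_top P s))

theorem covariance_indicator {Ω : Type*} [MeasurableSpace Ω] {P : Measure Ω}
    [IsProbabilityMeasure P] {s t : Set Ω} (hs : MeasurableSet s) (ht : MeasurableSet t) :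
    cov[s.indicator fun _ => (1 : ℝ), t.indicator fun _ => (1 : ℝ); P]
      = P.real (s ∩ t) - P.real s * P.real t := by
  rw [covariance_eq_sub (memLp_two_indicator hs) (memLp_two_indicator ht)]
  have h : ((s.indicator fun _ => (1 : ℝ)) * t.indicator fun _ => (1 : ℝ)) =
      (s ∩ t).indicator fun _ => (1 : ℝ) := by
    ext ω
    by_cases h1 : ω ∈ s <;> by_cases h2 : ω ∈ t <;> simp [h1, h2]
  rw [h, integral_indicator_const _ (hs.inter ht), integral_indicator_const _ hs,
    integral_indicator_const _ ht]
  simp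

/-- A Bessel inequality: the squared covariances of a fixed `g` with the level indicators of
pairwise independent integer variables of small atoms are jointly summable. -/
theorem sum_covariance_sq_le {Ω ι : Type*} [MeasurableSpace Ω] {P : Measure Ω}
    [IsProbabilityMeasure P] {e : ι → Ω → ℤ} (he : ∀ i, Measurable (e i))
    (hind : Pairwise fun i j => IndepFun (e i) (e j) P) (I : Finset ι) (Z : Finset ℤ) {q : ℝ}
    (hq : 0 < q) (hZ : ∀ i ∈ I, ∀ z ∈ Z, P.real {ω | e i ω = z} ≤ q) {g : Ω → ℝ}
    (hg : MemLp g 2 P) :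
    ∑ i ∈ I, ∑ z ∈ Z, cov[{ω | e i ω = z}.indicator fun _ => (1 : ℝ), g; P] ^ 2
      ≤ q * Var[g; P] := by
  classical
  set T : ι → ℤ → ℝ := fun i z => cov[{ω | e i ω = z}.indicator fun _ => (1 : ℝ), g; P] with hT
  have hlev : ∀ i z, MeasurableSet {ω | e i ω = z} := fun i z =>
    he i (measurableSet_singleton z)
  -- The test variable `∑ i, U i` weights each level indicator with its own covariance with `g`. Its
  -- covariance with `g` is then the sum `S` to be bounded, while by pairwise independence its
  -- variance is at most `q * S`.
  set φ : ι → ℤ → ℝ := fun i v => ∑ z ∈ Z, T i z * ({z} : Set ℤ).indicator (fun _ => 1) v with hφ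
  set U : ι → Ω → ℝ := fun i ω => φ i (e i ω) with hU
  have hUeq : ∀ i, U i = fun ω => ∑ z ∈ Z, T i z * {ω | e i ω = z}.indicator (fun _ => 1) ω := by
    intro i
    ext ω
    simp only [hU, hφ, Set.indicator_apply, Set.mem_singleton_iff, Set.mem_ofPred_eq]
  have hmem : ∀ i z, MemLp (fun ω => T i z * {ω | e i ω = z}.indicator (fun _ => (1 : ℝ)) ω) 2 P :=
    fun i z => (memLp_two_indicator (hlev i z)).const_mul (T i z)
  have hUmem : ∀ i, MemLp (U i) 2 P := by
    intro i
    rw [hUeq]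
    exact memLp_finsetSum _ fun z _ => hmem i z
  have hUU : ∀ i, φ i ∘ e i = U i := fun i => rfl
  have hUcov : ∀ i, cov[U i, g; P] = ∑ z ∈ Z, T i z ^ 2 := by
    intro i
    rw [hUeq, covariance_fun_sum_left' (fun z _ => hmem i z) hg]
    refine Finset.sum_congr rfl fun z _ => ?_
    rw [covariance_const_mul_left, sq]
  have hUvar : ∀ i ∈ I, Var[U i; P] ≤ q * ∑ z ∈ Z, T i z ^ 2 := by
    intro i hi
    refine (variance_le_expectation_sq (hUmem i).aestronglyMeasurable).trans ?_
    have hsq : (U i ^ 2) = fun ω => ∑ z ∈ Z, T i z ^ 2 * {ω | e i ω = z}.indicator (fun _ => 1) ω := by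
      ext ω
      rw [hUeq, Pi.pow_apply]
      simp only [Set.indicator_apply, Set.mem_ofPred_eq, mul_ite, mul_one, mul_zero,
        Finset.sum_ite_eq]
      split_ifs <;> simp
    rw [hsq, integral_finsetSum]
    · rw [Finset.mul_sum]
      refine Finset.sum_le_sum fun z hz => ?_
      rw [integral_const_mul, integral_indicator_const _ (hlev i z), smul_eq_mul, mul_one, mul_comm]
      exact mul_le_mul_of_nonneg_right (hZ i hi z hz) (sq_nonneg _)
    · intro z _
      exact ((memLp_two_indicator (hlev i z)).integrable one_le_two).const_mul _
  set S := ∑ i ∈ I, ∑ z ∈ Z, T i z ^ 2 with hS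
  have hvar : Var[∑ i ∈ I, U i; P] ≤ q * S := by
    rw [IndepFun.variance_sum (fun i _ => hUmem i), hS, Finset.mul_sum]
    · exact Finset.sum_le_sum hUvar
    · intro i _ j _ hij
      exact (hind hij).comp (measurable_of_countable (φ i)) (measurable_of_countable (φ j))
  have hcov : cov[∑ i ∈ I, U i, g; P] = S := by
    rw [covariance_sum_left' (fun i _ => hUmem i) hg]
    exact Finset.sum_congr rfl fun i _ => hUcov i
  have hsum : MemLp (∑ i ∈ I, U i) 2 P := memLp_finsetSum' _ fun i _ => hUmem i
  -- Expanding this variance gives `0 ≤ q * S - 2 * q * S + q ^ 2 * Var[g; P]`.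
  have hnn := variance_nonneg (∑ i ∈ I, U i - q • g) P
  rw [variance_sub hsum (hg.const_smul q), variance_smul, covariance_smul_right, hcov] at hnn
  have : q * S ≤ q * (q * Var[g; P]) := by nlinarith
  exact le_of_mul_le_mul_left this hq

/-- Collision mass of small-atom variables shifted by an arbitrary variable `H` of small range. -/
theorem sum_sq_prob_shift_le {Ω ι : Type*} [MeasurableSpace Ω] {P : Measure Ω}
    [IsProbabilityMeasure P] {e : ι → Ω → ℤ} (he : ∀ i, Measurable (e i))
    (hind : Pairwise fun i j => IndepFun (e i) (e j) P) (I : Finset ι) (Z S M : Finset ℤ) {q : ℝ}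
    (hq : 0 < q) (hZ : ∀ i ∈ I, ∀ z ∈ Z, P.real {ω | e i ω = z} ≤ q) {H : Ω → ℤ}
    (hH : Measurable H) :
    ∑ i ∈ I, ∑ m ∈ M, P.real {ω | e i ω ∈ Z ∧ H ω ∈ S ∧ e i ω + H ω = m} ^ 2
      ≤ 2 * q * I.card + 4 * S.card * q := by
  classical
  have hlev : ∀ i z, MeasurableSet {ω | e i ω = z} := fun i z =>
    he i (measurableSet_singleton z)
  have hHl : ∀ l, MeasurableSet {ω | H ω = l} := fun l => hH (measurableSet_singleton l)
  set a : ι → ℤ → ℝ := fun i m => P.real {ω | e i ω ∈ Z ∧ H ω ∈ S ∧ e i ω + H ω = m} with ha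
  set T : ι → ℤ → ℤ → ℝ := fun i z l =>
    cov[{ω | e i ω = z}.indicator fun _ => (1 : ℝ), {ω | H ω = l}.indicator fun _ => (1 : ℝ); P]
    with hT
  -- A joint probability of levels is a covariance plus a product. For fixed `m` the products sum to
  -- at most `q`, and `α i m` collects the covariances.
  set α : ι → ℤ → ℝ := fun i m => ∑ l ∈ S, if m - l ∈ Z then T i (m - l) l else 0 with hα
  have hHsum : ∑ l ∈ S, P.real {ω | H ω = l} ≤ 1 := by
    have h := measureReal_biUnion_finset (μ := P) (s := S) (f := fun l => {ω | H ω = l})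
      (fun l _ l' _ hll' => Set.disjoint_left.2 fun ω h h' => hll' (h.symm.trans h'))
      (fun l _ => hHl l)
    rw [← h]
    exact measureReal_le_one
  have ha0 : ∀ i m, 0 ≤ a i m := fun i m => measureReal_nonneg
  have haα : ∀ i ∈ I, ∀ m, a i m ≤ α i m + q := by
    intro i hi m
    have h1 : a i m ≤ ∑ l ∈ S, P.real
        (if m - l ∈ Z then {ω | e i ω = m - l} ∩ {ω | H ω = l} else ∅) := by
      refine (measureReal_mono ?_ (measure_ne_top _ _)).trans (measureReal_biUnion_finset_le S _)
      intro ω hω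
      simp only [Set.mem_ofPred_eq] at hω
      simp only [Set.mem_iUnion]
      refine ⟨H ω, hω.2.1, ?_⟩
      have h2 : e i ω = m - H ω := by omega
      rw [if_pos (h2 ▸ hω.1)]
      exact ⟨h2, rfl⟩
    refine h1.trans ?_
    calc _ ≤ ∑ l ∈ S, ((if m - l ∈ Z then T i (m - l) l else 0) + q * P.real {ω | H ω = l}) := by
          refine Finset.sum_le_sum fun l _ => ?_
          split_ifs with hl
          · have h3 := covariance_indicator (P := P) (hlev i (m - l)) (hHl l)
            have h4 : P.real ({ω | e i ω = m - l} ∩ {ω | H ω = l}) =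
              T i (m - l) l + P.real {ω | e i ω = m - l} * P.real {ω | H ω = l} := by
              simp only [hT]; rw [h3]; ring
            rw [h4]
            gcongr
            exact hZ i hi _ hl
          · simp only [measureReal_empty, zero_add]; positivity
      _ ≤ _ := by
          rw [Finset.sum_add_distrib, ← Finset.mul_sum]
          have : q * ∑ l ∈ S, P.real {ω | H ω = l} ≤ q * 1 := by gcongr
          simp only [hα]
          linarith
  -- Either `a i m ≤ 2 * q`, or the covariance part `α i m` is at least half of `a i m`.
  have hsq : ∀ i ∈ I, ∀ m, a i m ^ 2 ≤ 2 * q * a i m + 4 * α i m ^ 2 := by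
    intro i hi m
    have h1 := haα i hi m
    have h0 := ha0 i m
    rcases le_total (a i m) (2 * q) with h | h
    · nlinarith [sq_nonneg (α i m)]
    · nlinarith [mul_nonneg hq.le h0]
  have hasum : ∀ i, ∑ m ∈ M, a i m ≤ 1 := by
    intro i
    have h := measureReal_biUnion_finset (μ := P) (s := M)
      (f := fun m => {ω | e i ω ∈ Z ∧ H ω ∈ S ∧ e i ω + H ω = m})
      (fun l _ l' _ hll' => Set.disjoint_left.2 fun ω h h' => hll' (h.2.2.symm.trans h'.2.2))
      (fun m _ => ((he i) (Finset.measurableSet Z)).inter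
        ((hH (Finset.measurableSet S)).inter
          (((he i).add hH) (measurableSet_singleton m))))
    rw [← h]
    exact measureReal_le_one
  have hαsq : ∀ i m, α i m ^ 2 ≤ S.card * ∑ l ∈ S, if m - l ∈ Z then T i (m - l) l ^ 2 else 0 := by
    intro i m
    refine sq_sum_le_card_mul_sum_sq.trans (le_of_eq ?_)
    congr 1
    refine Finset.sum_congr rfl fun l _ => ?_
    split_ifs <;> simp
  have hαsum : ∀ i, ∑ m ∈ M, α i m ^ 2 ≤ S.card * ∑ l ∈ S, ∑ z ∈ Z, T i z l ^ 2 := by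
    intro i
    refine (Finset.sum_le_sum fun m _ => hαsq i m).trans ?_
    rw [← Finset.mul_sum, Finset.sum_comm]
    gcongr with l _
    rw [← Finset.sum_filter]
    refine (Finset.sum_image (s := M.filter fun m => m - l ∈ Z) (g := fun m => m - l)
      (f := fun z => T i z l ^ 2) (fun x _ y _ h => sub_left_injective h)).symm.le.trans ?_
    refine Finset.sum_le_sum_of_subset_of_nonneg ?_ fun _ _ _ => sq_nonneg _
    intro z hz
    obtain ⟨m, hm, rfl⟩ := Finset.mem_image.1 hz
    exact (Finset.mem_filter.1 hm).2
  -- The Bessel inequality for each indicator of `H = l`, whose variance is at most its probability.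
  -- These probabilities sum to at most one, so `S.card` enters only through Cauchy–Schwarz.
  have hbessel : ∑ i ∈ I, ∑ l ∈ S, ∑ z ∈ Z, T i z l ^ 2 ≤ q := by
    rw [Finset.sum_comm]
    calc _ ≤ ∑ l ∈ S, q * P.real {ω | H ω = l} := by
          refine Finset.sum_le_sum fun l _ => ?_
          refine (sum_covariance_sq_le he hind I Z hq hZ (memLp_two_indicator (hHl l))).trans ?_
          gcongr
          refine (variance_le_expectation_sq
            (memLp_two_indicator (hHl l)).aestronglyMeasurable).trans (le_of_eq ?_)
          have : ({ω | H ω = l}.indicator fun _ => (1 : ℝ)) ^ 2 =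
              {ω | H ω = l}.indicator fun _ => (1 : ℝ) := by
            ext ω
            by_cases h : H ω = l <;> simp [h]
          rw [this, integral_indicator_const _ (hHl l)]
          simp
      _ = q * ∑ l ∈ S, P.real {ω | H ω = l} := by rw [Finset.mul_sum]
      _ ≤ q * 1 := by gcongr
      _ = q := mul_one q
  calc ∑ i ∈ I, ∑ m ∈ M, a i m ^ 2
      ≤ ∑ i ∈ I, (2 * q + 4 * (S.card * ∑ l ∈ S, ∑ z ∈ Z, T i z l ^ 2)) := by
        refine Finset.sum_le_sum fun i hi => ?_
        calc _ ≤ ∑ m ∈ M, (2 * q * a i m + 4 * α i m ^ 2) :=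
              Finset.sum_le_sum fun m _ => hsq i hi m
          _ = 2 * q * ∑ m ∈ M, a i m + 4 * ∑ m ∈ M, α i m ^ 2 := by
              rw [Finset.sum_add_distrib, Finset.mul_sum, Finset.mul_sum]
          _ ≤ 2 * q * 1 + 4 * (S.card * ∑ l ∈ S, ∑ z ∈ Z, T i z l ^ 2) := by
              gcongr
              · exact hasum i
              · exact hαsum i
          _ = _ := by ring
    _ = 2 * q * I.card + 4 * S.card * ∑ i ∈ I, ∑ l ∈ S, ∑ z ∈ Z, T i z l ^ 2 := by
        rw [Finset.sum_add_distrib, Finset.sum_const, nsmul_eq_mul, ← Finset.mul_sum,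
          ← Finset.mul_sum]
        ring
    _ ≤ _ := by gcongr

/-- Decoupled collision bound: two independent samples, each shifted by functions of the other one
of small range, have few collisions. -/
theorem sum_prob_collision_le {Ω₁ Ω₂ ι : Type*} [MeasurableSpace Ω₁]
    [MeasurableSpace Ω₂] {P₁ : Measure Ω₁} {P₂ : Measure Ω₂}
    [IsProbabilityMeasure P₁] [IsProbabilityMeasure P₂] {e : ι → Ω₁ → ℤ} {e' : ι → Ω₂ → ℤ}
    (he : ∀ i, Measurable (e i)) (he' : ∀ i, Measurable (e' i))
    (hind : Pairwise fun i j => IndepFun (e i) (e j) P₁)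
    (hind' : Pairwise fun i j => IndepFun (e' i) (e' j) P₂) (I J : Finset ι) (Z S : Finset ℤ)
    {q : ℝ} (hq : 0 < q) (hZ : ∀ i ∈ I, ∀ z ∈ Z, P₁.real {ω | e i ω = z} ≤ q)
    (hZ' : ∀ j ∈ J, ∀ z ∈ Z, P₂.real {ω | e' j ω = z} ≤ q)
    {H : ι → Ω₁ → ℤ} {H' : ι → Ω₂ → ℤ} (hH : ∀ i, Measurable (H i)) (hH' : ∀ i, Measurable (H' i))
    (W : ι → ι → Prop) [∀ i j, Decidable (W i j)] (d : ℤ) :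
    ∑ i ∈ I, ∑ j ∈ J with W i j, (P₁.prod P₂).real {p | (e i p.1 ∈ Z ∧ H j p.1 ∈ S) ∧
      (e' j p.2 ∈ Z ∧ H' i p.2 ∈ S) ∧ e i p.1 + H j p.1 = e' j p.2 + H' i p.2 + d} ≤
    2 * q * (∑ i ∈ I, ({j ∈ J | W i j}.card : ℝ)) + 2 * S.card * q * (I.card + J.card) := by
  classical
  set M : Finset ℤ := (Z ×ˢ S).image fun p => p.1 + p.2 with hM
  set A : ι → ι → ℤ → ℝ := fun i j m =>
    P₁.real {ω | e i ω ∈ Z ∧ H j ω ∈ S ∧ e i ω + H j ω = m} with hA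
  set B : ι → ι → ℤ → ℝ := fun i j m =>
    P₂.real {ω | e' j ω ∈ Z ∧ H' i ω ∈ S ∧ e' j ω + H' i ω = m} with hB
  -- The two sides live on independent factors. Splitting over the common value gives products `A *
  -- B`, and `A * B ≤ (A ^ 2 + B ^ 2) / 2` separates the samples.
  have hpair : ∀ i j, (P₁.prod P₂).real {p | (e i p.1 ∈ Z ∧ H j p.1 ∈ S) ∧
      (e' j p.2 ∈ Z ∧ H' i p.2 ∈ S) ∧ e i p.1 + H j p.1 = e' j p.2 + H' i p.2 + d} ≤
      (∑ m ∈ M, A i j m ^ 2) / 2 + (∑ m ∈ M, B i j (m - d) ^ 2) / 2 := by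
    intro i j
    calc _ ≤ ∑ m ∈ M, (P₁.prod P₂).real
          ({ω | e i ω ∈ Z ∧ H j ω ∈ S ∧ e i ω + H j ω = m} ×ˢ
          {ω | e' j ω ∈ Z ∧ H' i ω ∈ S ∧ e' j ω + H' i ω = m - d}) := by
          refine (measureReal_mono ?_ (measure_ne_top _ _)).trans
            (measureReal_biUnion_finset_le M _)
          rintro ⟨ω, ω'⟩ ⟨⟨h1, h2⟩, ⟨h3, h4⟩, h5⟩
          simp only [Set.mem_iUnion]
          refine ⟨e i ω + H j ω, Finset.mem_image.2 ⟨(e i ω, H j ω), ?_, rfl⟩, ?_⟩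
          · exact Finset.mem_product.2 ⟨h1, h2⟩
          · refine Set.mk_mem_prod ⟨h1, h2, rfl⟩ ⟨h3, h4, ?_⟩
            simp only at h5
            omega
      _ = ∑ m ∈ M, A i j m * B i j (m - d) := by
          refine Finset.sum_congr rfl fun m _ => ?_
          rw [measureReal_prod_prod]
      _ ≤ ∑ m ∈ M, (A i j m ^ 2 / 2 + B i j (m - d) ^ 2 / 2) := by
          refine Finset.sum_le_sum fun m _ => ?_
          nlinarith [sq_nonneg (A i j m - B i j (m - d))]
      _ = _ := by rw [Finset.sum_add_distrib, Finset.sum_div, Finset.sum_div]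
  set N : ℝ := ∑ i ∈ I, ({j ∈ J | W i j}.card : ℝ) with hN
  have hN' : N = ∑ j ∈ J, ({i ∈ I | W i j}.card : ℝ) := by
    rw [hN]
    simp_rw [Finset.card_filter]
    push_cast
    rw [Finset.sum_comm]
  -- The shift `H j` does not depend on `i`, so for fixed `j` the sum over `i` is one application of
  -- `sum_sq_prob_shift_le`. The `B` half is summed over `j` with `i` fixed.
  have h1 : ∑ i ∈ I, ∑ j ∈ J with W i j, ∑ m ∈ M, A i j m ^ 2 ≤
      2 * q * N + 4 * S.card * q * J.card := by
    calc _ = ∑ j ∈ J, ∑ i ∈ I with W i j, ∑ m ∈ M, A i j m ^ 2 := by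
          simp_rw [Finset.sum_filter]
          rw [Finset.sum_comm]
      _ ≤ ∑ j ∈ J, (2 * q * {i ∈ I | W i j}.card + 4 * S.card * q) := by
          refine Finset.sum_le_sum fun j _ => ?_
          exact sum_sq_prob_shift_le he hind _ Z S M hq
            (fun i hi => hZ i (Finset.mem_filter.1 hi).1) (hH j)
      _ = _ := by
          rw [Finset.sum_add_distrib, ← Finset.mul_sum, ← hN', Finset.sum_const, nsmul_eq_mul]
          ring
  have h2 : ∑ i ∈ I, ∑ j ∈ J with W i j, ∑ m ∈ M, B i j (m - d) ^ 2 ≤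
      2 * q * N + 4 * S.card * q * I.card := by
    calc _ ≤ ∑ i ∈ I, (2 * q * {j ∈ J | W i j}.card + 4 * S.card * q) := by
          refine Finset.sum_le_sum fun i _ => ?_
          have h3 := sum_sq_prob_shift_le he' hind' {j ∈ J | W i j} Z S (M.image fun m => m - d) hq
            (fun j hj => hZ' j (Finset.mem_filter.1 hj).1) (hH' i)
          simp_rw [Finset.sum_image (fun x _ y _ h => sub_left_injective h :
            Set.InjOn (fun m : ℤ => m - d) M)] at h3
          exact h3
      _ = _ := by
          rw [Finset.sum_add_distrib, ← Finset.mul_sum, ← hN, Finset.sum_const, nsmul_eq_mul]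
          ring
  calc _ ≤ ∑ i ∈ I, ∑ j ∈ J with W i j,
        ((∑ m ∈ M, A i j m ^ 2) / 2 + (∑ m ∈ M, B i j (m - d) ^ 2) / 2) :=
        Finset.sum_le_sum fun i _ => Finset.sum_le_sum fun j _ => hpair i j
    _ = (∑ i ∈ I, ∑ j ∈ J with W i j, ∑ m ∈ M, A i j m ^ 2) / 2 +
        (∑ i ∈ I, ∑ j ∈ J with W i j, ∑ m ∈ M, B i j (m - d) ^ 2) / 2 := by
        simp_rw [Finset.sum_add_distrib, Finset.sum_div]
    _ ≤ _ := by linarith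

/-! ### Resampling coordinates, and collisions within and across folds -/

/-- Replacing some coordinates by an independent copy preserves the product law. Conditioning on the
other coordinates is carried out in this form. -/
theorem measurePreserving_splice {ι α : Type*} [Fintype ι] [MeasurableSpace α] (μ : Measure α)
    [IsProbabilityMeasure μ] (s : ι → Prop) [DecidablePred s] :
    MeasurePreserving (fun p : (ι → α) × (ι → α) => fun i => if s i then p.1 i else p.2 i)
      ((Measure.pi fun _ => μ).prod (Measure.pi fun _ => μ)) (Measure.pi fun _ => μ) := by
  have hm : Measurable
      (fun p : (ι → α) × (ι → α) => fun i => if s i then p.1 i else p.2 i) := by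
    refine measurable_pi_iff.2 fun i => ?_
    by_cases h : s i
    · simp only [h, if_true]; fun_prop
    · simp only [h, if_false]; fun_prop
  refine ⟨hm, (Measure.pi_eq fun t ht => ?_).symm⟩
  rw [Measure.map_apply hm (MeasurableSet.univ_pi ht)]
  have : (fun p : (ι → α) × (ι → α) => fun i => if s i then p.1 i else p.2 i) ⁻¹'
      Set.univ.pi t = (Set.univ.pi fun i => if s i then t i else Set.univ) ×ˢ
        (Set.univ.pi fun i => if s i then Set.univ else t i) := by
    ext p
    simp only [Set.mem_preimage, Set.mem_pi, Set.mem_univ, true_imp_iff, Set.mem_prod,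
      ← forall_and]
    refine forall_congr' fun i => ?_
    by_cases h : s i <;> simp [h]
  rw [this, Measure.prod_prod, Measure.pi_pi, Measure.pi_pi, ← Finset.prod_mul_distrib]
  refine Finset.prod_congr rfl fun i _ => ?_
  by_cases h : s i <;> simp [h]

theorem pi_apply_eq_lintegral_splice {ι α : Type*} [Fintype ι] [MeasurableSpace α] (μ : Measure α)
    [IsProbabilityMeasure μ] (s : ι → Prop) [DecidablePred s] {E : Set (ι → α)}
    (hE : MeasurableSet E) :
    Measure.pi (fun _ => μ) E = ∫⁻ e₀, Measure.pi (fun _ => μ)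
      {e | (fun i => if s i then e i else e₀ i) ∈ E} ∂Measure.pi fun _ => μ := by
  have h := measurePreserving_splice μ s
  rw [← h.measure_preimage hE.nullMeasurableSet, Measure.prod_apply_symm (h.measurable hE)]
  rfl

theorem pi_apply_eq_lintegral_splice₂ {ι α : Type*} [Fintype ι] [MeasurableSpace α] (μ : Measure α)
    [IsProbabilityMeasure μ] (s t : ι → Prop) [DecidablePred s] [DecidablePred t]
    {E : Set (ι → α)} (hE : MeasurableSet E) :
    Measure.pi (fun _ => μ) E = ∫⁻ e₀, ((Measure.pi fun _ => μ).prod (Measure.pi fun _ => μ))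
      {p | (fun i => if s i then p.1 i else if t i then p.2 i else e₀ i) ∈ E}
        ∂Measure.pi fun _ => μ := by
  have h1 := measurePreserving_splice μ s
  have h2 := measurePreserving_splice μ t
  have h3 := h1.comp ((MeasurePreserving.id (Measure.pi fun _ : ι => μ)).prod h2)
  have h4 := h3.comp (measurePreserving_prodAssoc (Measure.pi fun _ : ι => μ)
    (Measure.pi fun _ : ι => μ) (Measure.pi fun _ : ι => μ))
  rw [← h4.measure_preimage hE.nullMeasurableSet, Measure.prod_apply_symm (h4.measurable hE)]
  rfl

theorem card_Icc_floor_le {M w : ℝ} (hM : 0 ≤ M) (hw : 0 < w) :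
    ((Finset.Icc ⌊-M / w⌋ ⌊M / w⌋).card : ℝ) ≤ 2 * M / w + 2 := by
  rw [Int.card_Icc]
  have h3 : ⌊-M / w⌋ ≤ ⌊M / w⌋ := Int.floor_mono (by gcongr; linarith)
  have h4 : (((⌊M / w⌋ + 1 - ⌊-M / w⌋).toNat : ℤ) : ℝ) = ⌊M / w⌋ + 1 - ⌊-M / w⌋ := by
    rw [Int.toNat_of_nonneg (by omega)]; push_cast; ring
  rw [Int.cast_natCast] at h4
  rw [h4]
  have h5 := Int.floor_le (M / w)
  have h6 := Int.lt_floor_add_one (-M / w)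
  have h7 : 2 * M / w = M / w - (-M / w) := by ring
  rw [h7]; linarith

theorem floor_mem_Icc {M w x : ℝ} (hw : 0 < w) (hx : |x| ≤ M) :
    ⌊x / w⌋ ∈ Finset.Icc ⌊-M / w⌋ ⌊M / w⌋ := by
  have h1 := abs_le.1 hx
  rw [Finset.mem_Icc]
  exact ⟨Int.floor_mono (by gcongr; exact h1.1), Int.floor_mono (by gcongr; exact h1.2)⟩

/-- The event that two shifted coordinates, with noise in `[-L, L]` and shifts in `[-δ, δ]`,
are within `w` of each other. -/
def collisionEvent {n : ℕ} (h : Fin n → (Fin n → ℝ) → ℝ) (L δ w : ℝ) (i j : Fin n) :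
    Set (Fin n → ℝ) :=
  {e | (|e i| ≤ L ∧ |e j| ≤ L) ∧ (|h i e| ≤ δ ∧ |h j e| ≤ δ) ∧
    |(e i - h i e) - (e j - h j e)| ≤ w}

theorem measurableSet_collisionEvent {n : ℕ} {h : Fin n → (Fin n → ℝ) → ℝ}
    (hh : ∀ i, Measurable (h i)) (L δ w : ℝ) (i j : Fin n) :
    MeasurableSet (collisionEvent h L δ w i j) := by
  have h1 : ∀ i : Fin n, Measurable fun e : Fin n → ℝ => |e i| := fun i =>
    (measurable_pi_apply i).abs
  have h2 : ∀ i : Fin n, Measurable fun e : Fin n → ℝ => |h i e| := fun i => (hh i).abs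
  have h3 : Measurable fun e : Fin n → ℝ => |(e i - h i e) - (e j - h j e)| :=
    (((measurable_pi_apply i).sub (hh i)).sub ((measurable_pi_apply j).sub (hh j))).abs
  exact ((measurableSet_le (h1 i) measurable_const).inter
    (measurableSet_le (h1 j) measurable_const)).inter
    (((measurableSet_le (h2 i) measurable_const).inter
    (measurableSet_le (h2 j) measurable_const)).inter (measurableSet_le h3 measurable_const))

/-- Neither error depends on the noise of the common fold. Freezing everything but `e i` leaves the
event that `e i` is within `w` of a fixed `c`, covered by two intervals of length `w`. -/
theorem collision_same_fold_le {n K : ℕ} (fold : Fin n → Fin K) {ν : Measure ℝ}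
    [IsProbabilityMeasure ν] {h : Fin n → (Fin n → ℝ) → ℝ} (hh : ∀ i, Measurable (h i))
    (hloc : ∀ i e e', (∀ j, fold j ≠ fold i → e j = e' j) → h i e = h i e')
    {L δ w q : ℝ} (hw : 0 < w) (hν : ∀ c, |c| ≤ L + 2 * w → ν.real (Icc c (c + w)) ≤ q)
    (hq : 0 < q) {i j : Fin n} (hij : i ≠ j) (hf : fold i = fold j) :
    Measure.pi (fun _ => ν) (collisionEvent h L δ w i j) ≤ ENNReal.ofReal (2 * q) := by
  classical
  rw [pi_apply_eq_lintegral_splice ν (· = i) (measurableSet_collisionEvent hh L δ w i j)]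
  have key : ∀ e₀ : Fin n → ℝ, Measure.pi (fun _ => ν)
      {e | (fun m => if m = i then e m else e₀ m) ∈ collisionEvent h L δ w i j} ≤
        ENNReal.ofReal (2 * q) := by
    intro e₀
    set c : ℝ := h i e₀ + (e₀ j - h j e₀) with hc
    have hsub : {e : Fin n → ℝ | (fun m => if m = i then e m else e₀ m) ∈
        collisionEvent h L δ w i j} ⊆ Function.eval i ⁻¹' {z | |z| ≤ L ∧ |z - c| ≤ w} := by
      intro e he
      simp only [collisionEvent, Set.mem_ofPred_eq, if_true, hij.symm, if_false] at he
      have e1 : h i (fun m => if m = i then e m else e₀ m) = h i e₀ :=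
        hloc _ _ _ fun m hm => if_neg fun hmi => hm (by rw [hmi])
      have e2 : h j (fun m => if m = i then e m else e₀ m) = h j e₀ :=
        hloc _ _ _ fun m hm => if_neg fun hmi => hm (by rw [hmi, hf])
      rw [e1, e2] at he
      refine ⟨he.1.1, ?_⟩
      have : Function.eval i e - c = e i - h i e₀ - (e₀ j - h j e₀) := by
        simp only [Function.eval, hc]; ring
      rw [this]
      exact he.2.2
    -- If the event is nonempty then `c` is within `L + w` of the origin, so the left interval,
    -- starting at `c - w`, is within the reach `L + 2 * w` of `hν`.
    have hbd : ∀ z : ℝ, |z| ≤ L ∧ |z - c| ≤ w → |c| ≤ L + w := by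
      intro z hz
      calc |c| = |z - (z - c)| := by congr 1; ring
        _ ≤ |z| + |z - c| := abs_sub _ _
        _ ≤ L + w := add_le_add hz.1 hz.2
    refine (measure_mono hsub).trans ?_
    have hms : MeasurableSet {z : ℝ | |z| ≤ L ∧ |z - c| ≤ w} :=
      (measurableSet_le measurable_id.abs measurable_const).inter
        (measurableSet_le (measurable_id.sub_const c).abs measurable_const)
    rw [(measurePreserving_eval (fun _ : Fin n => ν) i).measure_preimage hms.nullMeasurableSet]
    rw [← ofReal_measureReal]
    refine ENNReal.ofReal_le_ofReal ?_
    rcases Set.eq_empty_or_nonempty {z : ℝ | |z| ≤ L ∧ |z - c| ≤ w} with h0 | ⟨z, hz⟩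
    · rw [h0]; simp [hq.le]
    have hcb := abs_le.1 (hbd z hz)
    have hsub2 : {z : ℝ | |z| ≤ L ∧ |z - c| ≤ w} ⊆ Icc (c - w) (c - w + w) ∪ Icc c (c + w) := by
      intro z hz
      have h1 := abs_le.1 hz.2
      rcases le_total z c with h2 | h2
      · exact Or.inl ⟨by linarith, by linarith⟩
      · exact Or.inr ⟨by linarith, by linarith⟩
    refine (measureReal_mono hsub2 (measure_ne_top _ _)).trans ((measureReal_union_le _ _).trans ?_)
    have h1 := hν (c - w) (abs_le.2 ⟨by linarith, by linarith⟩)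
    have h2 := hν c (abs_le.2 ⟨by linarith, by linarith⟩)
    linarith
  calc _ ≤ ∫⁻ _, ENNReal.ofReal (2 * q) ∂Measure.pi fun _ : Fin n => ν := lintegral_mono key
    _ = _ := by simp

/-- The shifts change sides, so that only sums appear. The fractional parts alter a difference of
size at most one by less than two, so the resulting integer lies strictly between `-3` and `3`. -/
theorem floor_collision {a b c d w : ℝ} (hw : 0 < w) (h : |(a - d) - (c - b)| ≤ w) :
    (⌊a / w⌋ + ⌊b / w⌋) - (⌊c / w⌋ + ⌊d / w⌋) ∈ Finset.Icc (-2 : ℤ) 2 := by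
  have h1 : |(a / w + b / w) - (c / w + d / w)| ≤ 1 := by
    have : (a / w + b / w) - (c / w + d / w) = ((a - d) - (c - b)) / w := by ring
    rw [this, abs_div, abs_of_pos hw, div_le_one hw]
    exact h
  have h2 := abs_le.1 h1
  have a1 := Int.floor_le (a / w)
  have a2 := Int.lt_floor_add_one (a / w)
  have b1 := Int.floor_le (b / w)
  have b2 := Int.lt_floor_add_one (b / w)
  have c1 := Int.floor_le (c / w)
  have c2 := Int.lt_floor_add_one (c / w)
  have d1 := Int.floor_le (d / w)
  have d2 := Int.lt_floor_add_one (d / w)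
  rw [Finset.mem_Icc]
  have u : (((⌊a / w⌋ + ⌊b / w⌋) - (⌊c / w⌋ + ⌊d / w⌋) : ℤ) : ℝ) < ((3 : ℤ) : ℝ) := by
    push_cast; linarith
  have l : ((-3 : ℤ) : ℝ) < (((⌊a / w⌋ + ⌊b / w⌋) - (⌊c / w⌋ + ⌊d / w⌋) : ℤ) : ℝ) := by
    push_cast; linarith
  have u' := Int.cast_lt.1 u
  have l' := Int.cast_lt.1 l
  constructor <;> omega

/-- A collision means that `e i + h j` and `e j + h i` are within `w`. With the noise outside folds
`k` and `l` frozen, `h j` sees only fold `k` and `h i` only fold `l`. The two sides are therefore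
independent, and after rounding to multiples of `w` they fall under `sum_prob_collision_le`. -/
theorem sum_collision_cross_fold_le {n K : ℕ} (fold : Fin n → Fin K) {ν : Measure ℝ}
    [IsProbabilityMeasure ν] {h : Fin n → (Fin n → ℝ) → ℝ} (hh : ∀ i, Measurable (h i))
    (hloc : ∀ i e e', (∀ j, fold j ≠ fold i → e j = e' j) → h i e = h i e')
    {L δ w q : ℝ} (hδ : 0 ≤ δ) (hw : 0 < w)
    (hν : ∀ c, |c| ≤ L + 2 * w → ν.real (Icc c (c + w)) ≤ q)
    (hq : 0 < q) (W : Fin n → Fin n → Prop) [∀ i j, Decidable (W i j)] {k l : Fin K}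
    (hkl : k ≠ l) :
    ∑ i with fold i = k, ∑ j with fold j = l ∧ W i j,
      Measure.pi (fun _ => ν) (collisionEvent h L δ w i j) ≤
    ENNReal.ofReal (5 * (2 * q * (∑ i with fold i = k, (({j | fold j = l ∧ W i j} : Finset _).card : ℝ))
      + 2 * (2 * δ / w + 2) * q * n * 2)) := by
  classical
  set I : Finset (Fin n) := Finset.univ.filter fun i => fold i = k with hI
  set J : Finset (Fin n) := Finset.univ.filter fun j => fold j = l with hJ
  have hJW : ∀ i, (Finset.univ.filter fun j => fold j = l ∧ W i j) = J.filter (W i) := by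
    intro i
    rw [hJ, Finset.filter_filter]
  simp_rw [hJW]
  set C : ℝ := 5 * (2 * q * (∑ i ∈ I, ((J.filter (W i)).card : ℝ))
      + 2 * (2 * δ / w + 2) * q * n * 2) with hC
  set Φ : (Fin n → ℝ) → (Fin n → ℝ) → (Fin n → ℝ) → Fin n → ℝ := fun e₀ e₁ e₂ m =>
    if fold m = k then e₁ m else if fold m = l then e₂ m else e₀ m with hΦ
  have hE := fun i j => measurableSet_collisionEvent hh L δ w i j
  have hmeasΦ : ∀ e₀, Measurable fun p : (Fin n → ℝ) × (Fin n → ℝ) => Φ e₀ p.1 p.2 := by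
    intro e₀
    refine measurable_pi_iff.2 fun m => ?_
    by_cases h1 : fold m = k
    · simp only [hΦ, h1, if_true]; fun_prop
    · by_cases h2 : fold m = l
      · simp only [hΦ, h2, if_true, if_false, hkl.symm]; fun_prop
      · simp only [hΦ, h1, h2, if_false]; exact measurable_const
  have hsection : ∀ i j, Measurable fun e₀ =>
      ((Measure.pi fun _ => ν).prod (Measure.pi fun _ => ν))
        {p : (Fin n → ℝ) × (Fin n → ℝ) | Φ e₀ p.1 p.2 ∈ collisionEvent h L δ w i j} := by
    intro i j
    have hm : Measurable fun p : ((Fin n → ℝ) × (Fin n → ℝ)) × (Fin n → ℝ) =>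
        Φ p.2 p.1.1 p.1.2 := by
      refine measurable_pi_iff.2 fun m => ?_
      by_cases h1 : fold m = k
      · simp only [hΦ, h1, if_true]; fun_prop
      · by_cases h2 : fold m = l
        · simp only [hΦ, h2, if_true, if_false, hkl.symm]; fun_prop
        · simp only [hΦ, h1, h2, if_false]; fun_prop
    exact measurable_measure_prodMk_right (hm (hE i j))
  have hint : ∀ i j, Measure.pi (fun _ => ν) (collisionEvent h L δ w i j) =
      ∫⁻ e₀, ((Measure.pi fun _ => ν).prod (Measure.pi fun _ => ν))
        {p : (Fin n → ℝ) × (Fin n → ℝ) | Φ e₀ p.1 p.2 ∈ collisionEvent h L δ w i j}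
        ∂Measure.pi fun _ => ν := fun i j =>
    pi_apply_eq_lintegral_splice₂ ν (fun m => fold m = k) (fun m => fold m = l) (hE i j)
  simp_rw [hint]
  have hpt : ∀ e₀, ∑ i ∈ I, ∑ j ∈ J with W i j,
      ((Measure.pi fun _ => ν).prod (Measure.pi fun _ => ν))
        {p : (Fin n → ℝ) × (Fin n → ℝ) | Φ e₀ p.1 p.2 ∈ collisionEvent h L δ w i j} ≤
      ENNReal.ofReal C := by
    intro e₀
    set Z := Finset.Icc ⌊-L / w⌋ ⌊L / w⌋ with hZ
    set S := Finset.Icc ⌊-δ / w⌋ ⌊δ / w⌋ with hS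
    set ε : Fin n → (Fin n → ℝ) → ℤ := fun i e => ⌊e i / w⌋ with hε
    -- For `j` in fold `l`, `h j` ignores that fold, so filling both folds from one copy changes
    -- nothing and makes the shift a function of that copy; likewise for `i` in fold `k`.
    set H : Fin n → (Fin n → ℝ) → ℤ := fun j e => ⌊h j (Φ e₀ e e) / w⌋ with hH
    have hεm : ∀ i, Measurable (ε i) := fun i =>
      Int.measurable_floor.comp (Measurable.div_const (by fun_prop) w)
    have hHm : ∀ i, Measurable (H i) := fun i =>
      Int.measurable_floor.comp (((hh i).comp ((hmeasΦ e₀).comp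
        (measurable_id.prodMk measurable_id))).div_const w)
    have hind : Pairwise fun i j => IndepFun (ε i) (ε j) (Measure.pi fun _ : Fin n => ν) := by
      intro i j hij
      have h1 := iIndepFun_pi (μ := fun _ : Fin n => ν) (X := fun _ x => ⌊x / w⌋)
        (fun _ => (Int.measurable_floor.comp (measurable_id.div_const w)).aemeasurable)
      exact h1.indepFun hij
    have hatom : ∀ i : Fin n, ∀ z ∈ Z,
        (Measure.pi fun _ : Fin n => ν).real {e | ε i e = z} ≤ q := by
      intro i z hz
      rw [hZ, Finset.mem_Icc] at hz
      have hsub : {e | ε i e = z} ⊆ Function.eval i ⁻¹' Icc ((z : ℝ) * w) (z * w + w) := by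
        intro e he
        have h1 : ⌊e i / w⌋ = z := he
        have h2 := Int.floor_le (e i / w)
        have h3 := Int.lt_floor_add_one (e i / w)
        rw [h1] at h2 h3
        rw [le_div_iff₀ hw] at h2
        rw [div_lt_iff₀ hw] at h3
        exact ⟨h2, by simp only [Function.eval]; linarith⟩
      refine (measureReal_mono hsub (measure_ne_top _ _)).trans ?_
      rw [measureReal_def, (measurePreserving_eval (fun _ : Fin n => ν) i).measure_preimage
        measurableSet_Icc.nullMeasurableSet]
      refine hν _ (abs_le.2 ⟨?_, ?_⟩)
      · have h1 : (⌊-L / w⌋ : ℝ) ≤ z := by exact_mod_cast hz.1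
        have h2 := Int.lt_floor_add_one (-L / w)
        have h3 : -L / w - 1 ≤ z := by linarith
        have h4 : (-L / w - 1) * w ≤ z * w := by gcongr
        have h5 : (-L / w - 1) * w = -L - w := by field_simp
        linarith
      · have h1 : (z : ℝ) ≤ L / w := (Int.cast_le.2 hz.2).trans (Int.floor_le _)
        rw [le_div_iff₀ hw] at h1
        linarith
    have hsub : ∀ i ∈ I, ∀ j ∈ J,
        {p : (Fin n → ℝ) × (Fin n → ℝ) | Φ e₀ p.1 p.2 ∈ collisionEvent h L δ w i j} ⊆
        ⋃ d ∈ Finset.Icc (-2 : ℤ) 2, {p | (ε i p.1 ∈ Z ∧ H j p.1 ∈ S) ∧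
          (ε j p.2 ∈ Z ∧ H i p.2 ∈ S) ∧ ε i p.1 + H j p.1 = ε j p.2 + H i p.2 + d} := by
      rintro i hi j hj ⟨e₁, e₂⟩ hp
      have hi' : fold i = k := (Finset.mem_filter.1 hi).2
      have hj' : fold j = l := (Finset.mem_filter.1 hj).2
      have hp' : Φ e₀ e₁ e₂ ∈ collisionEvent h L δ w i j := hp
      have e1 : Φ e₀ e₁ e₂ i = e₁ i := if_pos hi'
      have e2 : Φ e₀ e₁ e₂ j = e₂ j := by
        simp only [hΦ, hj', hkl.symm, if_false, if_true]
      have e3 : h j (Φ e₀ e₁ e₂) = h j (Φ e₀ e₁ e₁) := by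
        refine hloc _ _ _ fun m hm => ?_
        rw [hj'] at hm
        simp only [hΦ, hm, if_false]
      have e4 : h i (Φ e₀ e₁ e₂) = h i (Φ e₀ e₂ e₂) := by
        refine hloc _ _ _ fun m hm => ?_
        rw [hi'] at hm
        simp only [hΦ, hm, if_false]
      simp only [collisionEvent, Set.mem_ofPred_eq, e1, e2, e3, e4] at hp'
      obtain ⟨⟨h1, h2⟩, ⟨h3, h4⟩, h5⟩ := hp'
      have h6 := floor_collision hw h5
      simp only [Set.mem_iUnion]
      refine ⟨_, h6, ⟨floor_mem_Icc hw h1, floor_mem_Icc hw h4⟩,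
        ⟨floor_mem_Icc hw h2, floor_mem_Icc hw h3⟩, ?_⟩
      simp only [hε, hH]
      ring
    have hreal : ∑ i ∈ I, ∑ j ∈ J with W i j,
        ((Measure.pi fun _ => ν).prod (Measure.pi fun _ => ν)).real
        {p : (Fin n → ℝ) × (Fin n → ℝ) | Φ e₀ p.1 p.2 ∈ collisionEvent h L δ w i j} ≤ C := by
      calc _ ≤ ∑ i ∈ I, ∑ j ∈ J with W i j, ∑ d ∈ Finset.Icc (-2 : ℤ) 2,
            ((Measure.pi fun _ => ν).prod (Measure.pi fun _ => ν)).real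
            {p : (Fin n → ℝ) × (Fin n → ℝ) | (ε i p.1 ∈ Z ∧ H j p.1 ∈ S) ∧
          (ε j p.2 ∈ Z ∧ H i p.2 ∈ S) ∧ ε i p.1 + H j p.1 = ε j p.2 + H i p.2 + d} := by
            refine Finset.sum_le_sum fun i hi => Finset.sum_le_sum fun j hj => ?_
            exact (measureReal_mono (hsub i hi j (Finset.mem_filter.1 hj).1)
              (measure_ne_top _ _)).trans (measureReal_biUnion_finset_le _ _)
        _ = ∑ d ∈ Finset.Icc (-2 : ℤ) 2, ∑ i ∈ I, ∑ j ∈ J with W i j,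
            ((Measure.pi fun _ => ν).prod (Measure.pi fun _ => ν)).real
            {p : (Fin n → ℝ) × (Fin n → ℝ) | (ε i p.1 ∈ Z ∧ H j p.1 ∈ S) ∧
          (ε j p.2 ∈ Z ∧ H i p.2 ∈ S) ∧ ε i p.1 + H j p.1 = ε j p.2 + H i p.2 + d} := by
            rw [Finset.sum_comm]
            refine Finset.sum_congr rfl fun i _ => ?_
            rw [Finset.sum_comm]
        _ ≤ ∑ d ∈ Finset.Icc (-2 : ℤ) 2, (2 * q * (∑ i ∈ I, ((J.filter (W i)).card : ℝ))
            + 2 * S.card * q * (I.card + J.card)) :=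
            Finset.sum_le_sum fun d _ => sum_prob_collision_le hεm hεm hind hind I J Z S hq
              (fun i _ => hatom i) (fun i _ => hatom i) hHm hHm W d
        _ ≤ C := by
            rw [Finset.sum_const, nsmul_eq_mul]
            have h5 : ((Finset.Icc (-2 : ℤ) 2).card : ℝ) = 5 := by simp
            rw [h5, hC]
            have hIn : (I.card : ℝ) ≤ n := by
              exact_mod_cast (Finset.card_le_univ I).trans (by simp)
            have hJn : (J.card : ℝ) ≤ n := by
              exact_mod_cast (Finset.card_le_univ J).trans (by simp)
            have hSc := card_Icc_floor_le hδ hw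
            have : 2 * (S.card : ℝ) * q * (I.card + J.card) ≤
                2 * (2 * δ / w + 2) * q * (n + n) := by gcongr
            linarith
    refine le_trans (le_of_eq ?_) (ENNReal.ofReal_le_ofReal hreal)
    rw [ENNReal.ofReal_sum_of_nonneg fun _ _ => Finset.sum_nonneg fun _ _ => measureReal_nonneg]
    refine Finset.sum_congr rfl fun i _ => ?_
    rw [ENNReal.ofReal_sum_of_nonneg fun _ _ => measureReal_nonneg]
    exact Finset.sum_congr rfl fun j _ => (ofReal_measureReal).symm
  calc _ = ∫⁻ e₀, ∑ i ∈ I, ∑ j ∈ J with W i j,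
      ((Measure.pi fun _ => ν).prod (Measure.pi fun _ => ν))
        {p : (Fin n → ℝ) × (Fin n → ℝ) | Φ e₀ p.1 p.2 ∈ collisionEvent h L δ w i j}
        ∂Measure.pi fun _ => ν := by
        rw [lintegral_finsetSum _ fun i _ => Finset.measurable_sum _ fun j _ => hsection i j]
        refine Finset.sum_congr rfl fun i _ => ?_
        rw [lintegral_finsetSum _ fun j _ => hsection i j]
    _ ≤ ∫⁻ _, ENNReal.ofReal C ∂Measure.pi fun _ : Fin n => ν := lintegral_mono hpt
    _ = ENNReal.ofReal C := by simp

/-- With `q` of order `w`, the first term is of order `n * w * D`, as for independent residuals. The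
second, of order `n * (δ + w)`, is the price of the dependence between errors and noise across
folds. -/
theorem sum_collision_le {n K : ℕ} (fold : Fin n → Fin K) {ν : Measure ℝ}
    [IsProbabilityMeasure ν] {h : Fin n → (Fin n → ℝ) → ℝ} (hh : ∀ i, Measurable (h i))
    (hloc : ∀ i e e', (∀ j, fold j ≠ fold i → e j = e' j) → h i e = h i e')
    {L δ w q : ℝ} (hδ : 0 ≤ δ) (hw : 0 < w)
    (hν : ∀ c, |c| ≤ L + 2 * w → ν.real (Icc c (c + w)) ≤ q)
    (hq : 0 < q) (W : Fin n → Fin n → Prop) [∀ i j, Decidable (W i j)] {D : ℕ}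
    (hD : ∀ i, ({j | W i j} : Finset (Fin n)).card ≤ D) :
    ∑ i, ∑ j with i ≠ j ∧ W i j, Measure.pi (fun _ => ν) (collisionEvent h L δ w i j) ≤
    ENNReal.ofReal (K ^ 2 * (q * n * (12 * D + 20 * (2 * δ / w + 2)))) := by
  classical
  set G : ℝ := q * n * (12 * D + 20 * (2 * δ / w + 2)) with hG
  set m : Fin n → Fin n → ℝ≥0∞ := fun i j =>
    Measure.pi (fun _ => ν) (collisionEvent h L δ w i j) with hm
  have hG0 : 0 ≤ G := by positivity
  have hkl : ∀ k l : Fin K, ∑ i with fold i = k, ∑ j with fold j = l,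
      (if i ≠ j ∧ W i j then m i j else 0) ≤ ENNReal.ofReal G := by
    intro k l
    have hcard : ∀ k : Fin K, ((Finset.univ.filter fun i => fold i = k).card : ℝ) ≤ n := fun k => by
      exact_mod_cast (Finset.card_le_univ (Finset.univ.filter fun i => fold i = k)).trans (by simp)
    have hDl : ∀ i, (((Finset.univ.filter fun j => fold j = l ∧ W i j).card : ℕ) : ℝ) ≤ D := by
      intro i
      refine Nat.cast_le.2 ((Finset.card_le_card fun j hj => ?_).trans (hD i))
      simp only [Finset.mem_filter, Finset.mem_univ, true_and] at hj ⊢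
      exact hj.2
    have hsumD : ∑ i with fold i = k,
        (((Finset.univ.filter fun j => fold j = l ∧ W i j).card : ℕ) : ℝ) ≤ n * D := by
      refine (Finset.sum_le_sum fun i _ => hDl i).trans ?_
      rw [Finset.sum_const, nsmul_eq_mul]
      exact mul_le_mul_of_nonneg_right (hcard k) (by positivity)
    by_cases hkl : k = l
    · subst hkl
      calc _ ≤ ∑ i with fold i = k, ∑ j with fold j = k ∧ W i j, ENNReal.ofReal (2 * q) := by
            refine Finset.sum_le_sum fun i hi => ?_
            rw [← Finset.filter_filter, Finset.sum_filter (p := W i)]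
            refine Finset.sum_le_sum fun j hj => ?_
            rw [Finset.mem_filter] at hi hj
            by_cases hij : i ≠ j
            · by_cases hW : W i j
              · simp only [hij, hW, ne_eq, not_false_eq_true, and_self, if_true]
                exact collision_same_fold_le fold hh hloc hw hν hq hij (hi.2.trans hj.2.symm)
              · simp [hW]
            · simp [hij]
        _ = ENNReal.ofReal ((∑ i with fold i = k,
              (((Finset.univ.filter fun j => fold j = k ∧ W i j).card : ℕ) : ℝ)) * (2 * q)) := by
            rw [Finset.sum_mul, ENNReal.ofReal_sum_of_nonneg fun _ _ => by positivity]
            refine Finset.sum_congr rfl fun i _ => ?_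
            rw [Finset.sum_const, nsmul_eq_mul, ENNReal.ofReal_mul (p := (Finset.card _ : ℝ))
              (by positivity), ENNReal.ofReal_natCast]
        _ ≤ _ := by
            refine ENNReal.ofReal_le_ofReal ?_
            calc _ ≤ (n * D : ℝ) * (2 * q) := by gcongr
              _ ≤ G := by
                rw [hG]
                have : 0 ≤ q * n * D := by positivity
                have : 0 ≤ q * n * (20 * (2 * δ / w + 2)) := by positivity
                nlinarith
    · calc _ ≤ ∑ i with fold i = k, ∑ j with fold j = l ∧ W i j, m i j := by
            refine Finset.sum_le_sum fun i hi => ?_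
            rw [← Finset.filter_filter, Finset.sum_filter (p := W i)]
            refine Finset.sum_le_sum fun j hj => ?_
            by_cases hW : W i j
            · simp only [hW, and_true, if_true]
              split_ifs
              · exact le_rfl
              · exact zero_le
            · simp [hW]
        _ ≤ _ := sum_collision_cross_fold_le fold hh hloc hδ hw hν hq W hkl
        _ ≤ _ := by
            refine ENNReal.ofReal_le_ofReal ?_
            calc _ ≤ 5 * (2 * q * (n * D) + 2 * (2 * δ / w + 2) * q * n * 2) := by gcongr
              _ ≤ G := by
                rw [hG]
                have : 0 ≤ q * n * D := by positivity
                nlinarith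
  calc ∑ i, ∑ j with i ≠ j ∧ W i j, m i j
      = ∑ k : Fin K, ∑ l : Fin K, ∑ i with fold i = k, ∑ j with fold j = l,
      (if i ≠ j ∧ W i j then m i j else 0) := by
        simp_rw [Finset.sum_filter (p := fun j => _ ≠ j ∧ W _ j)]
        rw [← Finset.sum_fiberwise Finset.univ fold]
        refine Finset.sum_congr rfl fun k _ => ?_
        rw [Finset.sum_comm (s := Finset.univ) (t := Finset.univ.filter fun i => fold i = k)]
        refine Finset.sum_congr rfl fun i _ => ?_
        rw [← Finset.sum_fiberwise Finset.univ fold]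
    _ ≤ ∑ k : Fin K, ∑ l : Fin K, ENNReal.ofReal G :=
        Finset.sum_le_sum fun k _ => Finset.sum_le_sum fun l _ => hkl k l
    _ = _ := by
        simp only [Finset.sum_const, Finset.card_univ, Fintype.card_fin, nsmul_eq_mul]
        rw [← mul_assoc, ENNReal.ofReal_mul (p := (K : ℝ) ^ 2) (by positivity),
          ENNReal.ofReal_pow (by positivity), ENNReal.ofReal_natCast, sq]

/-! ### The expected deficit of the forward score -/

/-- The error of the cross-fitted forward regressor at the `i`-th design point, as a function of the
design and of the noise. -/
def regressionError {n K : ℕ} {fold : Fin n → Fin K} (fhat : CrossFit fold) (f : ℝ → ℝ)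
    (x : Fin n → ℝ) (i : Fin n) (e : Fin n → ℝ) : ℝ :=
  fhat (fold i) (training fold (fold i) x fun j => f (x j) + e j) (x i) - f (x i)

theorem forwardResidual_eq {n K : ℕ} {fold : Fin n → Fin K} (fhat : CrossFit fold) (f : ℝ → ℝ)
    (x e : Fin n → ℝ) (i : Fin n) :
    forwardResidual fhat x (fun j => f (x j) + e j) i = e i - regressionError fhat f x i e := by
  simp only [forwardResidual, regressionError]
  ring

/-- The locality that cross-fitting provides: the training sample of a fold contains none of its
noise variables. -/
theorem regressionError_congr {n K : ℕ} {fold : Fin n → Fin K} (fhat : CrossFit fold) (f : ℝ → ℝ)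
    (x : Fin n → ℝ) (i : Fin n) (e e' : Fin n → ℝ) (h : ∀ j, fold j ≠ fold i → e j = e' j) :
    regressionError fhat f x i e = regressionError fhat f x i e' := by
  have : training fold (fold i) x (fun j => f (x j) + e j) =
      training fold (fold i) x fun j => f (x j) + e' j := by
    ext j
    · rfl
    · simp only [training]
      rw [h j j.2]
  rw [regressionError, regressionError, this]

theorem measurable_regressionError {n K : ℕ} {fold : Fin n → Fin K} {fhat : CrossFit fold}
    (hf : ∀ k, Measurable (Function.uncurry (fhat k))) {f : ℝ → ℝ} (hfm : Measurable f)
    (i : Fin n) :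
    Measurable fun p : (Fin n → ℝ) × (Fin n → ℝ) => regressionError fhat f p.1 i p.2 := by
  have h1 : Measurable fun p : (Fin n → ℝ) × (Fin n → ℝ) => p.1 i := by fun_prop
  refine Measurable.sub ?_ (hfm.comp h1)
  refine (hf (fold i)).comp (Measurable.prodMk ?_ h1)
  have h2 : Measurable fun p : (Fin n → ℝ) × (Fin n → ℝ) => (p.1, fun j => f (p.1 j) + p.2 j) := by
    fun_prop
  exact (measurable_training fold (fold i)).comp h2

-- Exceptional are the points with large noise, with large regression error, or with a residual more
-- than `w` above their own at most `r` ranks higher. For two other points closer than twice the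
-- upper window end, nearby residual ranks force nearby residuals, so the pair is a collision.
open Classical in
theorem forwardScore_deficit_le {n K : ℕ} {fold : Fin n → Fin K} (fhat : CrossFit fold)
    (f : ℝ → ℝ) {κ cβ : ℝ} (hκ : 0 < κ) (hcβ : 1 < cβ) (hn : 2 ≤ n) (x e : Fin n → ℝ) {r : ℕ}
    (hr : 2 * (cβ * scale κ n) * (n + 1) ≤ r) {L δ w : ℝ} (hL : 0 ≤ L) (hδ : 0 ≤ δ)
    (hw : 0 < w) :
    ((n : ℝ) - 1) * (1 - forwardScore κ cβ fhat x fun j => f (x j) + e j) ≤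
      2 * (∑ i, if L < |e i| then 1 else 0) +
      2 * (∑ i, if δ < |regressionError fhat f x i e| then 1 else 0) +
      2 * (r * (2 * (L + δ) / w + 2)) +
      ∑ i, ∑ j with i ≠ j, if (rank x i ≤ rank x j + r ∧ rank x j ≤ rank x i + r) ∧
        e ∈ collisionEvent (regressionError fhat f x) L δ w i j then 1 else 0 := by
  set h := regressionError fhat f x with hh
  set R : Fin n → ℝ := fun i => e i - h i e with hR
  have hRr : forwardResidual fhat x (fun j => f (x j) + e j) = R :=
    funext fun i => forwardResidual_eq fhat f x e i
  set V1 : Finset (Fin n) := {i | L < |e i|} with hV1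
  set V2 : Finset (Fin n) := {i | δ < |h i e|} with hV2
  set V3 : Finset (Fin n) := {i | |R i| ≤ L + δ ∧ ∃ j, rank R j ≤ rank R i + r ∧ R i + w < R j}
    with hV3
  have hs : 0 < scale κ n := by
    rw [scale]
    have : (0 : ℝ) < n := by exact_mod_cast (by omega : 0 < n)
    positivity
  have hα : scale κ n < cβ * scale κ n := by nlinarith
  have hmain := one_sub_score_le hα (by simpa using hn)
    (forwardCloud fhat x fun j => f (x j) + e j) (V1 ∪ V2 ∪ V3)
  rw [Fintype.card_fin] at hmain
  refine hmain.trans ?_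
  have hVc : ((V1 ∪ V2 ∪ V3).card : ℝ) ≤ V1.card + V2.card + V3.card := by
    exact_mod_cast (Finset.card_union_le _ _).trans
      (Nat.add_le_add_right (Finset.card_union_le _ _) _)
  have h1 : (V1.card : ℝ) = ∑ i, if L < |e i| then 1 else 0 := by
    rw [hV1, Finset.card_filter]; push_cast; rfl
  have h2 : (V2.card : ℝ) = ∑ i, if δ < |h i e| then 1 else 0 := by
    rw [hV2, Finset.card_filter]; push_cast; rfl
  have h3 : (V3.card : ℝ) ≤ r * (2 * (L + δ) / w + 2) :=
    card_sparse_le R r (add_nonneg hL hδ) hw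
  have hrank : ∀ (u : Fin n → ℝ) i j, |copulaRank u i - copulaRank u j| < 2 * (cβ * scale κ n) →
      rank u i ≤ rank u j + r ∧ rank u j ≤ rank u i + r := by
    intro u i j hu
    have hn' : (0 : ℝ) < (n : ℝ) + 1 := by positivity
    rw [copulaRank, copulaRank, ← sub_div, abs_div, abs_of_pos hn', div_lt_iff₀ hn'] at hu
    have h4 := abs_le.1 (hu.le.trans hr)
    constructor
    · have : (rank u i : ℝ) ≤ rank u j + r := by linarith [h4.2]
      exact_mod_cast this
    · have : (rank u j : ℝ) ≤ rank u i + r := by linarith [h4.1]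
      exact_mod_cast this
  have hgood : ∀ i ∉ V1 ∪ V2 ∪ V3, |e i| ≤ L ∧ |h i e| ≤ δ ∧
      ∀ j, rank R j ≤ rank R i + r → R j ≤ R i + w := by
    intro i hi
    simp only [hV1, hV2, hV3, Finset.mem_union, Finset.mem_filter, Finset.mem_univ, true_and,
      not_or, not_lt, not_and, not_exists] at hi
    obtain ⟨⟨a1, a2⟩, a3⟩ := hi
    refine ⟨a1, a2, fun j hj => a3 ?_ j hj⟩
    exact (abs_sub _ _).trans (add_le_add a1 a2)
  have h5 : (((Finset.univ.filter fun p : Fin n × Fin n =>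
        p.1 ∉ V1 ∪ V2 ∪ V3 ∧ p.2 ∉ V1 ∪ V2 ∪ V3 ∧ p.1 ≠ p.2 ∧
        dist (forwardCloud fhat x (fun j => f (x j) + e j) p.1)
          (forwardCloud fhat x (fun j => f (x j) + e j) p.2) < 2 * (cβ * scale κ n)).card : ℕ) : ℝ)
      ≤ ∑ i, ∑ j with i ≠ j, if (rank x i ≤ rank x j + r ∧ rank x j ≤ rank x i + r) ∧
        e ∈ collisionEvent h L δ w i j then 1 else 0 := by
    rw [Finset.card_filter, Fintype.sum_prod_type]
    push_cast
    refine Finset.sum_le_sum fun i _ => ?_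
    rw [Finset.sum_filter]
    refine Finset.sum_le_sum fun j _ => ?_
    split_ifs with c1 c2 c3 c4 c5
    · exact le_rfl
    · exfalso
      obtain ⟨b1, b2, b3, b4⟩ := c1
      simp only [forwardCloud, hRr] at b4
      obtain ⟨d1, d2⟩ := abs_sub_le_dist_mk (copulaRank x i) (copulaRank R i)
        (copulaRank x j) (copulaRank R j)
      have r1 := hrank x i j (d1.trans_lt b4)
      have r2 := hrank R i j (d2.trans_lt b4)
      obtain ⟨g1, g2, g3⟩ := hgood i b1
      obtain ⟨g1', g2', g3'⟩ := hgood j b2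
      refine c3 ⟨r1, ⟨g1, g1'⟩, ⟨g2, g2'⟩, ?_⟩
      have g4 := g3 j r2.2
      have g5 := g3' i r2.1
      exact abs_le.2 ⟨by simp only [hR] at g4 g5; linarith, by simp only [hR] at g4 g5; linarith⟩
    · exact absurd c1.2.2.1 c2
    · exact zero_le_one
    · exact le_rfl
    · exact le_rfl
  refine (add_le_add (mul_le_mul_of_nonneg_left hVc zero_le_two)
    (le_trans (le_of_eq ?_) h5)).trans ?_
  · congr!
  · rw [h1, h2]; linarith

theorem FixedNoiseANM.measurePreserving_pairs {Ω : Type*} [MeasurableSpace Ω] {P : Measure Ω}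
    [IsProbabilityMeasure P] {X ε : ℕ → Ω → ℝ} {σ : ℝ} (h : FixedNoiseANM P X ε σ) (n : ℕ) :
    MeasurePreserving (fun ω (i : Fin n) => (X i ω, ε i ω)) P
      (Measure.pi fun _ => P.map fun ω => (X 0 ω, ε 0 ω)) := by
  have hm : ∀ i, Measurable fun ω => (X i ω, ε i ω) := fun i =>
    (h.measurable_X i).prodMk (h.measurable_noise i)
  refine ⟨measurable_pi_iff.2 fun i => hm i, ?_⟩
  have h1 := h.indep.precomp (g := fun i : Fin n => (i : ℕ)) Fin.val_injective
  have h2 := (iIndepFun_iff_map_fun_eq_pi_map fun i : Fin n => (hm i).aemeasurable).1 h1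
  rw [h2]
  congr 1
  ext1 i
  exact (h.ident i).map_eq

theorem FixedNoiseANM.map_pair {Ω : Type*} [MeasurableSpace Ω] {P : Measure Ω}
    [IsProbabilityMeasure P] {X ε : ℕ → Ω → ℝ} {σ : ℝ} (h : FixedNoiseANM P X ε σ) :
    P.map (fun ω => (X 0 ω, ε 0 ω)) = (P.map (X 0)).prod (P.map (ε 0)) :=
  (indepFun_iff_map_prod_eq_prod_map_map (h.measurable_X 0).aemeasurable
    (h.measurable_noise 0).aemeasurable).1 (h.indep_noise 0)

theorem FixedNoiseANM.measurePreserving_firstN {Ω : Type*} [MeasurableSpace Ω] {P : Measure Ω}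
    [IsProbabilityMeasure P] {X ε : ℕ → Ω → ℝ} {σ : ℝ} (h : FixedNoiseANM P X ε σ) (n : ℕ) :
    MeasurePreserving (fun ω => (firstN X n ω, firstN ε n ω)) P
      ((Measure.pi fun _ => P.map (X 0)).prod (Measure.pi fun _ => P.map (ε 0))) := by
  have := Measure.isProbabilityMeasure_map (μ := P) (h.measurable_X 0).aemeasurable
  have := Measure.isProbabilityMeasure_map (μ := P) (h.measurable_noise 0).aemeasurable
  have h1 := h.measurePreserving_pairs n
  rw [h.map_pair] at h1
  exact (measurePreserving_arrowProdEquivProdArrow ℝ ℝ (Fin n) (fun _ => P.map (X 0))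
    fun _ => P.map (ε 0)).comp h1

/-- The training sample for observation `i` does not contain it, so `X i` is a fresh point with the
law of `X 0`. -/
theorem lintegral_regressionError_sq {Ω : Type*} [MeasurableSpace Ω] {P : Measure Ω}
    [IsProbabilityMeasure P] {X ε : ℕ → Ω → ℝ} {σ : ℝ} (h : FixedNoiseANM P X ε σ) {f : ℝ → ℝ}
    (hfm : Measurable f) {n K : ℕ} {fold : Fin n → Fin K} {fhat : CrossFit fold}
    (hf : ∀ k, Measurable (Function.uncurry (fhat k))) (i : Fin n) :
    ∫⁻ ω, ENNReal.ofReal (regressionError fhat f (firstN X n ω) i (firstN ε n ω) ^ 2) ∂P =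
    ∫⁻ ω, ∫⁻ x, ENNReal.ofReal ((fhat (fold i) (training fold (fold i) (firstN X n ω)
          (firstN (response f X ε) n ω)) x - f x) ^ 2) ∂(P.map (X 0)) ∂P := by
  set μ := P.map fun ω => (X 0 ω, ε 0 ω) with hμ
  have hm0 : Measurable fun ω => (X 0 ω, ε 0 ω) :=
    (h.measurable_X 0).prodMk (h.measurable_noise 0)
  have hμp : IsProbabilityMeasure μ := Measure.isProbabilityMeasure_map hm0.aemeasurable
  have hX0 := Measure.isProbabilityMeasure_map (μ := P) (h.measurable_X 0).aemeasurable
  have hζ := h.measurePreserving_pairs n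
  set tr : (Fin n → ℝ × ℝ) → {j : Fin n // fold j ≠ fold i} → ℝ × ℝ := fun z =>
    training fold (fold i) (fun j => (z j).1) fun j => f (z j).1 + (z j).2 with htr
  have htrm : Measurable tr := by
    have h2 : Measurable fun z : Fin n → ℝ × ℝ =>
        ((fun j => (z j).1 : Fin n → ℝ), fun j => f (z j).1 + (z j).2) := by fun_prop
    exact (measurable_training fold (fold i)).comp h2
  set G : ({j : Fin n // fold j ≠ fold i} → ℝ × ℝ) → ℝ → ℝ≥0∞ := fun t x =>
    ENNReal.ofReal ((fhat (fold i) t x - f x) ^ 2) with hG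
  have hGm : Measurable (Function.uncurry G) := by
    have h1 : Measurable fun p : ({j : Fin n // fold j ≠ fold i} → ℝ × ℝ) × ℝ =>
      fhat (fold i) p.1 p.2 := hf (fold i)
    exact ENNReal.measurable_ofReal.comp ((h1.sub (hfm.comp measurable_snd)).pow_const 2)
  have hF : Measurable fun z : Fin n → ℝ × ℝ => G (tr z) (z i).1 :=
    hGm.comp (htrm.prodMk (by fun_prop))
  have hF2 : Measurable fun z : Fin n → ℝ × ℝ => ∫⁻ x, G (tr z) x ∂(P.map (X 0)) := by
    have h1 : Measurable fun p : (Fin n → ℝ × ℝ) × ℝ => G (tr p.1) p.2 :=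
      hGm.comp ((htrm.comp measurable_fst).prodMk measurable_snd)
    exact h1.lintegral_prod_right'
  have e1 : ∫⁻ ω, ENNReal.ofReal (regressionError fhat f (firstN X n ω) i (firstN ε n ω) ^ 2) ∂P =
      ∫⁻ z, G (tr z) (z i).1 ∂Measure.pi fun _ => μ := by
    rw [← hζ.lintegral_comp hF]
    rfl
  have e2 : ∫⁻ ω, ∫⁻ x, ENNReal.ofReal ((fhat (fold i) (training fold (fold i) (firstN X n ω)
          (firstN (response f X ε) n ω)) x - f x) ^ 2) ∂(P.map (X 0)) ∂P =
      ∫⁻ z, ∫⁻ x, G (tr z) x ∂(P.map (X 0)) ∂Measure.pi fun _ => μ := by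
    rw [← hζ.lintegral_comp hF2]
    rfl
  rw [e1, e2]
  have hsp := measurePreserving_splice (ι := Fin n) μ (· = i)
  refine (hsp.lintegral_comp hF).symm.trans
    ((lintegral_prod_symm' _ (hF.comp hsp.measurable)).trans ?_)
  refine lintegral_congr fun z' => ?_
  have hloc : ∀ z : Fin n → ℝ × ℝ, tr (fun m => if m = i then z m else z' m) = tr z' := by
    intro z
    ext1 j
    have hj : (j : Fin n) ≠ i := fun hji => j.2 (by rw [hji])
    simp only [htr, training, hj, if_false]
  have hev : MeasurePreserving (fun z : Fin n → ℝ × ℝ => (z i).1) (Measure.pi fun _ => μ)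
      (P.map (X 0)) := by
    have h1 := measurePreserving_eval (fun _ : Fin n => μ) i
    have h2 : MeasurePreserving (Prod.fst : ℝ × ℝ → ℝ) μ (P.map (X 0)) := by
      refine ⟨measurable_fst, ?_⟩
      rw [hμ, Measure.map_map measurable_fst hm0]
      rfl
    exact h2.comp h1
  simp only [Function.comp_def, hloc, if_true]
  exact hev.lintegral_comp (f := G (tr z')) (hGm.comp (measurable_const.prodMk measurable_id))

theorem ofReal_sum_ite {ι : Type*} (s : Finset ι) (p : ι → Prop) [DecidablePred p] :
    ENNReal.ofReal (∑ i ∈ s, if p i then 1 else 0) = ∑ i ∈ s, if p i then 1 else 0 := by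
  rw [ENNReal.ofReal_sum_of_nonneg fun i _ => by split_ifs <;> simp]
  refine Finset.sum_congr rfl fun i _ => ?_
  split_ifs <;> simp

theorem lintegral_ite_one {Ω : Type*} [MeasurableSpace Ω] {P : Measure Ω} (p : Ω → Prop)
    [DecidablePred p] (hp : MeasurableSet {ω | p ω}) :
    ∫⁻ ω, (if p ω then 1 else 0) ∂P = P {ω | p ω} := by
  rw [← lintegral_indicator_one hp]
  refine lintegral_congr fun ω => ?_
  by_cases h : p ω <;> simp [h]

theorem lintegral_two_mul_add {Ω : Type*} [MeasurableSpace Ω] {P : Measure Ω}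
    [IsProbabilityMeasure P] {u v : Ω → ℝ≥0∞} (hu : Measurable u) (hv : Measurable v) (c : ℝ≥0∞)
    (w : Ω → ℝ≥0∞) : ∫⁻ ω, (2 * u ω + 2 * v ω + c + w ω) ∂P =
      2 * ∫⁻ ω, u ω ∂P + 2 * ∫⁻ ω, v ω ∂P + c + ∫⁻ ω, w ω ∂P := by
  have h1 : Measurable fun ω => 2 * u ω := hu.const_mul 2
  have h2 : Measurable fun ω => 2 * v ω := hv.const_mul 2
  have h3 : Measurable fun ω => 2 * u ω + 2 * v ω := h1.add h2
  have h4 : Measurable fun ω => 2 * u ω + 2 * v ω + c := h3.add_const c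
  rw [lintegral_add_left h4, lintegral_add_left h3, lintegral_add_left h1,
    lintegral_const_mul _ hu, lintegral_const_mul _ hv, lintegral_const, measure_univ, mul_one]

/-- Expected deficit of the forward score. -/
theorem lintegral_forwardScore_deficit_le {Ω : Type*} [MeasurableSpace Ω] {P : Measure Ω}
    [IsProbabilityMeasure P] {X ε : ℕ → Ω → ℝ} {σ : ℝ} (hmod : FixedNoiseANM P X ε σ) {f : ℝ → ℝ}
    (hfm : Measurable f) {n K : ℕ} {fold : Fin n → Fin K} {fhat : CrossFit fold}
    (hf : ∀ k, Measurable (Function.uncurry (fhat k)))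
    {κ cβ : ℝ} (hκ : 0 < κ) (hcβ : 1 < cβ) (hn : 2 ≤ n) {r : ℕ}
    (hr : 2 * (cβ * scale κ n) * (n + 1) ≤ r) {L δ w q : ℝ} (hL : 0 ≤ L) (hδ : 0 < δ)
    (hw : 0 < w) (hq : 0 < q)
    (hν : ∀ c, |c| ≤ L + 2 * w → (P.map (ε 0)).real (Icc c (c + w)) ≤ q) :
    ∫⁻ ω, ENNReal.ofReal (((n : ℝ) - 1) * (1 - forwardScore κ cβ fhat (firstN X n ω)
        (firstN (response f X ε) n ω))) ∂P ≤
      2 * (n * P.map (ε 0) {z | L < |z|}) +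
      2 * (n * ((∑ k, ∫⁻ ω, ∫⁻ x, ENNReal.ofReal ((fhat k (training fold k (firstN X n ω)
          (firstN (response f X ε) n ω)) x - f x) ^ 2) ∂(P.map (X 0)) ∂P) /
          ENNReal.ofReal (δ ^ 2))) +
      ENNReal.ofReal (2 * (r * (2 * (L + δ) / w + 2))) +
      ENNReal.ofReal (K ^ 2 * (q * n * (12 * (2 * r + 1) + 20 * (2 * δ / w + 2)))) := by
  classical
  have hX0 := Measure.isProbabilityMeasure_map (μ := P) (hmod.measurable_X 0).aemeasurable
  have hε0 := Measure.isProbabilityMeasure_map (μ := P) (hmod.measurable_noise 0).aemeasurable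
  have hxe := hmod.measurePreserving_firstN n
  set ν := P.map (ε 0) with hνdef
  set h : Fin n → Ω → ℝ := fun i ω => regressionError fhat f (firstN X n ω) i (firstN ε n ω) with hh
  have hhm : ∀ i, Measurable (h i) := fun i =>
    (measurable_regressionError hf hfm i).comp hxe.measurable
  set E : Fin n → Fin n → Set ((Fin n → ℝ) × (Fin n → ℝ)) := fun i j =>
    {p | (rank p.1 i ≤ rank p.1 j + r ∧ rank p.1 j ≤ rank p.1 i + r) ∧
        p.2 ∈ collisionEvent (regressionError fhat f p.1) L δ w i j} with hE
  have hEm : ∀ i j, MeasurableSet (E i j) := by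
    intro i j
    have h1 : ∀ i : Fin n, Measurable fun p : (Fin n → ℝ) × (Fin n → ℝ) => rank p.1 i := fun i =>
      (measurable_rank i).comp measurable_fst
    have h2 : ∀ i : Fin n, Measurable fun p : (Fin n → ℝ) × (Fin n → ℝ) => |p.2 i| := fun i =>
      ((measurable_pi_apply i).comp measurable_snd).abs
    have h3 : ∀ i : Fin n, Measurable fun p : (Fin n → ℝ) × (Fin n → ℝ) =>
        |regressionError fhat f p.1 i p.2| := fun i => (measurable_regressionError hf hfm i).abs
    have h4 : Measurable fun p : (Fin n → ℝ) × (Fin n → ℝ) =>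
        |(p.2 i - regressionError fhat f p.1 i p.2) - (p.2 j - regressionError fhat f p.1 j p.2)| :=
      ((((measurable_pi_apply i).comp measurable_snd).sub (measurable_regressionError hf hfm i)).sub
        (((measurable_pi_apply j).comp measurable_snd).sub
          (measurable_regressionError hf hfm j))).abs
    exact ((measurableSet_le (h1 i) ((h1 j).add_const r)).inter
      (measurableSet_le (h1 j) ((h1 i).add_const r))).inter
      (((measurableSet_le (h2 i) measurable_const).inter
      (measurableSet_le (h2 j) measurable_const)).inter
      (((measurableSet_le (h3 i) measurable_const).inter
      (measurableSet_le (h3 j) measurable_const)).inter (measurableSet_le h4 measurable_const)))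
  have hm1 : ∀ i : Fin n, MeasurableSet {ω | L < |firstN ε n ω i|} := fun i =>
    measurableSet_lt measurable_const (hmod.measurable_noise i).abs
  have hm2 : ∀ i : Fin n, MeasurableSet {ω | δ < |h i ω|} := fun i =>
    measurableSet_lt measurable_const (hhm i).abs
  have hm3 : ∀ i j, MeasurableSet {ω | (firstN X n ω, firstN ε n ω) ∈ E i j} := fun i j =>
    hxe.measurable (hEm i j)
  have hpt : ∀ ω, ENNReal.ofReal (((n : ℝ) - 1) * (1 - forwardScore κ cβ fhat (firstN X n ω)
        (firstN (response f X ε) n ω))) ≤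
      2 * (∑ i, if L < |firstN ε n ω i| then 1 else 0) +
      2 * (∑ i, if δ < |h i ω| then 1 else 0) +
      ENNReal.ofReal (2 * (r * (2 * (L + δ) / w + 2))) +
      ∑ i, ∑ j with i ≠ j, if (firstN X n ω, firstN ε n ω) ∈ E i j then 1 else 0 := by
    intro ω
    have h1 := forwardScore_deficit_le fhat f hκ hcβ hn (firstN X n ω) (firstN ε n ω) hr hL hδ.le hw
    refine (ENNReal.ofReal_le_ofReal h1).trans ?_
    refine ENNReal.ofReal_add_le.trans (add_le_add ?_ ?_)
    · refine ENNReal.ofReal_add_le.trans (add_le_add ?_ le_rfl)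
      refine ENNReal.ofReal_add_le.trans (add_le_add ?_ ?_)
      · rw [ENNReal.ofReal_mul zero_le_two, ofReal_sum_ite, ENNReal.ofReal_ofNat]
      · rw [ENNReal.ofReal_mul zero_le_two, ofReal_sum_ite, ENNReal.ofReal_ofNat]
    · rw [ENNReal.ofReal_sum_of_nonneg fun i _ => Finset.sum_nonneg fun j _ => by
        split_ifs <;> simp]
      refine Finset.sum_le_sum fun i _ => ?_
      rw [ofReal_sum_ite]
      exact le_of_eq (by congr!)
  refine (lintegral_mono hpt).trans ?_
  have hmi1 : ∀ i : Fin n, Measurable fun ω => (if L < |firstN ε n ω i| then 1 else 0 : ℝ≥0∞) :=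
    fun i => Measurable.ite (hm1 i) measurable_const measurable_const
  have hmi2 : ∀ i : Fin n, Measurable fun ω => (if δ < |h i ω| then 1 else 0 : ℝ≥0∞) :=
    fun i => Measurable.ite (hm2 i) measurable_const measurable_const
  have hmi3 : ∀ i j : Fin n, Measurable fun ω =>
      (if (firstN X n ω, firstN ε n ω) ∈ E i j then 1 else 0 : ℝ≥0∞) :=
    fun i j => Measurable.ite (hm3 i j) measurable_const measurable_const
  have hms1 := Finset.measurable_sum Finset.univ fun i _ => hmi1 i
  have hms2 := Finset.measurable_sum Finset.univ fun i _ => hmi2 i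
  refine (le_of_eq (lintegral_two_mul_add hms1 hms2 _ _)).trans ?_
  rw [lintegral_finsetSum _ fun i _ => hmi1 i, lintegral_finsetSum _ fun i _ => hmi2 i,
    lintegral_finsetSum _ fun i _ => Finset.measurable_sum _ fun j _ => hmi3 i j]
  refine add_le_add (add_le_add (add_le_add ?_ ?_) ?_) ?_
  · gcongr
    have h1 : ∀ i : Fin n, ∫⁻ ω, (if L < |firstN ε n ω i| then 1 else 0) ∂P = ν {z | L < |z|} := by
      intro i
      rw [lintegral_ite_one _ (hm1 i)]
      have hid : P.map (ε i) = ν := by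
        have h2 := (hmod.ident i).comp measurable_snd
        exact h2.map_eq
      have hset : MeasurableSet {z : ℝ | L < |z|} := measurableSet_lt measurable_const measurable_id.abs
      rw [← hid, Measure.map_apply (hmod.measurable_noise i) hset]
      rfl
    simp [h1]
  · gcongr
    have h1 : ∀ i : Fin n, ∫⁻ ω, (if δ < |h i ω| then 1 else 0) ∂P ≤
        (∑ k, ∫⁻ ω, ∫⁻ x, ENNReal.ofReal ((fhat k (training fold k (firstN X n ω)
          (firstN (response f X ε) n ω)) x - f x) ^ 2) ∂(P.map (X 0)) ∂P) /
          ENNReal.ofReal (δ ^ 2) := by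
      intro i
      rw [lintegral_ite_one _ (hm2 i)]
      have h2 : {ω | δ < |h i ω|} ⊆ {ω | ENNReal.ofReal (δ ^ 2) ≤ ENNReal.ofReal (h i ω ^ 2)} := by
        intro ω hω
        refine ENNReal.ofReal_le_ofReal ?_
        rw [← sq_abs (h i ω)]
        have : δ < |h i ω| := hω
        gcongr
      -- Markov's inequality for the squared error; the risk of one fold is then bounded by the sum
      -- over all folds.
      refine (measure_mono h2).trans ((meas_ge_le_lintegral_div
        (ENNReal.measurable_ofReal.comp ((hhm i).pow_const 2)).aemeasurable
        (by simpa using hδ.ne') ENNReal.ofReal_ne_top).trans ?_)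
      gcongr
      simp only [Function.comp_def, hh]
      rw [lintegral_regressionError_sq hmod hfm hf i]
      exact Finset.single_le_sum (f := fun k => ∫⁻ ω, ∫⁻ x, ENNReal.ofReal ((fhat k
        (training fold k (firstN X n ω) (firstN (response f X ε) n ω)) x - f x) ^ 2)
          ∂(P.map (X 0)) ∂P) (fun _ _ => zero_le) (Finset.mem_univ (fold i))
    refine (Finset.sum_le_sum fun i _ => h1 i).trans ?_
    simp
  · exact le_rfl
  · have h1 : ∀ i j, ∫⁻ ω, (if (firstN X n ω, firstN ε n ω) ∈ E i j then 1 else 0) ∂P =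
        ∫⁻ x, Measure.pi (fun _ => ν) {e | (x, e) ∈ E i j} ∂Measure.pi fun _ => P.map (X 0) := by
      intro i j
      rw [lintegral_ite_one _ (hm3 i j)]
      have h2 := hxe.measure_preimage (hEm i j).nullMeasurableSet
      rw [Measure.prod_apply (hEm i j)] at h2
      exact h2
    have hsecm : ∀ i j, Measurable fun x => Measure.pi (fun _ => ν) {e | (x, e) ∈ E i j} :=
      fun i j => measurable_measure_prodMk_left (hEm i j)
    have h2 : ∀ i, ∫⁻ ω, ∑ j with i ≠ j, (if (firstN X n ω, firstN ε n ω) ∈ E i j then 1 else 0) ∂P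
        = ∫⁻ x, ∑ j with i ≠ j, Measure.pi (fun _ => ν) {e | (x, e) ∈ E i j}
          ∂Measure.pi fun _ => P.map (X 0) := by
      intro i
      rw [lintegral_finsetSum _ fun j _ => hmi3 i j, lintegral_finsetSum _ fun j _ => hsecm i j]
      exact Finset.sum_congr rfl fun j _ => h1 i j
    simp_rw [h2]
    rw [← lintegral_finsetSum _ fun i _ => Finset.measurable_sum _ fun j _ => hsecm i j]
    refine (lintegral_mono (g := fun _ => ENNReal.ofReal
      (K ^ 2 * (q * n * (12 * (2 * r + 1) + 20 * (2 * δ / w + 2))))) fun x => ?_).trans ?_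
    -- Noise and design are independent, so the collision bound applies for a frozen design.
    · have h3 := sum_collision_le fold (ν := ν) (h := regressionError fhat f x)
        (fun i => (measurable_regressionError hf hfm i).comp measurable_prodMk_left)
        (regressionError_congr fhat f x) hδ.le hw hν hq
        (fun i j => rank x i ≤ rank x j + r ∧ rank x j ≤ rank x i + r)
        (D := 2 * r + 1) (fun i => card_rank_close_le x i r)
      push_cast at h3
      refine le_trans (Finset.sum_le_sum fun i _ => ?_) h3
      rw [← Finset.filter_filter, Finset.sum_filter (p := fun j =>
        rank x i ≤ rank x j + r ∧ rank x j ≤ rank x i + r)]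
      refine Finset.sum_le_sum fun j _ => ?_
      split_ifs with hW
      · exact measure_mono fun e he => he.2
      · refine le_of_eq ?_
        have : {e | (x, e) ∈ E i j} = ∅ := by
          ext e
          simp only [Set.mem_ofPred_eq, Set.mem_empty_iff_false, iff_false]
          exact fun he => hW he.1
        rw [this, measure_empty]
    · simp

/-! ### Choice of constants and the forward limit -/

theorem exists_measure_abs_gt_le (ν : Measure ℝ) [IsProbabilityMeasure ν] {η : ℝ} (hη : 0 < η) :
    ∃ L : ℝ, 0 ≤ L ∧ ν {z | L < |z|} ≤ ENNReal.ofReal η := by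
  have hm : ∀ N : ℕ, MeasurableSet {z : ℝ | (N : ℝ) < |z|} := fun N =>
    measurableSet_lt measurable_const measurable_id.abs
  have h := tendsto_measure_iInter_atTop (μ := ν) (s := fun N : ℕ => {z : ℝ | (N : ℝ) < |z|})
    (fun N => (hm N).nullMeasurableSet)
    (fun a b hab z hz => by
      have h1 : (b : ℝ) < |z| := hz
      have h2 : (a : ℝ) ≤ b := Nat.cast_le.2 hab
      exact h2.trans_lt h1) ⟨0, measure_ne_top _ _⟩
  have h0 : ⋂ N : ℕ, {z : ℝ | (N : ℝ) < |z|} = ∅ := by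
    ext z
    simp only [Set.mem_iInter, Set.mem_ofPred_eq, Set.mem_empty_iff_false, iff_false, not_forall,
      not_lt]
    exact exists_nat_ge |z|
  rw [h0, measure_empty] at h
  obtain ⟨N, hN⟩ := ((ENNReal.tendsto_nhds_zero.1 h) (ENNReal.ofReal η) (by simpa using hη)).exists
  exact ⟨N, by positivity, hN⟩

theorem exists_Icc_measure_le {ν : Measure ℝ} {p : ℝ → ℝ} (hp : Continuous p)
    (hν : ν = volume.withDensity fun z => ENNReal.ofReal (p z)) (M : ℝ) :
    ∃ C : ℝ, 0 < C ∧ ∀ c w, 0 ≤ w → -M ≤ c → c + w ≤ M → ν.real (Icc c (c + w)) ≤ C * w := by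
  obtain ⟨C, hC⟩ := (isCompact_Icc (a := -M) (b := M)).exists_bound_of_continuousOn
    hp.continuousOn
  refine ⟨max C 1, by positivity, fun c w hw h1 h2 => ?_⟩
  rw [measureReal_def, hν, withDensity_apply _ measurableSet_Icc]
  refine ENNReal.toReal_le_of_le_ofReal (by positivity) ?_
  calc ∫⁻ z in Icc c (c + w), ENNReal.ofReal (p z)
      ≤ ∫⁻ _ in Icc c (c + w), ENNReal.ofReal (max C 1) := by
        refine setLIntegral_mono measurable_const fun z hz => ENNReal.ofReal_le_ofReal ?_
        have := hC z ⟨h1.trans hz.1, hz.2.trans h2⟩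
        exact (le_abs_self _).trans (this.trans (le_max_left _ _))
    _ = _ := by
        rw [setLIntegral_const, Real.volume_Icc, add_sub_cancel_left,
          ENNReal.ofReal_mul (by positivity)]

theorem scale_eq_div_cube_root {κ s : ℝ} {n : ℕ} (hn : 0 < n) (hs : s = (n : ℝ) ^ ((1 : ℝ) / 3)) :
    s ^ 3 = n ∧ scale κ n = κ / s ^ 2 := by
  have h0 : (0 : ℝ) < n := by exact_mod_cast hn
  constructor
  · rw [hs, ← Real.rpow_natCast, ← Real.rpow_mul h0.le]
    norm_num
  · have h1 : s ^ 2 = (n : ℝ) ^ ((2 : ℝ) / 3) := by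
      rw [hs, ← Real.rpow_natCast, ← Real.rpow_mul h0.le]
      norm_num
    rw [h1, scale, neg_div, Real.rpow_neg h0.le, div_eq_mul_inv κ]

/-- With `S = n^(1/3)`, ranks are compared up to `r` of order `c * S` and residuals up to `w = A / S
^ 2`. The cutoff `L` is chosen first, to make the noise tails small. A large `A` makes sparse points
rare, a small `δ` makes the dependent collisions rare, and all other terms vanish as `n` grows. -/
theorem tendsto_lintegral_forwardScore_deficit {Ω : Type*} [MeasurableSpace Ω] {P : Measure Ω}
    [IsProbabilityMeasure P] {X ε : ℕ → Ω → ℝ} {σ : ℝ} (hmod : FixedNoiseANM P X ε σ) {f : ℝ → ℝ}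
    (hfm : Measurable f) (hdens : ∃ p : ℝ → ℝ, Continuous p ∧ (∀ z, 0 ≤ p z) ∧
      P.map (ε 0) = volume.withDensity fun z => ENNReal.ofReal (p z))
    {κ cβ : ℝ} (hκ : 0 < κ) (hcβ : 1 < cβ) {K : ℕ} {fold : (n : ℕ) → Fin n → Fin K}
    {fhat : (n : ℕ) → CrossFit (fold n)} (hf : ∀ n k, Measurable (Function.uncurry (fhat n k)))
    (hrisk : ∀ k : Fin K, Tendsto
      (fun n : ℕ => ∫⁻ ω, ∫⁻ x, ENNReal.ofReal
        ((fhat n k (training (fold n) k (firstN X n ω)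
          (firstN (response f X ε) n ω)) x - f x) ^ 2) ∂(P.map (X 0)) ∂P) atTop (𝓝 0)) :
    Tendsto (fun n => ∫⁻ ω, ENNReal.ofReal (1 - forwardScore κ cβ (fhat n) (firstN X n ω)
        (firstN (response f X ε) n ω)) ∂P) atTop (𝓝 0) := by
  have hε0 := Measure.isProbabilityMeasure_map (μ := P) (hmod.measurable_noise 0).aemeasurable
  suffices H : ∀ η : ℝ, 0 < η → ∀ᶠ n : ℕ in atTop,
      ∫⁻ ω, ENNReal.ofReal (1 - forwardScore κ cβ (fhat n) (firstN X n ω)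
        (firstN (response f X ε) n ω)) ∂P ≤ ENNReal.ofReal (11 * η) by
    rw [ENNReal.tendsto_nhds_zero]
    intro t ht
    rcases eq_or_ne t ∞ with rfl | htop
    · simp
    · have ht' := ENNReal.toReal_pos ht.ne' htop
      filter_upwards [H (t.toReal / 11) (by positivity)] with n hn
      refine hn.trans (le_of_eq ?_)
      rw [mul_div_cancel₀ _ (by norm_num), ENNReal.ofReal_toReal htop]
  intro η hη
  obtain ⟨p, hp, -, hpν⟩ := hdens
  obtain ⟨L, hL0, hL⟩ := exists_measure_abs_gt_le (P.map (ε 0)) hη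
  -- Once `w ≤ 1`, an interval of length `w` starting within `L + 2 * w` of the origin stays in
  -- `[-(L + 3), L + 3]`.
  obtain ⟨C, hC0, hC⟩ := exists_Icc_measure_le hp hpν (L + 3)
  set c : ℝ := 4 * cβ * κ with hc
  have hc0 : 0 < c := by positivity
  set A : ℝ := 8 * c * (L + 1) / η with hA
  have hA0 : 0 < A := by positivity
  set δ : ℝ := min 1 (η / (80 * (K ^ 2 * C) + 1)) with hδ
  have hδ0 : 0 < δ := by
    have : 0 < η / (80 * (K ^ 2 * C) + 1) := by positivity
    exact lt_min one_pos this
  have hδ1 : δ ≤ 1 := min_le_left _ _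
  have hδη : 80 * (K ^ 2 * C) * δ ≤ η := by
    have h1 : δ ≤ η / (80 * (K ^ 2 * C) + 1) := min_le_right _ _
    rw [le_div_iff₀ (by positivity)] at h1
    nlinarith
  set s : ℕ → ℝ := fun n => (n : ℝ) ^ ((1 : ℝ) / 3) with hs
  have hst : Tendsto s atTop atTop :=
    (tendsto_rpow_atTop (by norm_num)).comp tendsto_natCast_atTop_atTop
  -- `n / 2 * g S⁻¹` will dominate the sparse points and the collisions. At `0` there remain the
  -- sparse points, equal to `η` by the choice of `A`, and the dependent collisions, at most `η` by
  -- the choice of `δ`.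
  set g : ℝ → ℝ := fun u => 4 * (c + u) * (2 * (L + 1) / A + 2 * u ^ 2) +
    2 * (K ^ 2 * C) * (A * (24 * c * u + 36 * u ^ 2) + 40 * δ + 40 * A * u ^ 2) with hg
  have hg0 : g 0 < 3 * η := by
    have h1 : g 0 = 8 * c * (L + 1) / A + 80 * (K ^ 2 * C) * δ := by simp only [hg]; ring
    have h2 : 8 * c * (L + 1) / A = η := by rw [hA]; field_simp
    rw [h1, h2]; linarith
  have hglim : Tendsto (fun n => g (s n)⁻¹) atTop (𝓝 (g 0)) := by
    have h1 : Continuous g := by fun_prop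
    exact (h1.tendsto 0).comp (tendsto_inv_atTop_zero.comp hst)
  have hρ : Tendsto (fun n : ℕ => (∑ k, ∫⁻ ω, ∫⁻ x, ENNReal.ofReal ((fhat n k (training (fold n) k
      (firstN X n ω) (firstN (response f X ε) n ω)) x - f x) ^ 2) ∂(P.map (X 0)) ∂P) /
          ENNReal.ofReal (δ ^ 2)) atTop (𝓝 0) := by
    have h1 := tendsto_finsetSum Finset.univ fun k _ => hrisk k
    rw [Finset.sum_const_zero] at h1
    have h2 := ENNReal.Tendsto.div_const h1
      (b := ENNReal.ofReal (δ ^ 2)) (Or.inr (by simpa using hδ0.ne'))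
    rwa [ENNReal.zero_div] at h2
  filter_upwards [eventually_ge_atTop 2, hglim.eventually (gt_mem_nhds hg0),
    ENNReal.tendsto_nhds_zero.1 hρ (ENNReal.ofReal η) (by simpa using hη),
    hst.eventually (eventually_ge_atTop 1), hst.eventually (eventually_ge_atTop A)]
    with n hn hgn hρn hs1 hsA
  obtain ⟨hs3, hsc⟩ := scale_eq_div_cube_root (κ := κ) (by omega : 0 < n) (rfl : s n = _)
  set S := s n with hS
  have hS0 : 0 < S := by linarith
  have hn1 : (2 : ℝ) ≤ n := by exact_mod_cast hn
  set r : ℕ := ⌈c * S⌉₊ with hr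
  have hr1 : (r : ℝ) ≤ c * S + 1 := (Nat.ceil_lt_add_one (by positivity)).le
  have hr2 : 2 * (cβ * scale κ n) * (n + 1) ≤ r := by
    refine le_trans ?_ (Nat.le_ceil (c * S))
    rw [hsc]
    have h1 : 2 * (cβ * (κ / S ^ 2)) * (n + 1) ≤ 2 * (cβ * (κ / S ^ 2)) * (2 * S ^ 3) := by
      gcongr
      rw [hs3]; linarith
    refine h1.trans (le_of_eq ?_)
    rw [hc]; field_simp; ring
  set w : ℝ := A / S ^ 2 with hw
  have hw0 : 0 < w := by positivity
  have hw1 : w ≤ 1 := by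
    rw [hw, div_le_one (by positivity)]
    nlinarith
  have hν : ∀ z, |z| ≤ L + 2 * w → (P.map (ε 0)).real (Icc z (z + w)) ≤ C * w := by
    intro z hz
    have h1 := abs_le.1 hz
    exact hC z w hw0.le (by linarith) (by linarith)
  have hmain := lintegral_forwardScore_deficit_le hmod hfm (hf n) hκ hcβ hn hr2 hL0 hδ0 hw0
    (by positivity : 0 < C * w) hν
  set Φ : Ω → ℝ := fun ω => 1 - forwardScore κ cβ (fhat n) (firstN X n ω)
        (firstN (response f X ε) n ω) with hΦ
  have hleft : ENNReal.ofReal (n / 2) * ∫⁻ ω, ENNReal.ofReal (Φ ω) ∂P ≤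
      ∫⁻ ω, ENNReal.ofReal (((n : ℝ) - 1) * Φ ω) ∂P := by
    rw [← lintegral_const_mul' _ _ ENNReal.ofReal_ne_top]
    refine lintegral_mono fun ω => ?_
    simp only
    rw [← ENNReal.ofReal_mul (by positivity)]
    refine ENNReal.ofReal_le_ofReal ?_
    have h0 : 0 ≤ Φ ω := by
      have hs0 : 0 ≤ scale κ n := by rw [hsc]; positivity
      have := score_le_one (by nlinarith : scale κ n ≤ cβ * scale κ n)
        (forwardCloud (fhat n) (firstN X n ω) (firstN (response f X ε) n ω))
      simp only [hΦ, forwardScore]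
      linarith
    have : (n : ℝ) / 2 ≤ n - 1 := by linarith
    gcongr
  have hbr : 2 * (r * (2 * (L + δ) / w + 2)) +
      K ^ 2 * (C * w * n * (12 * (2 * r + 1) + 20 * (2 * δ / w + 2))) ≤ n / 2 * g S⁻¹ := by
    calc _ ≤ 2 * ((c * S + 1) * (2 * (L + 1) / w + 2)) +
      K ^ 2 * (C * w * n * (12 * (2 * (c * S + 1) + 1) + 20 * (2 * δ / w + 2))) := by gcongr
      _ = n / 2 * g S⁻¹ := by
        rw [← hs3, hw]
        simp only [hg]
        field_simp
        ring
  have hfin : ∫⁻ ω, ENNReal.ofReal (((n : ℝ) - 1) * Φ ω) ∂P ≤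
      ENNReal.ofReal (n / 2) * ENNReal.ofReal (11 * η) := by
    refine hmain.trans ?_
    calc _ ≤ 2 * (n * ENNReal.ofReal η) + 2 * (n * ENNReal.ofReal η) +
        ENNReal.ofReal (2 * (r * (2 * (L + δ) / w + 2))) +
        ENNReal.ofReal (K ^ 2 * (C * w * n * (12 * (2 * r + 1) + 20 * (2 * δ / w + 2)))) := by
          gcongr
      _ = ENNReal.ofReal (4 * (n * η) + (2 * (r * (2 * (L + δ) / w + 2)) +
        K ^ 2 * (C * w * n * (12 * (2 * r + 1) + 20 * (2 * δ / w + 2))))) := by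
          rw [ENNReal.ofReal_add (by positivity) (by positivity),
            ENNReal.ofReal_add (p := 2 * (r * (2 * (L + δ) / w + 2))) (by positivity)
              (by positivity),
            ENNReal.ofReal_mul (by norm_num : (0 : ℝ) ≤ 4), ENNReal.ofReal_mul (Nat.cast_nonneg n),
            ENNReal.ofReal_natCast, ENNReal.ofReal_ofNat]
          ring
      -- Tails and risk give `4 * n * η`, that is `n / 2 * (8 * η)`; the rest is at most `n / 2 * (3
      -- * η)`.
      _ ≤ ENNReal.ofReal (n / 2 * (11 * η)) := by
          refine ENNReal.ofReal_le_ofReal ?_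
          have : (n : ℝ) / 2 * g S⁻¹ ≤ n / 2 * (3 * η) := by gcongr
          linarith
      _ = _ := ENNReal.ofReal_mul (by positivity)
  have h0 : ENNReal.ofReal ((n : ℝ) / 2) ≠ 0 := by
    have : (0 : ℝ) < n / 2 := by linarith
    simpa using this
  exact (ENNReal.mul_le_mul_iff_right h0 ENNReal.ofReal_ne_top).1 (hleft.trans hfin)

theorem tendstoInMeasure_of_lintegral {Ω : Type*} [MeasurableSpace Ω] {P : Measure Ω}
    {u : ℕ → Ω → ℝ} {a : ℝ} (hu : ∀ n, Measurable (u n))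
    (h : Tendsto (fun n => ∫⁻ ω, ENNReal.ofReal |u n ω - a| ∂P) atTop (𝓝 0)) :
    TendstoInMeasure P u atTop fun _ => a := by
  rw [tendstoInMeasure_iff_norm]
  intro t ht
  have h1 : Tendsto (fun n => (∫⁻ ω, ENNReal.ofReal |u n ω - a| ∂P) / ENNReal.ofReal t) atTop
      (𝓝 0) := by
    have h2 := ENNReal.Tendsto.div_const h (b := ENNReal.ofReal t) (Or.inr (by simpa using ht))
    rwa [ENNReal.zero_div] at h2
  refine tendsto_of_tendsto_of_tendsto_of_le_of_le tendsto_const_nhds h1 (fun _ => zero_le)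
    fun n => ?_
  refine le_trans (measure_mono fun ω hω => ?_) (meas_ge_le_lintegral_div
    (ENNReal.measurable_ofReal.comp ((hu n).sub_const a).abs).aemeasurable
    (by simpa using ht) ENNReal.ofReal_ne_top)
  exact ENNReal.ofReal_le_ofReal hω

/-! ### Conditionally centred fluctuations in the bins -/

/-- Terms that are centered given the labels `π` are orthogonal when selected through the
labels. -/
theorem lintegral_sq_sum_indicator_le {ι α β : Type*} [Fintype ι] [MeasurableSpace α]
    [MeasurableSpace β] {μ : Measure α} [IsProbabilityMeasure μ] {π : α → β} (hπ : Measurable π)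
    {φ : α → ℝ} (hφ : Measurable φ) {c : ℝ} (hc : ∀ᵐ a ∂μ, |φ a| ≤ c)
    (h0 : ∀ s, MeasurableSet s → ∫ a in π ⁻¹' s, φ a ∂μ = 0)
    {A : ι → Set (ι → β)} (hA : ∀ i, MeasurableSet (A i)) :
    ∫⁻ z, ENNReal.ofReal ((∑ i, (A i).indicator (fun _ => φ (z i)) (π ∘ z)) ^ 2)
        ∂Measure.pi (fun _ => μ) ≤
      ENNReal.ofReal (c ^ 2 * ∑ i, (Measure.pi fun _ => μ).real {z : ι → α | π ∘ z ∈ A i}) := by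
  classical
  have hπz : Measurable fun z : ι → α => π ∘ z :=
    measurable_pi_iff.2 fun i => hπ.comp (measurable_pi_apply i)
  have hc0 : 0 ≤ c := by
    obtain ⟨a, ha⟩ := hc.exists
    exact (abs_nonneg _).trans ha
  have hbd : ∀ᵐ z ∂Measure.pi (fun _ : ι => μ), ∀ i, |φ (z i)| ≤ c :=
    ae_all_iff.2 fun i =>
      (measurePreserving_eval (fun _ : ι => μ) i).quasiMeasurePreserving.ae hc
  set F : ι → (ι → α) → ℝ := fun i z => (A i).indicator (fun _ => φ (z i)) (π ∘ z) with hF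
  have hFeq : ∀ i, F i = {z | π ∘ z ∈ A i}.indicator fun z => φ (z i) := by
    intro i; ext z; simp [hF, Set.indicator]
  have hFm : ∀ i, Measurable (F i) := by
    intro i
    rw [hFeq]
    exact (hφ.comp (measurable_pi_apply i)).indicator (hπz (hA i))
  have hFb : ∀ᵐ z ∂Measure.pi (fun _ : ι => μ), ∀ i, |F i z| ≤ c := by
    filter_upwards [hbd] with z hz i
    simp only [hF, Set.indicator]
    split_ifs
    · exact hz i
    · simpa using hc0
  have hint : ∀ i j, Integrable (fun z => F i z * F j z) (Measure.pi fun _ : ι => μ) := by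
    intro i j
    refine Integrable.of_bound ((hFm i).mul (hFm j)).aestronglyMeasurable (c * c) ?_
    filter_upwards [hFb] with z hz
    rw [Real.norm_eq_abs, abs_mul]
    exact mul_le_mul (hz i) (hz j) (abs_nonneg _) hc0
  -- Integrate over `z i` with the other observations frozen. The selections depend on `z i` only
  -- through its label and `φ (z j)` is constant, so what remains is an integral of `φ` over a set
  -- of labels, which vanishes.
  have hoff : ∀ i j, i ≠ j → ∫ z, F i z * F j z ∂Measure.pi (fun _ : ι => μ) = 0 := by
    intro i j hij
    have h := measurePreserving_splice μ (· = i)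
    have hi := hint i j
    rw [← h.map_eq] at hi ⊢
    rw [integral_map h.measurable.aemeasurable hi.aestronglyMeasurable]
    have hi' := hi.comp_measurable h.measurable
    refine (integral_prod_symm _ hi').trans ?_
    refine integral_eq_zero_of_ae (ae_of_all _ fun z₀ => ?_)
    set S : Set β := {t | Function.update (π ∘ z₀) i t ∈ A i ∩ A j} with hS
    have hSm : MeasurableSet S := by
      have : Measurable fun t => Function.update (π ∘ z₀) i t := measurable_update _
      exact this ((hA i).inter (hA j))
    have hval : ∀ z : ι → α, F i (fun m => if m = i then z m else z₀ m) *
        F j (fun m => if m = i then z m else z₀ m) =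
        (π ⁻¹' S).indicator φ (z i) * φ (z₀ j) := by
      intro z
      have h1 : (π ∘ fun m => if m = i then z m else z₀ m) =
          Function.update (π ∘ z₀) i (π (z i)) := by
        ext m
        by_cases hm : m = i
        · subst hm; simp
        · simp [hm]
      simp only [hF, h1, Set.indicator, if_true, hij.symm, if_false, Set.mem_preimage, hS,
        Set.mem_ofPred_eq, Set.mem_inter_iff]
      by_cases h2 : Function.update (π ∘ z₀) i (π (z i)) ∈ A i <;>
      by_cases h3 : Function.update (π ∘ z₀) i (π (z i)) ∈ A j <;> simp [h2, h3]
    simp only [Function.comp_def, hval, Pi.zero_apply]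
    rw [integral_mul_const]
    have h2 := (measurePreserving_eval (fun _ : ι => μ) i)
    have h3 : ∫ z : ι → α, (π ⁻¹' S).indicator φ (z i) ∂Measure.pi (fun _ => μ) =
        ∫ a, (π ⁻¹' S).indicator φ a ∂μ := by
      conv_rhs => rw [← h2.map_eq]
      rw [integral_map h2.measurable.aemeasurable
        (hφ.indicator (hπ hSm)).aestronglyMeasurable]
    rw [h3, integral_indicator (hπ hSm), h0 S hSm, zero_mul]
  have hexp : ∀ z, (∑ i, F i z) ^ 2 = ∑ i, ∑ j, F i z * F j z := fun z => by
    rw [sq, Finset.sum_mul_sum]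
  have hgoal : ∫ z, (∑ i, F i z) ^ 2 ∂Measure.pi (fun _ : ι => μ) =
      ∑ i, ∫ z, F i z * F i z ∂Measure.pi (fun _ : ι => μ) := by
    simp_rw [hexp]
    rw [integral_finsetSum _ fun i _ => integrable_finsetSum _ fun j _ => hint i j]
    refine Finset.sum_congr rfl fun i _ => ?_
    rw [integral_finsetSum _ fun j _ => hint i j]
    exact Finset.sum_eq_single i (fun j _ hj => hoff i j hj.symm) (by simp)
  have hsq : Integrable (fun z => (∑ i, F i z) ^ 2) (Measure.pi fun _ : ι => μ) := by
    simp_rw [hexp]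
    exact integrable_finsetSum _ fun i _ => integrable_finsetSum _ fun j _ => hint i j
  rw [← ofReal_integral_eq_lintegral_ofReal hsq (ae_of_all _ fun z => sq_nonneg _)]
  refine ENNReal.ofReal_le_ofReal ?_
  rw [hgoal, Finset.mul_sum]
  refine Finset.sum_le_sum fun i _ => ?_
  have hset : MeasurableSet {z : ι → α | π ∘ z ∈ A i} := hπz (hA i)
  calc ∫ z, F i z * F i z ∂Measure.pi (fun _ : ι => μ)
      ≤ ∫ z, {z : ι → α | π ∘ z ∈ A i}.indicator (fun _ => c ^ 2) z ∂Measure.pi (fun _ => μ) := by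
        refine integral_mono_ae (hint i i) ((integrable_const _).indicator hset) ?_
        filter_upwards [hbd] with z hz
        simp only [hFeq, Set.indicator]
        split_ifs
        · rw [← sq, ← sq_abs]
          exact pow_le_pow_left₀ (abs_nonneg _) (hz i) 2
        · simp
    _ = _ := by rw [integral_indicator_const _ hset, smul_eq_mul, mul_comm]

theorem measurable_reverseTarget {Ω : Type*} [MeasurableSpace Ω] (P : Measure Ω)
    [IsFiniteMeasure P] (X Y : Ω → ℝ) : Measurable (reverseTarget P X Y) :=
  (StronglyMeasurable.integral_condDistrib (f := fun p : ℝ × ℝ => p.2)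
    measurable_snd.stronglyMeasurable).measurable

theorem reverseTarget_ae_eq_condExp {Ω : Type*} [mΩ : MeasurableSpace Ω] {P : Measure Ω}
    [IsProbabilityMeasure P] {X Y : Ω → ℝ} (hX : Integrable X P) (hY : Measurable Y) :
    (fun ω => reverseTarget P X Y (Y ω)) =ᵐ[P]
      P[X | MeasurableSpace.comap Y inferInstance] :=
  (condExp_ae_eq_integral_condDistrib' hY hX).symm

theorem abs_reverseTarget_le {Ω : Type*} [mΩ : MeasurableSpace Ω] {P : Measure Ω}
    [IsProbabilityMeasure P] {X Y : Ω → ℝ} (hX : Measurable X) (hY : Measurable Y) {R : ℝ}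
    (hR : 0 ≤ R) (hXR : ∀ᵐ ω ∂P, |X ω| ≤ R) : ∀ᵐ ω ∂P, |reverseTarget P X Y (Y ω)| ≤ R := by
  have hi : Integrable X P := Integrable.of_bound hX.aestronglyMeasurable R hXR
  lift R to NNReal using hR
  filter_upwards [reverseTarget_ae_eq_condExp hi hY,
    ae_bdd_abs_condExp_of_ae_bdd_abs (m := MeasurableSpace.comap Y inferInstance) hXR] with ω h1 h2
  have h1' : reverseTarget P X Y (Y ω) = _ := h1
  rw [h1']; exact h2

theorem setIntegral_sub_reverseTarget {Ω : Type*} [mΩ : MeasurableSpace Ω] {P : Measure Ω}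
    [IsProbabilityMeasure P] {X Y : Ω → ℝ} (hX : Integrable X P) (hY : Measurable Y) {s : Set ℝ}
    (hs : MeasurableSet s) : ∫ ω in Y ⁻¹' s, (X ω - reverseTarget P X Y (Y ω)) ∂P = 0 := by
  have h1 := reverseTarget_ae_eq_condExp hX hY
  have h2 : Integrable (fun ω => reverseTarget P X Y (Y ω)) P :=
    (integrable_congr h1).2 integrable_condExp
  rw [integral_sub hX.integrableOn h2.integrableOn,
    setIntegral_congr_ae (hY hs) (h1.mono fun ω h _ => h),
    setIntegral_condExp hY.comap_le hX ⟨s, hs, rfl⟩, sub_self]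

/-- The sum over the bins of the squared sums of the reverse fluctuations `x - m(y)`. -/
noncomputable def binFluctuation {n : ℕ} (B : ℕ) (m : ℝ → ℝ) (x y : Fin n → ℝ) : ℝ :=
  ∑ b : Fin B, (∑ i ∈ bin B y b, (x i - m (y i))) ^ 2

theorem measurable_binFluctuation {n : ℕ} (B : ℕ) {m : ℝ → ℝ} (hm : Measurable m) :
    Measurable fun p : (Fin n → ℝ) × (Fin n → ℝ) => binFluctuation B m p.1 p.2 := by
  classical
  refine Finset.measurable_sum _ fun b _ => Measurable.pow_const ?_ 2
  have h : ∀ p : (Fin n → ℝ) × (Fin n → ℝ), ∑ i ∈ bin B p.2 b, (p.1 i - m (p.2 i)) =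
      ∑ i, {p : (Fin n → ℝ) × (Fin n → ℝ) | i ∈ bin B p.2 b}.indicator
        (fun p => p.1 i - m (p.2 i)) p := by
    intro p
    simp only [Set.indicator, Set.mem_ofPred_eq]
    rw [← Finset.sum_filter, Finset.filter_univ_mem]
  simp_rw [h]
  refine Finset.measurable_sum _ fun i _ => Measurable.indicator ?_
    (measurable_snd (measurableSet_mem_bin B b i))
  exact ((measurable_pi_apply i).comp measurable_fst).sub
    (hm.comp ((measurable_pi_apply i).comp measurable_snd))

/-- The bins are functions of the responses, given which the fluctuations are orthogonal. The second
moment of a bin sum is thus at most `(2 * R) ^ 2` times the expected bin size, and the bins being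
disjoint, these sizes sum to at most `n`. -/
theorem lintegral_binFluctuation_le {Ω : Type*} [MeasurableSpace Ω] {P : Measure Ω}
    [IsProbabilityMeasure P] {X ε : ℕ → Ω → ℝ} {σ : ℝ} (hmod : FixedNoiseANM P X ε σ) {f : ℝ → ℝ}
    (hfm : Measurable f) {R : ℝ} (hR : 0 ≤ R) (hXR : ∀ᵐ ω ∂P, |X 0 ω| ≤ R) (n B : ℕ) :
    ∫⁻ ω, ENNReal.ofReal (binFluctuation B (reverseTarget P (X 0) (response f X ε 0))
        (firstN X n ω) (firstN (response f X ε) n ω)) ∂P ≤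
      ENNReal.ofReal ((2 * R) ^ 2 * n) := by
  classical
  set Y := response f X ε with hY
  set m := reverseTarget P (X 0) (Y 0) with hmdef
  have hmm : Measurable m := measurable_reverseTarget P _ _
  have hp0 : Measurable fun ω => (X 0 ω, ε 0 ω) :=
    (hmod.measurable_X 0).prodMk (hmod.measurable_noise 0)
  set μ := P.map fun ω => (X 0 ω, ε 0 ω) with hμ
  have : IsProbabilityMeasure μ := Measure.isProbabilityMeasure_map hp0.aemeasurable
  set π : ℝ × ℝ → ℝ := fun p => f p.1 + p.2 with hπdef
  have hπ : Measurable π := (hfm.comp measurable_fst).add measurable_snd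
  have hYm : Measurable (Y 0) := hπ.comp hp0
  set φ : ℝ × ℝ → ℝ := fun p => p.1 - m (π p) with hφdef
  have hφ : Measurable φ := measurable_fst.sub (hmm.comp hπ)
  have hXi : Integrable (X 0) P :=
    Integrable.of_bound (hmod.measurable_X 0).aestronglyMeasurable R hXR
  have hc : ∀ᵐ p ∂μ, |φ p| ≤ 2 * R := by
    rw [hμ, ae_map_iff hp0.aemeasurable (measurableSet_le hφ.abs measurable_const)]
    filter_upwards [hXR, abs_reverseTarget_le (hmod.measurable_X 0) hYm hR hXR] with ω h1 h2
    exact (abs_sub _ _).trans (by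
      have h2' : |m (π (X 0 ω, ε 0 ω))| ≤ R := h2
      linarith)
  have h0 : ∀ s, MeasurableSet s → ∫ p in π ⁻¹' s, φ p ∂μ = 0 := by
    intro s hs
    rw [hμ, setIntegral_map (hπ hs) hφ.aestronglyMeasurable hp0.aemeasurable]
    exact setIntegral_sub_reverseTarget hXi hYm hs
  have hpairs := hmod.measurePreserving_pairs n
  rw [← hμ] at hpairs
  set ν := Measure.pi fun _ : Fin n => μ with hν
  set G : Fin B → (Fin n → ℝ × ℝ) → ℝ := fun b z =>
    ∑ i, {y | i ∈ bin B y b}.indicator (fun _ => φ (z i)) (π ∘ z) with hG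
  have hπz : Measurable fun z : Fin n → ℝ × ℝ => π ∘ z :=
    measurable_pi_iff.2 fun i => hπ.comp (measurable_pi_apply i)
  have hGm : ∀ b, Measurable (G b) := by
    intro b
    refine Finset.measurable_sum _ fun i _ => ?_
    have : (fun z : Fin n → ℝ × ℝ => {y | i ∈ bin B y b}.indicator (fun _ => φ (z i)) (π ∘ z)) =
        {z : Fin n → ℝ × ℝ | i ∈ bin B (π ∘ z) b}.indicator fun z => φ (z i) := by
      ext z; simp [Set.indicator]
    rw [this]
    exact (hφ.comp (measurable_pi_apply i)).indicator (hπz (measurableSet_mem_bin B b i))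
  have hGF : ∀ ω, binFluctuation B m (firstN X n ω) (firstN Y n ω) =
      ∑ b, G b (fun i => (X i ω, ε i ω)) ^ 2 := by
    intro ω
    refine Finset.sum_congr rfl fun b _ => ?_
    congr 1
    simp only [hG, Set.indicator, Set.mem_ofPred_eq]
    rw [← Finset.sum_filter]
    refine Finset.sum_congr ?_ fun i _ => rfl
    exact (Finset.filter_univ_mem _).symm
  simp_rw [hGF]
  have hGs : Measurable fun z => ∑ b, ENNReal.ofReal (G b z ^ 2) :=
    Finset.measurable_sum _ fun b _ => ENNReal.measurable_ofReal.comp ((hGm b).pow_const 2)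
  calc ∫⁻ ω, ENNReal.ofReal (∑ b, G b (fun i => (X i ω, ε i ω)) ^ 2) ∂P
      = ∫⁻ ω, ∑ b, ENNReal.ofReal (G b (fun i => (X i ω, ε i ω)) ^ 2) ∂P :=
        lintegral_congr fun ω => ENNReal.ofReal_sum_of_nonneg fun b _ => sq_nonneg _
    _ = ∫⁻ z, ∑ b, ENNReal.ofReal (G b z ^ 2) ∂ν := hpairs.lintegral_comp hGs
    _ = ∑ b, ∫⁻ z, ENNReal.ofReal (G b z ^ 2) ∂ν := lintegral_finsetSum _ fun b _ =>
        ENNReal.measurable_ofReal.comp ((hGm b).pow_const 2)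
    _ ≤ ∑ b : Fin B, ENNReal.ofReal ((2 * R) ^ 2 *
          ∑ i, ν.real {z : Fin n → ℝ × ℝ | π ∘ z ∈ {y | i ∈ bin B y b}}) :=
        Finset.sum_le_sum fun b _ => lintegral_sq_sum_indicator_le hπ hφ hc h0
          fun i => measurableSet_mem_bin B b i
    _ = ENNReal.ofReal (∑ b : Fin B, (2 * R) ^ 2 *
          ∑ i, ν.real {z : Fin n → ℝ × ℝ | i ∈ bin B (π ∘ z) b}) := by
        rw [ENNReal.ofReal_sum_of_nonneg fun b _ => by positivity]
        rfl
    _ ≤ ENNReal.ofReal ((2 * R) ^ 2 * n) := by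
        refine ENNReal.ofReal_le_ofReal ?_
        rw [← Finset.mul_sum, Finset.sum_comm]
        refine mul_le_mul_of_nonneg_left ?_ (sq_nonneg _)
        have h1 : ∀ i : Fin n,
            ∑ b : Fin B, ν.real {z : Fin n → ℝ × ℝ | i ∈ bin B (π ∘ z) b} ≤ 1 := by
          intro i
          rw [← measureReal_biUnion_finset]
          · exact measureReal_le_one
          · intro b _ b' _ hbb
            refine Set.disjoint_left.2 fun z hz hz' => hbb (bin_disjoint hz hz')
          · exact fun b _ => hπz (measurableSet_mem_bin B b i)
        calc _ ≤ ∑ _i : Fin n, (1 : ℝ) := Finset.sum_le_sum fun i _ => h1 i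
          _ = n := by simp

/-! ### The score of the binned reverse cloud -/

theorem scale_pos {κ : ℝ} (hκ : 0 < κ) {N : ℕ} (hN : 0 < N) : 0 < scale κ N := by
  have : (0 : ℝ) < N := by exact_mod_cast hN
  unfold scale; positivity

/-- The loss of `2` in `le_card_bin` is at most half the nominal bin size `n / B`. In particular
every bin is occupied, and the random number of points is `B`. -/
theorem le_card_bin_of_four_mul_le {n B : ℕ} (hB : 0 < B) (hn : 4 * B ≤ n) (y : Fin n → ℝ)
    (b : Fin B) : (n : ℝ) / (2 * B) ≤ (bin B y b).card := by
  have hB' : (0 : ℝ) < B := by exact_mod_cast hB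
  have hn' : (4 : ℝ) * B ≤ n := by exact_mod_cast hn
  refine le_trans ?_ (le_card_bin B y b)
  have h1 : (2 : ℝ) ≤ n / (2 * B) := by rw [le_div_iff₀ (by positivity)]; linarith
  have h2 : ((n : ℝ) + 1) / B = n / (2 * B) + n / (2 * B) + 1 / B := by field_simp; ring
  have h3 : (0 : ℝ) < 1 / B := by positivity
  linarith

theorem bin_nonempty_of_four_mul_le {n B : ℕ} (hB : 0 < B) (hn : 4 * B ≤ n) (y : Fin n → ℝ)
    (b : Fin B) : (bin B y b).Nonempty := by
  have hB' : (0 : ℝ) < B := by exact_mod_cast hB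
  have hn' : (0 : ℝ) < n := by exact_mod_cast (by omega : 0 < n)
  have h1 := le_card_bin_of_four_mul_le hB hn y b
  have h2 : (0 : ℝ) < n / (2 * B) := by positivity
  exact Finset.card_pos.1 (by exact_mod_cast h2.trans_le h1)

theorem numBins_eq_of_four_mul_le {n B : ℕ} (hB : 0 < B) (hn : 4 * B ≤ n) (y : Fin n → ℝ) :
    numBins B y = B := by
  classical
  have h := bin_nonempty_of_four_mul_le hB hn y
  have : Fintype.card (NonemptyBin B y) = Fintype.card (Fin B) :=
    Fintype.card_congr (Equiv.subtypeUnivEquiv h)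
  unfold numBins
  convert this
  simp

theorem maxBinError_nonneg {n K : ℕ} {fold : Fin n → Fin K} (B : ℕ) (ghat : CrossFit fold)
    (m : ℝ → ℝ) (x y : Fin n → ℝ) : 0 ≤ maxBinError B ghat m x y :=
  Real.iSup_nonneg fun _ => abs_nonneg _

theorem abs_binMean_reverseResidual_le {n K : ℕ} {fold : Fin n → Fin K} {B : ℕ}
    (hB : 0 < B) (hn : 4 * B ≤ n) (ghat : CrossFit fold) (m : ℝ → ℝ) (x y : Fin n → ℝ)
    (b : Fin B) : |binMean (bin B y b) (reverseResidual ghat x y)| ≤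
      2 * B / n * |∑ i ∈ bin B y b, (x i - m (y i))| + maxBinError B ghat m x y := by
  have hB' : (0 : ℝ) < B := by exact_mod_cast hB
  have hn' : (0 : ℝ) < n := by exact_mod_cast (by omega : 0 < n)
  have h1 := le_card_bin_of_four_mul_le hB hn y b
  have h2 : (0 : ℝ) < n / (2 * B) := by positivity
  have h3 : binMean (bin B y b) (reverseResidual ghat x y) =
      (∑ i ∈ bin B y b, (x i - m (y i))) / (bin B y b).card - binMean (bin B y b)
        fun i => ghat (fold i) (training fold (fold i) x y) (y i) - m (y i) := by
    unfold binMean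
    rw [← sub_div, ← Finset.sum_sub_distrib]
    congr 1
    refine Finset.sum_congr rfl fun i _ => ?_
    unfold reverseResidual; ring
  rw [h3]
  refine (abs_sub _ _).trans (add_le_add ?_ ?_)
  · rw [abs_div, Nat.abs_cast]
    calc |∑ i ∈ bin B y b, (x i - m (y i))| / (bin B y b).card
        ≤ |∑ i ∈ bin B y b, (x i - m (y i))| / (n / (2 * B)) := by gcongr
      _ = _ := by field_simp
  · exact le_ciSup (f := fun b : NonemptyBin B y => |binMean (bin B y b.1) fun i =>
      ghat (fold i) (training fold (fold i) x y) (y i) - m (y i)|) (Set.finite_range _).bddAbove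
      ⟨b, bin_nonempty_of_four_mul_le hB hn y b⟩

/-- Visit the bins in order. Consecutive horizontal coordinates differ by at most `2 / B`, over `B -
1` edges, and each height enters at most two edges. -/
theorem totalWeight_mst_binnedCloud_le {n K : ℕ} {fold : Fin n → Fin K} {B : ℕ}
    (hB : 0 < B) (hn : 4 * B ≤ n) (ghat : CrossFit fold) (x y : Fin n → ℝ) :
    totalWeight (binnedCloud B ghat x y) (mst (binnedCloud B ghat x y)) ≤
      2 + 2 * ∑ b : Fin B, |binMean (bin B y b) (reverseResidual ghat x y)| := by
  classical
  obtain ⟨M, rfl⟩ : ∃ M, B = M + 1 := ⟨B - 1, by omega⟩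
  have hne := bin_nonempty_of_four_mul_le hB hn y
  set V : Fin (M + 1) → ℝ := fun b => binMean (bin (M + 1) y b) (reverseResidual ghat x y) with hV
  refine (totalWeight_mst_le_path _ (Equiv.subtypeUnivEquiv hne).symm).trans ?_
  have h1 : ∀ k : Fin M, dist
      (binnedCloud (M + 1) ghat x y ((Equiv.subtypeUnivEquiv hne).symm k.castSucc))
      (binnedCloud (M + 1) ghat x y ((Equiv.subtypeUnivEquiv hne).symm k.succ)) ≤
      2 / ((M : ℝ) + 1) + (|V k.castSucc| + |V k.succ|) := by
    intro k
    refine (dist_mk_le _ _ _ _).trans (add_le_add ?_ (abs_sub _ _))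
    have a1 := binMean_mem_Icc (hne k.castSucc)
    have a2 := binMean_mem_Icc (hne k.succ)
    simp only [Fin.val_castSucc, Fin.val_succ, Set.mem_Icc] at a1 a2
    push_cast at a1 a2
    have e1 : ((k : ℝ) + 1 + 1) / ((M : ℝ) + 1) = k / ((M : ℝ) + 1) + 2 / ((M : ℝ) + 1) := by ring
    have e2 : ((k : ℝ) + 1) / ((M : ℝ) + 1) = k / ((M : ℝ) + 1) + 1 / ((M : ℝ) + 1) := by ring
    have e3 : (0 : ℝ) < 1 / ((M : ℝ) + 1) := by positivity
    simp only [Equiv.subtypeUnivEquiv_symm_apply]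
    rw [abs_le]
    constructor <;> linarith [a1.1, a1.2, a2.1, a2.2]
  refine (Finset.sum_le_sum fun k _ => h1 k).trans ?_
  rw [Finset.sum_add_distrib, Finset.sum_add_distrib]
  have h2 : ∑ k : Fin M, |V k.castSucc| ≤ ∑ b, |V b| := by
    rw [Fin.sum_univ_castSucc]
    exact le_add_of_nonneg_right (abs_nonneg _)
  have h3 : ∑ k : Fin M, |V k.succ| ≤ ∑ b, |V b| := by
    rw [Fin.sum_univ_succ (f := fun b => |V b|)]
    exact le_add_of_nonneg_left (abs_nonneg _)
  have h4 : ∑ _k : Fin M, 2 / ((M : ℝ) + 1) ≤ 2 := by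
    rw [Finset.sum_const, Finset.card_univ, Fintype.card_fin, nsmul_eq_mul, mul_div_assoc',
      div_le_iff₀ (by positivity)]
    linarith
  linarith

/-- The score of the binned reverse cloud is small if the fluctuations and the regression errors
average out in the bins. -/
theorem binnedScore_le {n K : ℕ} {fold : Fin n → Fin K} {B : ℕ} (hB : 2 ≤ B) (hn : 4 * B ≤ n)
    {κ cβ : ℝ} (hκ : 0 < κ) (hcβ : 1 < cβ) (ghat : CrossFit fold) (m : ℝ → ℝ) (x y : Fin n → ℝ) :
    binnedScore κ cβ B ghat x y ≤ 4 / (B * scale κ B) +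
      Real.sqrt (64 * B / (n * scale κ B) ^ 2 * binFluctuation B m x y) +
      4 * (maxBinError B ghat m x y / scale κ (numBins B y)) := by
  have hB0 : 0 < B := by omega
  have hnB := numBins_eq_of_four_mul_le hB0 hn y
  have hB' : (2 : ℝ) ≤ B := by exact_mod_cast hB
  have hn' : (0 : ℝ) < n := by exact_mod_cast (by omega : 0 < n)
  set α := scale κ B with hα
  have hα0 : 0 < α := scale_pos hκ hB0
  set Q := binFluctuation B m x y with hQ
  set η := maxBinError B ghat m x y with hη
  set S : Fin B → ℝ := fun b => ∑ i ∈ bin B y b, (x i - m (y i)) with hS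
  have h1 : binnedScore κ cβ B ghat x y ≤
      totalWeight (binnedCloud B ghat x y) (mst (binnedCloud B ghat x y)) / (((B : ℝ) - 1) * α) := by
    have hcard : Fintype.card (NonemptyBin B y) = B := hnB
    have h := score_le_totalWeight (β := cβ * α) hα0 (by nlinarith) (hcard.symm ▸ hB)
      (binnedCloud B ghat x y)
    rw [hcard] at h
    unfold binnedScore
    rwa [hnB]
  have h2 := totalWeight_mst_binnedCloud_le hB0 hn ghat x y
  have h3 : ∑ b : Fin B, |binMean (bin B y b) (reverseResidual ghat x y)| ≤
      2 * B / n * ∑ b, |S b| + B * η := by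
    refine (Finset.sum_le_sum fun b _ =>
      abs_binMean_reverseResidual_le hB0 hn ghat m x y b).trans ?_
    rw [Finset.sum_add_distrib, ← Finset.mul_sum]
    simp [hS, hη]
  -- Cauchy–Schwarz over the `B` bins.
  have h4 : ∑ b, |S b| ≤ Real.sqrt (B * Q) := by
    refine Real.le_sqrt_of_sq_le ?_
    have h := sq_sum_le_card_mul_sum_sq (s := Finset.univ) (f := fun b => |S b|)
    simpa [sq_abs, hQ, binFluctuation, hS] using h
  have h5 : Real.sqrt (64 * B / (n * α) ^ 2 * Q) = 8 / (n * α) * Real.sqrt (B * Q) := by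
    have : 64 * B / (n * α) ^ 2 * Q = (8 / (n * α)) ^ 2 * (B * Q) := by ring
    rw [this, Real.sqrt_mul (sq_nonneg _), Real.sqrt_sq (by positivity)]
  have hηn : 0 ≤ η := maxBinError_nonneg _ _ _ _ _
  rw [hnB, h5, ← hα]
  have h6 : totalWeight (binnedCloud B ghat x y) (mst (binnedCloud B ghat x y)) ≤
      2 + 2 * (2 * B / n * Real.sqrt (B * Q) + B * η) := by
    have : 2 * B / n * ∑ b, |S b| ≤ 2 * B / n * Real.sqrt (B * Q) := by gcongr
    linarith
  calc binnedScore κ cβ B ghat x y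
      ≤ (2 + 2 * (2 * B / n * Real.sqrt (B * Q) + B * η)) / (((B : ℝ) - 1) * α) :=
        h1.trans (div_le_div_of_nonneg_right h6 (by nlinarith))
    _ ≤ (2 + 2 * (2 * B / n * Real.sqrt (B * Q) + B * η)) / ((B : ℝ) / 2 * α) := by
        gcongr
        linarith
    _ = _ := by field_simp; ring

/-- The source of the exponent `7 / 3`: the fluctuation term has mean of order `B / (n * α ^ 2)`, a
constant multiple of `B^(7/3) / n`. -/
theorem scale_sq {κ : ℝ} {N : ℕ} (hN : 0 < N) :
    (N : ℝ) ^ ((7 : ℝ) / 3) * scale κ N ^ 2 = κ ^ 2 * N := by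
  have hN' : (0 : ℝ) < N := by exact_mod_cast hN
  unfold scale
  rw [mul_pow, ← Real.rpow_natCast ((N : ℝ) ^ (-(2 : ℝ) / 3)) 2, ← Real.rpow_mul hN'.le,
    mul_left_comm, ← Real.rpow_add hN']
  norm_num

theorem tendsto_four_div_mul_scale {κ : ℝ} (hκ : 0 < κ) {B : ℕ → ℕ} (hB : Tendsto B atTop atTop) :
    Tendsto (fun n => 4 / (B n * scale κ (B n))) atTop (𝓝 0) := by
  have h1 : Tendsto (fun n => κ * (B n : ℝ) ^ ((1 : ℝ) / 3)) atTop atTop :=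
    ((tendsto_rpow_atTop (by norm_num)).comp
      (tendsto_natCast_atTop_atTop.comp hB)).const_mul_atTop hκ
  refine ((tendsto_const_nhds (x := (4 : ℝ))).div_atTop h1).congr' ?_
  filter_upwards [hB.eventually_gt_atTop 0] with n hn
  have hN' : (0 : ℝ) < B n := by exact_mod_cast hn
  congr 1
  unfold scale
  rw [mul_left_comm]
  congr 1
  nth_rw 2 [← Real.rpow_one (B n : ℝ)]
  rw [← Real.rpow_add hN']
  norm_num

theorem tendsto_rate_without_log {B : ℕ → ℕ} (hB : Tendsto B atTop atTop)
    (h : Tendsto (fun n : ℕ => (B n : ℝ) ^ ((7 : ℝ) / 3) * Real.log (B n : ℝ) / (n : ℝ)) atTop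
      (𝓝 0)) : Tendsto (fun n : ℕ => (B n : ℝ) ^ ((7 : ℝ) / 3) / (n : ℝ)) atTop (𝓝 0) := by
  refine squeeze_zero' (Eventually.of_forall fun n => by positivity) ?_ h
  have h1 : Tendsto (fun n => Real.log (B n : ℝ)) atTop atTop :=
    Real.tendsto_log_atTop.comp (tendsto_natCast_atTop_atTop.comp hB)
  filter_upwards [h1.eventually_ge_atTop 1] with n hn
  gcongr
  exact le_mul_of_one_le_right (by positivity) hn

theorem FixedNoiseANM.measurable_sample {Ω : Type*} [MeasurableSpace Ω] {P : Measure Ω}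
    {X ε : ℕ → Ω → ℝ} {σ : ℝ} (h : FixedNoiseANM P X ε σ) {f : ℝ → ℝ} (hf : Measurable f) (n : ℕ) :
    Measurable fun ω => (firstN X n ω, firstN (response f X ε) n ω) := by
  refine Measurable.prodMk (measurable_pi_iff.2 fun i => h.measurable_X i)
    (measurable_pi_iff.2 fun i => ?_)
  exact (hf.comp (h.measurable_X i)).add (h.measurable_noise i)

/-- The score of the binned reverse cloud tends to zero in probability. -/
theorem tendstoInMeasure_binnedScore {Ω : Type*} [MeasurableSpace Ω] {P : Measure Ω}
    [IsProbabilityMeasure P] {X ε : ℕ → Ω → ℝ} {σ : ℝ} (hmod : FixedNoiseANM P X ε σ) {f : ℝ → ℝ}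
    (hfm : Measurable f) {a b : ℝ} (hX : ∀ᵐ ω ∂P, X 0 ω ∈ Icc a b)
    {κ cβ : ℝ} (hκ : 0 < κ) (hcβ : 1 < cβ) {K : ℕ} {fold : (n : ℕ) → Fin n → Fin K}
    (ghat : (n : ℕ) → CrossFit (fold n)) {B : ℕ → ℕ} (hB : Tendsto B atTop atTop)
    (hB_o : Tendsto (fun n : ℕ => (B n : ℝ) / (n : ℝ)) atTop (𝓝 0))
    (hB_rate : Tendsto
      (fun n : ℕ => (B n : ℝ) ^ ((7 : ℝ) / 3) * Real.log (B n : ℝ) / (n : ℝ)) atTop (𝓝 0))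
    (hbin : TendstoInMeasure P
      (fun (n : ℕ) ω => maxBinError (B n) (ghat n) (reverseTarget P (X 0) (response f X ε 0))
            (firstN X n ω) (firstN (response f X ε) n ω) /
          scale κ (numBins (B n) (firstN (response f X ε) n ω)))
      atTop (fun _ => (0 : ℝ))) :
    TendstoInMeasure P
      (fun (n : ℕ) ω => binnedScore κ cβ (B n) (ghat n)
        (firstN X n ω) (firstN (response f X ε) n ω))
      atTop (fun _ => (0 : ℝ)) := by
  set m := reverseTarget P (X 0) (response f X ε 0) with hm
  have hmm : Measurable m := measurable_reverseTarget P _ _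
  set R := max |a| |b| with hRdef
  have hR : 0 ≤ R := le_max_of_le_left (abs_nonneg a)
  have hXR : ∀ᵐ ω ∂P, |X 0 ω| ≤ R := hX.mono fun ω h => abs_le_max_abs_abs h.1 h.2
  have hxy := hmod.measurable_sample hfm
  set D : ℕ → Ω → ℝ := fun n ω => 64 * B n / (n * scale κ (B n)) ^ 2 *
    binFluctuation (B n) m (firstN X n ω) (firstN (response f X ε) n ω) with hD
  have hDm : ∀ n, Measurable (D n) := fun n =>
    ((measurable_binFluctuation (B n) hmm).comp (hxy n)).const_mul _
  have hD0 : ∀ n ω, 0 ≤ D n ω := fun n ω =>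
    mul_nonneg (by positivity) (Finset.sum_nonneg fun _ _ => sq_nonneg _)
  have hBn : ∀ᶠ n in atTop, 2 ≤ B n ∧ 4 * B n ≤ n := by
    filter_upwards [hB.eventually_ge_atTop 2, hB_o.eventually_lt_const
      (show (0 : ℝ) < 1 / 4 by norm_num), eventually_gt_atTop 0] with n h1 h2 h3
    have h3' : (0 : ℝ) < n := by exact_mod_cast h3
    rw [div_lt_iff₀ h3'] at h2
    refine ⟨h1, ?_⟩
    have : (4 : ℝ) * B n ≤ n := by linarith
    exact_mod_cast this
  have hDt : TendstoInMeasure P D atTop fun _ => 0 := by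
    refine tendstoInMeasure_of_lintegral hDm ?_
    have h1 : Tendsto (fun n : ℕ => ENNReal.ofReal
        (64 * (2 * R) ^ 2 / κ ^ 2 * ((B n : ℝ) ^ ((7 : ℝ) / 3) / n))) atTop (𝓝 0) := by
      have := ENNReal.tendsto_ofReal ((tendsto_rate_without_log hB hB_rate).const_mul
        (64 * (2 * R) ^ 2 / κ ^ 2))
      simpa using this
    refine tendsto_of_tendsto_of_tendsto_of_le_of_le' tendsto_const_nhds h1
      (Eventually.of_forall fun _ => zero_le) ?_
    filter_upwards [hBn] with n hn
    have hB0 : 0 < B n := by omega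
    have hB' : (0 : ℝ) < B n := by exact_mod_cast hB0
    have hn' : (0 : ℝ) < n := by exact_mod_cast (by omega : 0 < n)
    have hα := scale_pos hκ hB0
    have h2 : ∀ ω, ENNReal.ofReal |D n ω - 0| = ENNReal.ofReal
        (64 * B n / (n * scale κ (B n)) ^ 2) * ENNReal.ofReal
        (binFluctuation (B n) m (firstN X n ω) (firstN (response f X ε) n ω)) := by
      intro ω
      rw [sub_zero, abs_of_nonneg (hD0 n ω), ← ENNReal.ofReal_mul (by positivity)]
    simp_rw [h2]
    rw [lintegral_const_mul' _ _ ENNReal.ofReal_ne_top]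
    refine (mul_le_mul_right (lintegral_binFluctuation_le hmod hfm hR hXR n (B n)) _).trans ?_
    rw [← ENNReal.ofReal_mul (by positivity)]
    refine ENNReal.ofReal_le_ofReal (le_of_eq ?_)
    have h3 := scale_sq (κ := κ) hB0
    have h4 : (B n : ℝ) = (B n : ℝ) ^ ((7 : ℝ) / 3) * scale κ (B n) ^ 2 / κ ^ 2 := by
      rw [h3]; field_simp
    nth_rw 1 [h4]
    field_simp
  rw [tendstoInMeasure_iff_norm] at hDt hbin ⊢
  intro η hη
  -- Each of the three terms of `binnedScore_le` is allowed `η / 3`: the fluctuations stand under a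
  -- square root, and the regression error carries a factor `4`.
  have h1 := (hDt ((η / 3) ^ 2) (by positivity)).add (hbin (η / 12) (by positivity))
  rw [add_zero] at h1
  refine tendsto_of_tendsto_of_tendsto_of_le_of_le' tendsto_const_nhds h1
    (Eventually.of_forall fun _ => zero_le) ?_
  filter_upwards [hBn, (tendsto_four_div_mul_scale hκ hB).eventually_lt_const
    (show 0 < η / 3 by positivity)] with n hn hsmall
  refine (measure_mono fun ω hω => ?_).trans (measure_union_le _ _)
  by_contra hcon
  simp only [Set.mem_union, Set.mem_ofPred_eq, not_or, not_le, sub_zero, Real.norm_eq_abs] at hcon hω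
  have h2 := binnedScore_le hn.1 hn.2 hκ hcβ (ghat n) m (firstN X n ω)
    (firstN (response f X ε) n ω)
  have h3 : Real.sqrt (D n ω) < η / 3 := by
    rw [Real.sqrt_lt' (by positivity)]
    exact (le_abs_self _).trans_lt hcon.1
  have h4 := (le_abs_self _).trans_lt hcon.2
  have hsc : 0 ≤ scale κ (numBins (B n) (firstN (response f X ε) n ω)) := by
    unfold scale; positivity
  have h5 : 0 ≤ binnedScore κ cβ (B n) (ghat n) (firstN X n ω) (firstN (response f X ε) n ω) :=
    score_nonneg (by nlinarith) _
  rw [abs_of_nonneg h5] at hω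
  linarith

/-! ### Ranges of the scores, convergence in mean and conclusion -/

theorem scale_nonneg {κ : ℝ} (hκ : 0 ≤ κ) (N : ℕ) : 0 ≤ scale κ N := by
  unfold scale; positivity

theorem le_mul_scale {κ cβ : ℝ} (hκ : 0 < κ) (hcβ : 1 < cβ) (N : ℕ) :
    scale κ N ≤ cβ * scale κ N :=
  le_mul_of_one_le_left (scale_nonneg hκ.le N) hcβ.le

theorem tendstoInMeasure_sub {Ω : Type*} [MeasurableSpace Ω] {P : Measure Ω}
    {u v : ℕ → Ω → ℝ} {a b : ℝ} (hu : TendstoInMeasure P u atTop fun _ => a)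
    (hv : TendstoInMeasure P v atTop fun _ => b) :
    TendstoInMeasure P (fun n ω => u n ω - v n ω) atTop fun _ => a - b := by
  rw [tendstoInMeasure_iff_norm] at *
  intro η hη
  have h := (hu (η / 2) (half_pos hη)).add (hv (η / 2) (half_pos hη))
  rw [add_zero] at h
  refine tendsto_of_tendsto_of_tendsto_of_le_of_le tendsto_const_nhds h (fun _ => zero_le)
    fun n => (measure_mono fun ω hω => ?_).trans (measure_union_le _ _)
  by_contra hcon
  simp only [Set.mem_union, Set.mem_ofPred_eq, not_or, not_le] at hcon hω
  have h1 : u n ω - v n ω - (a - b) = (u n ω - a) - (v n ω - b) := by ring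
  rw [h1] at hω
  have h2 := norm_sub_le (u n ω - a) (v n ω - b)
  linarith [hcon.1, hcon.2]

/-- Bounded convergence: a deviation is at most `η / 2` off an event of vanishing probability, and
at most `C` on it. -/
theorem tendsto_integral_of_tendstoInMeasure {Ω : Type*} [MeasurableSpace Ω] {P : Measure Ω}
    [IsProbabilityMeasure P] {u : ℕ → Ω → ℝ} {a C : ℝ} (hu : ∀ n, Measurable (u n))
    (hC : ∀ n ω, |u n ω - a| ≤ C) (h : TendstoInMeasure P u atTop fun _ => a) :
    Tendsto (fun n => ∫ ω, u n ω ∂P) atTop (𝓝 a) := by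
  rw [tendstoInMeasure_iff_measureReal_norm] at h
  rw [Metric.tendsto_atTop']
  intro η hη
  have h1 := (h (η / 2) (half_pos hη)).const_mul C
  rw [mul_zero] at h1
  obtain ⟨N, hN⟩ := eventually_atTop.1 (h1.eventually_lt_const (half_pos hη))
  refine ⟨N, fun n hn => ?_⟩
  have hd : Measurable fun ω => u n ω - a := (hu n).sub_const a
  have hdi : Integrable (fun ω => u n ω - a) P :=
    Integrable.of_bound hd.aestronglyMeasurable C (ae_of_all _ (hC n))
  have hui : Integrable (u n) P := by
    refine (hdi.add (integrable_const a)).congr (ae_of_all _ fun ω => ?_)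
    simp
  have hS : MeasurableSet {ω | η / 2 ≤ ‖u n ω - a‖} := measurableSet_le measurable_const hd.norm
  rw [Real.dist_eq]
  calc |∫ ω, u n ω ∂P - a| = |∫ ω, (u n ω - a) ∂P| := by
        rw [integral_sub hui (integrable_const a)]; simp
    _ ≤ ∫ ω, |u n ω - a| ∂P := abs_integral_le_integral_abs
    _ ≤ ∫ ω, ({ω | η / 2 ≤ ‖u n ω - a‖}.indicator (fun _ => C) ω + η / 2) ∂P := by
        refine integral_mono hdi.abs
          (((integrable_const C).indicator hS).add (integrable_const _)) fun ω => ?_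
        simp only [Set.indicator, Set.mem_ofPred_eq, Real.norm_eq_abs]
        split_ifs with h2
        · linarith [hC n ω]
        · linarith
    _ = C * P.real {ω | η / 2 ≤ ‖u n ω - a‖} + η / 2 := by
        rw [integral_add ((integrable_const C).indicator hS) (integrable_const _),
          integral_indicator_const _ hS]
        simp [mul_comm]
    _ < η := by linarith [hN n hn.le]

theorem forwardScore_mem_Icc {n K : ℕ} {fold : Fin n → Fin K} {κ cβ : ℝ} (hκ : 0 < κ)
    (hcβ : 1 < cβ) (fhat : CrossFit fold) (x y : Fin n → ℝ) :
    forwardScore κ cβ fhat x y ∈ Icc (0 : ℝ) 1 :=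
  ⟨score_nonneg (le_mul_scale hκ hcβ _) _, score_le_one (le_mul_scale hκ hcβ _) _⟩

theorem binnedScore_mem_Icc {n K : ℕ} {fold : Fin n → Fin K} {κ cβ : ℝ} (hκ : 0 < κ)
    (hcβ : 1 < cβ) (B : ℕ) (ghat : CrossFit fold) (x y : Fin n → ℝ) :
    binnedScore κ cβ B ghat x y ∈ Icc (0 : ℝ) 1 :=
  ⟨score_nonneg (le_mul_scale hκ hcβ _) _, score_le_one (le_mul_scale hκ hcβ _) _⟩

theorem trasScore_mem_Icc {n K : ℕ} {fold : Fin n → Fin K} {κ cβ : ℝ} (hκ : 0 < κ)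
    (hcβ : 1 < cβ) (B : ℕ) (fhat ghat : CrossFit fold) (x y : Fin n → ℝ) :
    trasScore κ cβ B fhat ghat x y ∈ Icc (-1 : ℝ) 1 := by
  have h1 := forwardScore_mem_Icc hκ hcβ fhat x y
  have h2 := binnedScore_mem_Icc hκ hcβ B ghat x y
  unfold trasScore
  exact ⟨by linarith [h1.1, h2.2], by linarith [h1.2, h2.1]⟩

theorem measurable_trasScore {n K : ℕ} {fold : Fin n → Fin K} {fhat ghat : CrossFit fold}
    (hf : ∀ k, Measurable (Function.uncurry (fhat k)))
    (hg : ∀ k, Measurable (Function.uncurry (ghat k))) (κ cβ : ℝ) (B : ℕ) :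
    Measurable fun p : (Fin n → ℝ) × (Fin n → ℝ) => trasScore κ cβ B fhat ghat p.1 p.2 :=
  (measurable_forwardScore hf κ cβ).sub (measurable_binnedScore hg κ cβ B)

/-- The forward score tends to one in probability. -/
theorem tendstoInMeasure_forwardScore {Ω : Type*} [MeasurableSpace Ω] {P : Measure Ω}
    [IsProbabilityMeasure P] {X ε : ℕ → Ω → ℝ} {σ : ℝ} (hmod : FixedNoiseANM P X ε σ) {f : ℝ → ℝ}
    (hfm : Measurable f) (hdens : ∃ p : ℝ → ℝ, Continuous p ∧ (∀ z, 0 ≤ p z) ∧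
      P.map (ε 0) = volume.withDensity fun z => ENNReal.ofReal (p z))
    {κ cβ : ℝ} (hκ : 0 < κ) (hcβ : 1 < cβ) {K : ℕ} {fold : (n : ℕ) → Fin n → Fin K}
    {fhat : (n : ℕ) → CrossFit (fold n)} (hf : ∀ n k, Measurable (Function.uncurry (fhat n k)))
    (hrisk : ∀ k : Fin K, Tendsto
      (fun n : ℕ => ∫⁻ ω, ∫⁻ x, ENNReal.ofReal
        ((fhat n k (training (fold n) k (firstN X n ω)
          (firstN (response f X ε) n ω)) x - f x) ^ 2) ∂(P.map (X 0)) ∂P) atTop (𝓝 0)) :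
    TendstoInMeasure P (fun (n : ℕ) ω => forwardScore κ cβ (fhat n) (firstN X n ω)
      (firstN (response f X ε) n ω)) atTop fun _ => (1 : ℝ) := by
  have hm : ∀ n, Measurable fun ω => forwardScore κ cβ (fhat n) (firstN X n ω)
      (firstN (response f X ε) n ω) := by
    intro n
    have h := (measurable_forwardScore (hf n) κ cβ).comp (hmod.measurable_sample hfm n)
    exact h
  refine tendstoInMeasure_of_lintegral hm ?_
  refine (tendsto_lintegral_forwardScore_deficit hmod hfm hdens hκ hcβ hf hrisk).congr
    fun n => lintegral_congr fun ω => ?_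
  rw [abs_sub_comm, abs_of_nonneg (sub_nonneg.2 (forwardScore_mem_Icc hκ hcβ _ _ _).2)]

end TRA

theorem theorem2 {Ω : Type*} [MeasurableSpace Ω] (P : Measure Ω) [IsProbabilityMeasure P]
    -- the fixed-noise model `Y = f(X) + ε` and its forward regularity
    (X ε : ℕ → Ω → ℝ) (f : ℝ → ℝ) (a b σ : ℝ)
    (hmodel : TRA.FixedNoiseANM P X ε σ)
    (hforward : TRA.ForwardRegular P X ε f a b)
    -- window constants
    (κ cβ : ℝ) (hκ : 0 < κ) (hcβ : 1 < cβ)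
    -- deterministic folds and cross-fitted regressors
    (K : ℕ) (hK : 2 ≤ K) (fold : (n : ℕ) → Fin n → Fin K)
    (fhat ghat : (n : ℕ) → TRA.CrossFit (fold n))
    (hfhat_meas : ∀ n k, Measurable (Function.uncurry (fhat n k)))
    (hghat_meas : ∀ n k, Measurable (Function.uncurry (ghat n k)))
    -- forward `L²`-risk consistency
    (hrisk : ∀ k : Fin K, Tendsto
      (fun n : ℕ => ∫⁻ ω, ∫⁻ x, ENNReal.ofReal
        ((fhat n k (TRA.training (fold n) k (TRA.firstN X n ω)
          (TRA.firstN (TRA.response f X ε) n ω)) x - f x) ^ 2) ∂(P.map (X 0)) ∂P)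
      atTop (𝓝 0))
    -- growth of the number of bins
    (B : ℕ → ℕ) (hB : Tendsto B atTop atTop)
    (hB_o : Tendsto (fun n : ℕ => (B n : ℝ) / (n : ℝ)) atTop (𝓝 0))
    (hB_rate : Tendsto
      (fun n : ℕ => (B n : ℝ) ^ ((7 : ℝ) / 3) * Real.log (B n : ℝ) / (n : ℝ)) atTop (𝓝 0))
    -- conditionally sub-Gaussian reverse fluctuations `ξ = X - m(Y)`
    (K₀ : ℝ)
    (hsubG : ∀ᵐ y ∂(P.map (TRA.response f X ε 0)),
      TRA.psi2Norm ((condDistrib (X 0) (TRA.response f X ε 0) P y).map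
        fun x => x - TRA.reverseTarget P (X 0) (TRA.response f X ε 0) y)
        ≤ ENNReal.ofReal (K₀ * σ))
    -- the bin-averaged reverse regression error is negligible at the binned window scale
    (hbin : TendstoInMeasure P
      (fun (n : ℕ) ω =>
        TRA.maxBinError (B n) (ghat n) (TRA.reverseTarget P (X 0) (TRA.response f X ε 0))
            (TRA.firstN X n ω) (TRA.firstN (TRA.response f X ε) n ω) /
          TRA.scale κ (TRA.numBins (B n) (TRA.firstN (TRA.response f X ε) n ω)))
      atTop (fun _ => (0 : ℝ))) :
    -- the forward score tends to one in probability
    TendstoInMeasure P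
      (fun (n : ℕ) ω => TRA.forwardScore κ cβ (fhat n)
        (TRA.firstN X n ω) (TRA.firstN (TRA.response f X ε) n ω))
      atTop (fun _ => (1 : ℝ)) ∧
    -- the score of the binned reverse cloud tends to zero in probability
    TendstoInMeasure P
      (fun (n : ℕ) ω => TRA.binnedScore κ cβ (B n) (ghat n)
        (TRA.firstN X n ω) (TRA.firstN (TRA.response f X ε) n ω))
      atTop (fun _ => (0 : ℝ)) ∧
    -- the score difference takes values in `[-1, 1]` and tends to one in probability and in mean
    (∀ (n : ℕ) (ω : Ω), TRA.trasScore κ cβ (B n) (fhat n) (ghat n)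
        (TRA.firstN X n ω) (TRA.firstN (TRA.response f X ε) n ω) ∈ Set.Icc (-1 : ℝ) 1) ∧
    TendstoInMeasure P
      (fun (n : ℕ) ω => TRA.trasScore κ cβ (B n) (fhat n) (ghat n)
        (TRA.firstN X n ω) (TRA.firstN (TRA.response f X ε) n ω))
      atTop (fun _ => (1 : ℝ)) ∧
    (∀ n : ℕ, Integrable
      (fun ω => TRA.trasScore κ cβ (B n) (fhat n) (ghat n)
        (TRA.firstN X n ω) (TRA.firstN (TRA.response f X ε) n ω)) P) ∧
    Tendsto
      (fun n : ℕ => ∫ ω, TRA.trasScore κ cβ (B n) (fhat n) (ghat n)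
        (TRA.firstN X n ω) (TRA.firstN (TRA.response f X ε) n ω) ∂P)
      atTop (𝓝 1) := by
  have hfm := hforward.measurable_f
  have hforwardLimit := TRA.tendstoInMeasure_forwardScore hmodel hfm hforward.density hκ hcβ
    hfhat_meas hrisk
  have hreverseLimit := TRA.tendstoInMeasure_binnedScore hmodel hfm hforward.mem_interval hκ hcβ
    ghat hB hB_o hB_rate hbin
  have hdiff := TRA.tendstoInMeasure_sub hforwardLimit hreverseLimit
  rw [sub_zero] at hdiff
  have hm : ∀ n, Measurable fun ω => TRA.trasScore κ cβ (B n) (fhat n) (ghat n)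
      (TRA.firstN X n ω) (TRA.firstN (TRA.response f X ε) n ω) := by
    intro n
    have h := (TRA.measurable_trasScore (hfhat_meas n) (hghat_meas n) κ cβ (B n)).comp
      (hmodel.measurable_sample hfm n)
    exact h
  have hT : ∀ (n : ℕ) (ω : Ω), TRA.trasScore κ cβ (B n) (fhat n) (ghat n)
      (TRA.firstN X n ω) (TRA.firstN (TRA.response f X ε) n ω) ∈ Set.Icc (-1 : ℝ) 1 :=
    fun n ω => TRA.trasScore_mem_Icc hκ hcβ _ _ _ _ _
  refine ⟨hforwardLimit, hreverseLimit, hT, hdiff, fun n => ?_, ?_⟩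
  · exact Integrable.of_bound (hm n).aestronglyMeasurable 1
      (ae_of_all _ fun ω => abs_le.2 (hT n ω))
  -- A value in `[-1, 1]` differs from the limit `1` by at most `2`.
  · refine TRA.tendsto_integral_of_tendstoInMeasure (C := 2) hm (fun n ω => ?_) hdiff
    rw [abs_le]
    constructor <;> linarith [(hT n ω).1, (hT n ω).2]
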